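/- Let $\lambda$ be a limit ordinal and let $\mathcal{E}_\lambda$ be the set of nontrivial (that is, different from the identity) elementary embeddings $j\colon (V_\lambda,\in)\to(V_\lambda,\in)$. For $j\in\mathcal{E}_\lambda$ and $A\subseteq V_\lambda$ put $j\cdot A=\bigcup_{\alpha<\lambda}j(A\cap V_\alpha)$. Every function from $V_\lambda$ to $V_\lambda$ is identified with its graph, a subset of $V_\lambda$; so $j\cdot k$ makes sense for $j,k\in\mathcal{E}_\lambda$. Let $m$ be a natural number. A formula of second-order set theory is $\Sigma^1_0$ (equivalently $\Pi^1_0$) if it has no second-order quantifiers; it is $\Sigma^1_{n+1}$ (respectively $\Pi^1_{n+1}$) if it is a $\Pi^1_n$ (respectively $\Sigma^1_n$) formula preceded by a block of existential (respectively universal) second-order quantifiers. An embedding $j\in\mathcal{E}_\lambda$ is $\Sigma^1_m$-elementary if for every $\Sigma^1_m$ formula $\varphi$, all $x_1,\dots,x_n\in V_\lambda$ and all $X_1,\dots,X_p\subseteq V_\lambda$, $$V_\lambda\models\varphi[x_1,\dots,x_n,X_1,\dots,X_p]\iff V_\lambda\models\varphi[j(x_1),\dots,j(x_n),j\cdot X_1,\dots,j\cdot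 X_p],$$ where second-order variables range over all subsets of $V_\lambda$. The right powers of $j\in\mathcal{E}_\lambda$ are $j^{(0)}=j$ and $j^{(n+1)}=j^{(n)}\cdot j^{(n)}$. The critical point $\operatorname{crit}(k)$ of $k\in\mathcal{E}_\lambda$ is the least ordinal $\kappa$ with $\kappa<k(\kappa)$. If $\langle k_n\mid n<\omega\rangle$ is a sequence in $\mathcal{E}_\lambda$ with $\liminf_n\operatorname{crit}(k_n)=\lambda$, its inverse limit $K=k_0\circ k_1\circ\cdots$ is the function on $V_\lambda$ given by $K(a)=(k_0\circ\cdots\circ k_n)(a)$, where $n$ is large enough that $k_i(a)=a$ for all $i>n$. The iterated range of $j\in\mathcal{E}_\lambda$ is $\operatorname{irng}(j)=\bigcup_{n<\omega}\operatorname{irng}_n(j)$, where $\operatorname{irng}_0(j)=\{j\cdot B\mid B\subseteq V_\lambda\}\cap\mathcal{E}_\lambda$ and $\operatorname{irng}_{n+1}(j)=\bigcup_{k\in\operatorname{irng}_n(j)}\operatorname{irng}_0(k)$. **Theorem.** Suppose $j\in\mathcal{E}_\lambda$ is $\Sigma^1_m$-elementary. Then there are $\Sigma^1_m$-elementary $k,\ell\in\mathcal{E}_\lambda$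 with disjoint iterated ranges: $\operatorname{irng}(k)\cap\operatorname{irng}(\ell)=\emptyset$. Namely, the right powers $j^{(n)}$ of $j$ are well-defined members of $\mathcal{E}_\lambda$ with $\liminf_n\operatorname{crit}(j^{(n)})=\lambda$, and the inverse limits $$k=j\circ j^{(1)}\circ j^{(2)}\circ\cdots\qquad\text{and}\qquad \ell=j^{(1)}\circ j^{(2)}\circ\cdots$$ are such embeddings. -/

import Mathlib

open FirstOrder
open scoped ZFSet

universe u

/-- The rank-initial segment `V_λ` of the universe of sets, as a type. -/
abbrev VRank (lam : Ordinal.{u}) : Type (u + 1) := {x : ZFSet.{u} // x ∈ V_ lam}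

/-- Relation symbols: the binary symbol `∈` and `p` unary predicate symbols, the latter
playing the role of free second-order variables. -/
inductive MemRel (p : ℕ) : ℕ → Type
  | mem : MemRel p 2
  | pred (i : Fin p) : MemRel p 1

/-- The language of set theory with `p` unary predicate symbols; `setLang 0` is `{∈}`. -/
def setLang (p : ℕ) : FirstOrder.Language.{0, 0} where
  Functions := fun _ => Empty
  Relations := MemRel p

/-- The structure `(V_λ, ∈, X₀, …, X_{p-1})`. -/
@[reducible] def rankStructure (lam : Ordinal.{u}) {p : ℕ} (X : Fin p → Set (VRank lam)) :
    (setLang p).Structure (VRank lam) where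
  funMap := fun f => nomatch f
  RelMap := fun {_} r =>
    match r with
    | .mem => fun v => (v 0).1 ∈ (v 1).1
    | .pred i => fun v => v 0 ∈ X i

/-- The structure `(V_λ, ∈)`. -/
instance instRankStructure (lam : Ordinal.{u}) : (setLang 0).Structure (VRank lam) :=
  rankStructure lam Fin.elim0

/-- Rank-to-rank embeddings: nontrivial elementary embeddings of `(V_λ, ∈)` into itself. -/
def RankEmb (lam : Ordinal.{u}) : Set (VRank lam → VRank lam) :=
  {j | (∃ e : VRank lam ↪ₑ[setLang 0] VRank lam, ⇑e = j) ∧ j ≠ id}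

/-- For `A ⊆ V_λ` and `α < λ`, the set `A ∩ V_α` as an element of `V_λ`. -/
noncomputable def truncSet {lam : Ordinal.{u}} (A : Set (VRank lam)) (α : Ordinal.{u})
    (hα : α < lam) : VRank lam :=
  ⟨ZFSet.sep (fun x => ∃ h : x ∈ V_ lam, (⟨x, h⟩ : VRank lam) ∈ A) (V_ α),
    ZFSet.mem_vonNeumann_of_subset (ZFSet.sep_subset ..) (ZFSet.vonNeumann_mem_of_lt hα)⟩

/-- The extension of `j` to subsets of `V_λ`: `j · A = ⋃_{α < λ} j (A ∩ V_α)`. -/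
def extendEmb {lam : Ordinal.{u}} (j : VRank lam → VRank lam) (A : Set (VRank lam)) :
    Set (VRank lam) :=
  {y | ∃ (α : Ordinal.{u}) (hα : α < lam), y.1 ∈ (j (truncSet A α hα)).1}

/-- A function `V_λ → V_λ` as a subset of `V_λ`, a set of Kuratowski pairs. -/
def graphEmb {lam : Ordinal.{u}} (j : VRank lam → VRank lam) : Set (VRank lam) :=
  {z | ∃ x : VRank lam, z.1 = ZFSet.pair x.1 (j x).1}

/-- Second-order formulas in prenex form with `n` free first-order variables and `p` free
second-order variables: a string of second-order quantifiers in front of a formula without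
second-order quantifiers. Under a quantifier, the bound variable has index `0`. -/
inductive SOFormula (n : ℕ) : ℕ → Type
  | fo {p : ℕ} (φ : (setLang p).Formula (Fin n)) : SOFormula n p
  | ex {p : ℕ} (φ : SOFormula n (p + 1)) : SOFormula n p
  | all {p : ℕ} (φ : SOFormula n (p + 1)) : SOFormula n p

/-- Satisfaction in `V_λ`, second-order variables ranging over all subsets of `V_λ`. -/
def SOFormula.Sat {lam : Ordinal.{u}} {n : ℕ} (x : Fin n → VRank lam) :
    {p : ℕ} → SOFormula n p → (Fin p → Set (VRank lam)) → Prop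
  | p, .fo φ, X => @FirstOrder.Language.Formula.Realize (setLang p) (VRank lam) (rankStructure lam X) _ φ x
  | _, .ex φ, X => ∃ Y : Set (VRank lam), φ.Sat x (Fin.cons Y X : Fin _ → Set (VRank lam))
  | _, .all φ, X => ∀ Y : Set (VRank lam), φ.Sat x (Fin.cons Y X : Fin _ → Set (VRank lam))

/-- `IsLevel true m φ` says that `φ` is `Σ¹_m`, and `IsLevel false m φ` that `φ` is `Π¹_m`:
a `Σ¹_{m+1}` formula is a block of existential second-order quantifiers followed by a
`Π¹_m` formula, and dually. -/
inductive SOFormula.IsLevel {n : ℕ} : Bool → ℕ → {p : ℕ} → SOFormula n p → Prop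
  | fo (b : Bool) {p : ℕ} (φ : (setLang p).Formula (Fin n)) : IsLevel b 0 (.fo φ)
  | switch {b : Bool} {m p : ℕ} {φ : SOFormula n p} (h : IsLevel b m φ) :
      IsLevel (!b) (m + 1) φ
  | ex {m p : ℕ} {φ : SOFormula n (p + 1)} (h : IsLevel true (m + 1) φ) :
      IsLevel true (m + 1) (.ex φ)
  | all {m p : ℕ} {φ : SOFormula n (p + 1)} (h : IsLevel false (m + 1) φ) :
      IsLevel false (m + 1) (.all φ)

/-- `j` preserves `Σ¹_m` formulas with parameters from `V_λ` and subsets of `V_λ`. -/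
def SigmaElementary {lam : Ordinal.{u}} (m : ℕ) (j : VRank lam → VRank lam) : Prop :=
  ∀ (n p : ℕ) (φ : SOFormula n p), φ.IsLevel true m →
    ∀ (x : Fin n → VRank lam) (X : Fin p → Set (VRank lam)),
      φ.Sat x X ↔ φ.Sat (fun i => j (x i)) (fun i => extendEmb j (X i))

/-- The critical point: the least ordinal `κ` with `κ < j κ`. -/
noncomputable def critPt {lam : Ordinal.{u}} (j : VRank lam → VRank lam) : Ordinal.{u} :=
  sInf {κ | ∃ h : κ.toZFSet ∈ V_ lam, κ.toZFSet ∈ (j ⟨κ.toZFSet, h⟩).1}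

/-- `r` is the sequence of right powers of `j`: `j⁽⁰⁾ = j` and `j⁽ⁿ⁺¹⁾ = j⁽ⁿ⁾ · j⁽ⁿ⁾`, where
the application `k · k` is the function whose graph is the image of the graph of `k` under the
extension of `k` to subsets of `V_λ`. -/
def IsRightPowers {lam : Ordinal.{u}} (j : VRank lam → VRank lam)
    (r : ℕ → VRank lam → VRank lam) : Prop :=
  r 0 = j ∧ ∀ n, graphEmb (r (n + 1)) = extendEmb (r n) (graphEmb (r n))

/-- The finite composition `k₀ ∘ k₁ ∘ ⋯ ∘ kₙ`. -/
def compUpTo {lam : Ordinal.{u}} (k : ℕ → VRank lam → VRank lam) : ℕ → VRank lam → VRank lam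
  | 0 => k 0
  | n + 1 => compUpTo k n ∘ k (n + 1)

/-- `K = k₀ ∘ k₁ ∘ ⋯` is the inverse limit of a sequence of rank-to-rank embeddings whose
critical points have limit inferior `λ`. -/
def IsInverseLimit {lam : Ordinal.{u}} (k : ℕ → VRank lam → VRank lam)
    (K : VRank lam → VRank lam) : Prop :=
  (∀ n, k n ∈ RankEmb lam) ∧
  Filter.liminf (fun n => critPt (k n)) Filter.atTop = lam ∧
  ∀ a, ∃ n, (∀ i, n < i → k i a = a) ∧ K a = compUpTo k n a

/-- `irng₀ j`: the rank-to-rank embeddings in the range of `j` as a map on subsets of `V_λ`. -/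
def irngZero {lam : Ordinal.{u}} (j : VRank lam → VRank lam) : Set (VRank lam → VRank lam) :=
  {k | k ∈ RankEmb lam ∧ ∃ B : Set (VRank lam), extendEmb j B = graphEmb k}

/-- `irngₙ j`. -/
def irngStep {lam : Ordinal.{u}} (j : VRank lam → VRank lam) : ℕ → Set (VRank lam → VRank lam)
  | 0 => irngZero j
  | n + 1 => ⋃ k ∈ irngStep j n, irngZero k

/-- The iterated range of `j`. -/
def irng {lam : Ordinal.{u}} (j : VRank lam → VRank lam) : Set (VRank lam → VRank lam) :=
  ⋃ n, irngStep j n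

/-!
A nontrivial elementary embedding `j` of `V_λ` has a critical sequence `κ₀ < κ₁ < ⋯` cofinal in `λ`
(Kunen, by means of an `ω`-Jónsson function on `V_μ`, `μ = sup κₙ`). As `λ` then has countable
cofinality, a map of `V_λ` is elementary as soon as it respects finitely many set operations, fixes
`ω` and its elements, and has cofinal values: its extension to subsets of `V_λ` commutes with
countable unions, hence with projections, so with everything first-order. Being the graph of an
embedding is therefore itself a first-order property of a subset of `V_λ`, which is why `j · k` is
again an embedding.

If the `kₙ` reflect `Σ¹` formulas with `2a + 1` blocks of quantifiers, their inverse limit reflects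
those with `2a + 2`. Witnesses are pulled back along a new inverse limit, in which every `kₙ` is
replaced by an embedding that has prescribed sets in its range; that such an embedding exists is a
`Σ¹` fact about the image under `kₙ` of the data, witnessed by `kₙ` itself, and `kₙ` reflects it.

For disjointness, let `K = j⁽ᵗ⁾ ∘ j⁽ᵗ⁺¹⁾ ∘ ⋯`. Then `K(κ_{s+t}) = κ_{2s+t+1}`, whereas the sets
`K(x)` with `x ∈ V_{κ_{s+t}}` have rank below `κ_{2s+t}`. A function in the range of `K`, hence by
uncurrying every member of `irng K`, therefore has no values with rank in `[κ_{2s+t}, κ_{2s+t+1})`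
once `s` is large. For `t = 0` and `t = 1` these intervals together cover a final segment of `λ`,
so a common member of the two iterated ranges would have no values of large rank.
-/

section Cardinality

open Cardinal

theorem exists_injective_choice {I X : Type u} (S : I → Set X) (h : ∀ i, #I ≤ #(S i)) :
    ∃ s : I → X, Function.Injective s ∧ ∀ i, s i ∈ S i := by
  obtain ⟨r, hr, hord⟩ := exists_ord_eq I
  have card_lt : ∀ i, #{k | r k i} < #I := fun i => by
    have := Ordinal.typein_lt_type r i
    rwa [← hord, lt_ord] at this
  have exists_new : ∀ (i : I) (f : ∀ k, r k i → X), ∃ x ∈ S i, ∀ k hk, f k hk ≠ x := by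
    intro i f
    by_contra! hall
    have hsub : S i ⊆ Set.range fun k : {k | r k i} => f k.1 k.2 := fun x hx =>
      let ⟨k, hk, e⟩ := hall x hx
      ⟨⟨k, hk⟩, e⟩
    exact ((h i).trans ((mk_le_mk_of_subset hsub).trans mk_range_le)).not_gt (card_lt i)
  choose c hcS hc using exists_new
  let s : I → X := hr.wf.fix c
  have hs : ∀ i, s i = c i fun k _ => s k := fun i => hr.wf.fix_eq c i
  have hne : ∀ {i k}, r k i → s k ≠ s i := fun {i k} hk => hs i ▸ hc i (fun k _ => s k) k hk
  refine ⟨s, fun i k hik => ?_, fun i => hs i ▸ hcS i _⟩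
  rcases trichotomous_of r i k with hlt | heq | hgt
  · exact absurd hik (hne hlt)
  · exact heq
  · exact absurd hik.symm (hne hgt)

/-- The function `F` is the `ω`-Jónsson function of Erdős and Hajnal. -/
theorem exists_jonsson {T : Type u} [Infinite T] {e : Set T → ℕ → T} (he : Function.Injective e) :
    ∃ F : (ℕ → T) → T, ∀ g : T → T, Function.Injective g → ∀ y, ∃ t : ℕ → T, F (g ∘ t) = y := by
  let I := {g : T → T // Function.Injective g} × T
  have hT : ℵ₀ ≤ #T := aleph0_le_mk T
  have card_lt : #T < #(Set T) := mk_set (α := T) ▸ cantor _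
  have card_injective_le : #{g : T → T // Function.Injective g} ≤ #(Set T) := by
    refine (mk_subtype_le _).trans ?_
    rw [← power_def, power_self_eq hT, mk_set]
  have card_index_le : #I ≤ #(ℕ → T) :=
    calc #I = #{g : T → T // Function.Injective g} * #T := by rw [mk_prod, lift_id, lift_id]
      _ ≤ #(Set T) * #(Set T) := mul_le_mul' card_injective_le card_lt.le
      _ = #(Set T) := mul_eq_self (hT.trans card_lt.le)
      _ ≤ #(ℕ → T) := mk_le_of_injective he
  obtain ⟨s, hs, hsmem⟩ := exists_injective_choice
    (fun i : I => Set.range fun t : ℕ → T => i.1.1 ∘ t)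
    fun i => card_index_le.trans (mk_range_eq _ i.1.2.comp_left).ge
  have : Nonempty I := ⟨⟨id, Function.injective_id⟩, Classical.arbitrary T⟩
  refine ⟨fun x => (Function.invFun s x).2, fun g hg y => ?_⟩
  obtain ⟨t, ht : g ∘ t = s ⟨⟨g, hg⟩, y⟩⟩ := hsmem ⟨⟨g, hg⟩, y⟩
  exact ⟨t, by simp only [ht, Function.leftInverse_invFun hs _]⟩

end Cardinality

/-- The quantifier `∃` for `b = true` and `∀` for `b = false`, so that dual statements about `Σ¹`
and `Π¹` can be proved at once. -/
def Quant {α : Type*} (b : Bool) (P : α → Prop) : Prop :=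
  match b with
  | true => ∃ a, P a
  | false => ∀ a, P a

namespace Quant

variable {α β : Type*} {b : Bool}

theorem congr {P Q : α → Prop} (h : ∀ a, P a ↔ Q a) : Quant b P ↔ Quant b Q := by
  rw [funext fun a => propext (h a)]

theorem not_iff {P : α → Prop} : ¬ Quant b P ↔ Quant (!b) fun a => ¬ P a := by
  cases b
  · exact not_forall
  · exact not_exists

theorem const_iff [Nonempty α] {p : Prop} : (Quant b fun _ : α => p) ↔ p := by
  cases b
  · exact forall_const α
  · exact exists_const α

theorem comp_equiv_iff (e : α ≃ β) {P : β → Prop} : (Quant b fun a => P (e a)) ↔ Quant b P := by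
  cases b
  · exact e.forall_congr_right
  · exact e.exists_congr_right

theorem prod_iff {P : α × β → Prop} : Quant b P ↔ Quant b fun x => Quant b fun y => P (x, y) := by
  cases b
  · exact Prod.forall
  · exact Prod.exists

theorem and_iff [Nonempty α] [Nonempty β] {P : α → Prop} {Q : β → Prop} :
    Quant b P ∧ Quant b Q ↔ Quant b fun x : α × β => P x.1 ∧ Q x.2 := by
  cases b
  · exact ⟨fun h x => ⟨h.1 x.1, h.2 x.2⟩,
      fun h => ⟨fun x => (h (x, Classical.arbitrary β)).1,
        fun y => (h (Classical.arbitrary α, y)).2⟩⟩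
  · exact ⟨fun ⟨⟨x, hx⟩, y, hy⟩ => ⟨(x, y), hx, hy⟩, fun ⟨x, h⟩ => ⟨⟨x.1, h.1⟩, x.2, h.2⟩⟩

end Quant

namespace SOFormula

variable {lam : Ordinal.{u}} {n p : ℕ}

/-- The formula `φ` preceded by the second-order quantifier coded by `b` as in `Quant`. -/
def quant (b : Bool) (φ : SOFormula n (p + 1)) : SOFormula n p :=
  match b with
  | true => .ex φ
  | false => .all φ

theorem sat_quant {b : Bool} {φ : SOFormula n (p + 1)} {x : Fin n → VRank lam}
    {X : Fin p → Set (VRank lam)} :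
    (quant b φ).Sat x X ↔ Quant b fun Y => φ.Sat x (Fin.cons Y X : Fin (p + 1) → _) := by
  cases b <;> rfl

theorem IsLevel.quant {b : Bool} {m : ℕ} {φ : SOFormula n (p + 1)} (h : φ.IsLevel b (m + 1)) :
    (quant b φ).IsLevel b (m + 1) := by
  cases b
  · exact .all h
  · exact .ex h

theorem IsLevel.exists_quantBlock {b : Bool} {m q : ℕ} {φ : SOFormula n (p + q)}
    (h : φ.IsLevel b (m + 1)) : ∃ ψ : SOFormula n p, ψ.IsLevel b (m + 1) ∧
      ∀ (x : Fin n → VRank lam) (X : Fin p → Set (VRank lam)), ψ.Sat x X ↔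
        Quant b fun Y : Fin q → Set (VRank lam) =>
          φ.Sat x (Fin.append Y X ∘ Fin.cast (Nat.add_comm p q)) := by
  induction q with
  | zero =>
    refine ⟨φ, h, fun x X => ?_⟩
    have append_eq : ∀ Y : Fin 0 → Set (VRank lam),
        Fin.append Y X ∘ Fin.cast (Nat.add_comm p 0) = X := fun Y => by
      rw [Subsingleton.elim Y Fin.elim0, Fin.elim0_append]
      rfl
    simp only [append_eq, Quant.const_iff]
  | succ q ih =>
    obtain ⟨ψ, hψ, hsat⟩ := ih (φ := SOFormula.quant b φ) h.quant
    refine ⟨ψ, hψ, fun x X => ?_⟩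
    have append_cons : ∀ (Y : Fin q → Set (VRank lam)) (Z : Set (VRank lam)),
        Fin.append (Fin.cons Z Y : Fin (q + 1) → _) X ∘ Fin.cast (Nat.add_comm p (q + 1)) =
          Fin.cons Z (Fin.append Y X ∘ Fin.cast (Nat.add_comm p q)) := fun Y Z => by
      rw [Fin.append_cons]
      funext i
      cases i using Fin.cases <;> rfl
    rw [hsat, ← Quant.comp_equiv_iff
      ((Equiv.prodComm _ _).trans (Fin.consEquiv fun _ : Fin (q + 1) => Set (VRank lam))),
      Quant.prod_iff]
    refine Quant.congr fun Y => sat_quant.trans (Quant.congr fun Z => ?_)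
    exact iff_of_eq (congrArg _ (append_cons Y Z).symm)

end SOFormula

/-- The map of languages that replaces the predicate symbol with index `i` by the one with index
`g i`. -/
def setLangMap {p q : ℕ} (g : Fin p → Fin q) : setLang p →ᴸ setLang q where
  onFunction := fun _ f => nomatch f
  onRelation := fun _ r => match r with
    | .mem => (.mem : MemRel q 2)
    | .pred i => (.pred (g i) : MemRel q 1)

namespace VRank

variable {lam : Ordinal.{u}}

/-! ### Definability over `V_λ` -/

/-- The relation `P` between first-order variables indexed by `ι` and second-order variables
indexed by `κ` is defined over `V_λ` by a formula without second-order quantifiers. As a formula has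
only finitely many predicate symbols, the second-order variables are assigned to them by an
arbitrary map `g`. -/
def FODefinable {ι κ : Type} (P : (ι → VRank lam) → (κ → Set (VRank lam)) → Prop) : Prop :=
  ∀ (p : ℕ) (g : κ → Fin p), ∃ φ : (setLang p).Formula ι,
    ∀ (X : Fin p → Set (VRank lam)) (x : ι → VRank lam),
      @Language.Formula.Realize (setLang p) (VRank lam) (rankStructure lam X) _ φ x ↔
        P x fun k => X (g k)

namespace FODefinable

variable {ι ι' κ κ' β : Type} {P Q : (ι → VRank lam) → (κ → Set (VRank lam)) → Prop}

theorem congr (h : FODefinable P) (hQ : ∀ x X, Q x X ↔ P x X) : FODefinable Q := fun p g =>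
  let ⟨φ, hφ⟩ := h p g
  ⟨φ, fun X x => (hφ X x).trans (hQ _ _).symm⟩

theorem mem (i k : ι) : FODefinable (lam := lam) (κ := κ) fun x _ => (x i).1 ∈ (x k).1 :=
  fun p _ =>
  ⟨Language.Relations.formula₂ (L := setLang p) (MemRel.mem : MemRel p 2) (.var i) (.var k),
    fun X _ => by
      let _ := rankStructure lam X
      exact Language.Formula.realize_rel₂⟩

theorem eq (i k : ι) : FODefinable (lam := lam) (κ := κ) fun x _ => x i = x k := fun p _ =>
  ⟨Language.Term.equal (.var i) (.var k), fun X _ => by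
    let _ := rankStructure lam X
    exact Language.Formula.realize_equal⟩

theorem pred (k : κ) (i : ι) : FODefinable fun (x : ι → VRank lam) X => x i ∈ X k := fun p g =>
  ⟨Language.Relations.formula₁ (L := setLang p) (MemRel.pred (g k) : MemRel p 1) (.var i),
    fun X _ => by
      let _ := rankStructure lam X
      exact Language.Formula.realize_rel₁⟩

theorem trivial : FODefinable (lam := lam) (ι := ι) (κ := κ) fun _ _ => True := fun _ _ =>
  ⟨⊤, fun X _ => by
    let _ := rankStructure lam X
    exact Language.Formula.realize_top⟩

theorem not (h : FODefinable P) : FODefinable fun x X => ¬ P x X := fun p g => by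
  obtain ⟨φ, hφ⟩ := h p g
  refine ⟨φ.not, fun X x => ?_⟩
  let _ := rankStructure lam X
  rw [Language.Formula.realize_not, hφ X x]

theorem imp (hP : FODefinable P) (hQ : FODefinable Q) : FODefinable fun x X => P x X → Q x X :=
  fun p g => by
    obtain ⟨φ, hφ⟩ := hP p g
    obtain ⟨ψ, hψ⟩ := hQ p g
    refine ⟨φ.imp ψ, fun X x => ?_⟩
    let _ := rankStructure lam X
    rw [Language.Formula.realize_imp, hφ X x, hψ X x]

theorem and (hP : FODefinable P) (hQ : FODefinable Q) : FODefinable fun x X => P x X ∧ Q x X :=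
  (hP.imp hQ.not).not.congr fun _ _ => by tauto

theorem or (hP : FODefinable P) (hQ : FODefinable Q) : FODefinable fun x X => P x X ∨ Q x X :=
  (hP.not.imp hQ).congr fun _ _ => by tauto

theorem iff (hP : FODefinable P) (hQ : FODefinable Q) : FODefinable fun x X => P x X ↔ Q x X :=
  ((hP.imp hQ).and (hQ.imp hP)).congr fun _ _ => by tauto

theorem rename (h : FODefinable P) (f : ι → ι') (g : κ → κ') :
    FODefinable fun x X => P (fun i => x (f i)) fun k => X (g k) := fun p g' => by
  obtain ⟨φ, hφ⟩ := h p fun k => g' (g k)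
  refine ⟨φ.relabel f, fun X x => ?_⟩
  let _ := rankStructure lam X
  exact Language.Formula.realize_relabel.trans (hφ X _)

theorem exs [Finite β] {R : (ι → VRank lam) → (κ → Set (VRank lam)) → (β → VRank lam) → Prop}
    (h : FODefinable fun (x : ι ⊕ β → VRank lam) X => R (x ∘ .inl) X (x ∘ .inr)) :
    FODefinable fun x X => ∃ y, R x X y := fun p g => by
  obtain ⟨φ, hφ⟩ := h p g
  refine ⟨φ.iExs β, fun X x => ?_⟩
  let _ := rankStructure lam X
  exact Language.Formula.realize_iExs.trans (exists_congr fun y => hφ X (Sum.elim x y))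

theorem ex {R : (ι → VRank lam) → (κ → Set (VRank lam)) → VRank lam → Prop}
    (h : FODefinable fun (x : Option ι → VRank lam) X => R (x ∘ some) X (x none)) :
    FODefinable fun x X => ∃ y, R x X y :=
  (exs (β := Unit) (R := fun x X y => R x X (y ()))
    (h.rename (fun o => o.elim (Sum.inr ()) Sum.inl) id)).congr
    fun _ _ => (Equiv.funUnique Unit _).exists_congr_right.symm

theorem all {R : (ι → VRank lam) → (κ → Set (VRank lam)) → VRank lam → Prop}
    (h : FODefinable fun (x : Option ι → VRank lam) X => R (x ∘ some) X (x none)) :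
    FODefinable fun x X => ∀ y, R x X y :=
  (ex (R := fun x X y => ¬ R x X y) h.not).not.congr fun _ _ => not_exists_not.symm

theorem forall_finite [Finite β] {R : β → (ι → VRank lam) → (κ → Set (VRank lam)) → Prop}
    (h : ∀ i, FODefinable (R i)) : FODefinable fun x X => ∀ i, R i x X := fun p g => by
  choose φ hφ using fun i => h i p g
  refine ⟨Language.Formula.iInf φ, fun X x => ?_⟩
  let _ := rankStructure lam X
  exact Language.Formula.realize_iInf.trans (forall_congr' fun i => hφ i X x)

theorem of_formula {p : ℕ} (φ : (setLang p).Formula ι) : FODefinable (lam := lam) fun x X =>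
    @Language.Formula.Realize (setLang p) (VRank lam) (rankStructure lam X) _ φ x := fun q g => by
  refine ⟨(setLangMap g).onFormula φ, fun X x => ?_⟩
  let _ := rankStructure lam X
  let _ := rankStructure lam fun i => X (g i)
  have : (setLangMap g).IsExpansionOn (VRank lam) :=
    ⟨fun f => (nomatch f), fun R x => by cases R <;> rfl⟩
  exact Language.LHom.realize_onFormula (setLangMap g) φ

end FODefinable

/-- `SODefinable true m P` says that `P` is defined over `V_λ` by a `Σ¹_m` formula, and
`SODefinable false m P` that it is defined by a `Π¹_m` formula. All second-order quantifiers of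
a block are bound at once, their variables being indexed by a finite type. -/
def SODefinable : Bool → ℕ → ∀ {κ : Type}, ((κ → Set (VRank lam)) → Prop) → Prop
  | _, 0, κ, P => FODefinable (ι := Empty) (κ := κ) fun _ X => P X
  | b, m + 1, κ, P => ∃ (β : Type) (_ : Finite β) (R : (κ ⊕ β → Set (VRank lam)) → Prop),
      SODefinable (!b) m R ∧ ∀ E, P E ↔ Quant b fun Y : β → Set (VRank lam) => R (Sum.elim E Y)

namespace SODefinable

variable {κ κ' β : Type} {b : Bool} {m : ℕ} {P Q : (κ → Set (VRank lam)) → Prop}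

theorem congr (h : SODefinable b m P) (hQ : ∀ E, Q E ↔ P E) : SODefinable b m Q := by
  rwa [show Q = P from funext fun E => propext (hQ E)]

theorem rename (h : SODefinable b m P) (f : κ → κ') :
    SODefinable b m fun E => P fun k => E (f k) := by
  induction m generalizing b κ κ' with
  | zero => exact FODefinable.rename (ι' := Empty) h id f
  | succ m ih =>
    obtain ⟨β, hβ, R, hR, hP⟩ := h
    refine ⟨β, hβ, _, ih hR (Sum.map f id), fun E => (hP _).trans (Quant.congr fun Y => ?_)⟩
    exact iff_of_eq (congrArg R Sum.elim_comp_map.symm)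

theorem not (h : SODefinable b m P) : SODefinable (!b) m fun E => ¬ P E := by
  induction m generalizing b κ with
  | zero => exact FODefinable.not h
  | succ m ih =>
    obtain ⟨β, hβ, R, hR, hP⟩ := h
    exact ⟨β, hβ, _, ih hR, fun E => (not_congr (hP E)).trans Quant.not_iff⟩

theorem switch (h : SODefinable b m P) : SODefinable (!b) (m + 1) P :=
  ⟨Empty, inferInstance, _, (Bool.not_not b).symm ▸ h.rename Sum.inl,
    fun _ => Quant.const_iff.symm⟩

theorem succ (h : SODefinable b m P) : SODefinable b (m + 1) P := by
  induction m generalizing b κ with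
  | zero => exact Bool.not_not b ▸ switch (b := !b) (m := 0) (P := P) h
  | succ m ih =>
    obtain ⟨β, hβ, R, hR, hP⟩ := h
    exact ⟨β, hβ, R, ih hR, hP⟩

theorem mono (h : SODefinable b m P) {n : ℕ} (hn : m ≤ n) : SODefinable b n P := by
  induction n, hn using Nat.le_induction with
  | base => exact h
  | succ n _ ih => exact ih.succ

theorem of_foDefinable (h : FODefinable (ι := Empty) fun _ X => P X) : SODefinable b m P :=
  mono (m := 0) h (Nat.zero_le m)

theorem and (hP : SODefinable b m P) (hQ : SODefinable b m Q) :
    SODefinable b m fun E => P E ∧ Q E := by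
  induction m generalizing b κ with
  | zero => exact FODefinable.and hP hQ
  | succ m ih =>
    obtain ⟨β, hβ, R, hR, hPR⟩ := hP
    obtain ⟨γ, hγ, S, hS, hQS⟩ := hQ
    refine ⟨β ⊕ γ, inferInstance, _, ih (hR.rename (Sum.map id Sum.inl))
      (hS.rename (Sum.map id Sum.inr)), fun E => ?_⟩
    change P E ∧ Q E ↔ _
    rw [hPR, hQS, Quant.and_iff, ← Quant.comp_equiv_iff (Equiv.sumArrowEquivProdArrow β γ _)]
    refine Quant.congr fun Y => and_congr (iff_of_eq (congrArg R ?_)) (iff_of_eq (congrArg S ?_))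
    all_goals
      funext k
      rcases k with k | k <;> rfl

theorem or (hP : SODefinable b m P) (hQ : SODefinable b m Q) :
    SODefinable b m fun E => P E ∨ Q E :=
  (Bool.not_not b ▸ (hP.not.and hQ.not).not).congr fun E => by tauto

theorem quants [Finite β] {R : (κ → Set (VRank lam)) → (β → Set (VRank lam)) → Prop}
    (h : SODefinable b (m + 1) fun E : κ ⊕ β → Set (VRank lam) => R (E ∘ .inl) (E ∘ .inr)) :
    SODefinable b (m + 1) fun E => Quant b fun Y => R E Y := by
  obtain ⟨γ, hγ, S, hS, hRS⟩ := h
  refine ⟨β ⊕ γ, inferInstance, _, hS.rename (Equiv.sumAssoc κ β γ), fun E => ?_⟩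
  have hR : ∀ Y, R E Y ↔ Quant b fun Z => S (Sum.elim (Sum.elim E Y) Z) :=
    fun Y => hRS (Sum.elim E Y)
  simp only [hR, ← Quant.prod_iff (P := fun YZ => S (Sum.elim (Sum.elim E YZ.1) YZ.2))]
  rw [← Quant.comp_equiv_iff (Equiv.sumArrowEquivProdArrow β γ _)]
  refine Quant.congr fun Y => iff_of_eq (congrArg S ?_)
  rw [Equiv.sumArrowEquivProdArrow]
  funext k
  rcases k with (k | k) | k <;> rfl

theorem quant {R : (κ → Set (VRank lam)) → Set (VRank lam) → Prop}
    (h : SODefinable b (m + 1) fun E : κ ⊕ Unit → Set (VRank lam) =>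
      R (E ∘ .inl) (E (.inr ()))) :
    SODefinable b (m + 1) fun E => Quant b fun Y => R E Y :=
  (quants (R := fun E Y => R E (Y ())) h).congr fun _ =>
    (Quant.comp_equiv_iff (Equiv.funUnique Unit _)).symm

theorem forall_list {α : Type*} {R : α → (κ → Set (VRank lam)) → Prop} (L : List α)
    (h : ∀ a ∈ L, SODefinable b m (R a)) : SODefinable b m fun E => ∀ a ∈ L, R a E := by
  induction L with
  | nil => exact (of_foDefinable FODefinable.trivial).congr fun E => by simp
  | cons a L ih =>
    rw [List.forall_mem_cons] at h
    exact (h.1.and (ih h.2)).congr fun E => List.forall_mem_cons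

theorem exists_formula (h : SODefinable b m P) {p : ℕ} (g : κ → Fin p) :
    ∃ φ : SOFormula 0 p, φ.IsLevel b m ∧
      ∀ (x : Fin 0 → VRank lam) (X : Fin p → Set (VRank lam)), φ.Sat x X ↔ P fun k => X (g k) := by
  induction m generalizing b κ p with
  | zero =>
    obtain ⟨φ, hφ⟩ := FODefinable.rename h (nofun : Empty → Fin 0) id p g
    exact ⟨.fo φ, .fo b φ, fun x X => hφ X x⟩
  | succ m ih =>
    obtain ⟨β, hβ, R, hR, hP⟩ := h
    obtain ⟨q, ⟨f⟩⟩ := Finite.exists_equiv_fin β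
    obtain ⟨φ, hφ, hφR⟩ := ih hR (p := p + q)
      (Fin.cast (Nat.add_comm q p) ∘ Sum.elim (fun k => (g k).natAdd q) fun k => (f k).castAdd p)
    obtain ⟨ψ, hψ, hψφ⟩ :=
      SOFormula.IsLevel.exists_quantBlock (lam := lam)
        (Bool.not_not b ▸ .switch hφ : φ.IsLevel b (m + 1))
    refine ⟨ψ, hψ, fun x X => ?_⟩
    rw [hψφ, hP, ← Quant.comp_equiv_iff (Equiv.arrowCongr f (Equiv.refl _))]
    refine Quant.congr fun Y => (hφR _ _).trans (iff_of_eq (congrArg R ?_))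
    funext k
    rcases k with k | k
    · exact Fin.append_right _ _ _
    · exact (Fin.append_left _ _ _).trans (congrArg Y (f.symm_apply_apply k))

end SODefinable

theorem exists_soDefinable_of_isLevel {n p m : ℕ} {b : Bool} {φ : SOFormula n p}
    (h : φ.IsLevel b m) : ∃ P : (Fin p ⊕ Fin n → Set (VRank lam)) → Prop, SODefinable b m P ∧
      ∀ x X, P (Sum.elim X fun i => {x i}) ↔ φ.Sat x X := by
  have quant_step : ∀ {b : Bool} {m p : ℕ} {φ : SOFormula n (p + 1)},
      (∃ P : (Fin (p + 1) ⊕ Fin n → Set (VRank lam)) → Prop, SODefinable b (m + 1) P ∧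
        ∀ x X, P (Sum.elim X fun i => {x i}) ↔ φ.Sat x X) →
      ∃ P : (Fin p ⊕ Fin n → Set (VRank lam)) → Prop, SODefinable b (m + 1) P ∧
        ∀ x X, P (Sum.elim X fun i => {x i}) ↔ (SOFormula.quant b φ).Sat x X := by
    rintro b m p φ ⟨P, hP, hPφ⟩
    refine ⟨_, SODefinable.quant (R := fun E Y => P (Sum.elim (Fin.cons Y (E ∘ .inl)) (E ∘ .inr)))
      ((hP.rename (Sum.elim (Fin.cons (.inr ()) fun i => .inl (.inl i))
        fun i => .inl (.inr i))).congr fun E => iff_of_eq (congrArg P ?_)),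
      fun x X => (Quant.congr fun Y => hPφ x _).trans SOFormula.sat_quant.symm⟩
    funext k
    rcases k with k | k
    · cases k using Fin.cases <;> rfl
    · rfl
  induction h with
  | fo b φ =>
    refine ⟨fun E => ∃ x : Fin n → VRank lam, (∀ i, x i ∈ E (.inr i)) ∧
        (SOFormula.fo φ).Sat x (E ∘ .inl),
      FODefinable.exs (ι := Empty) (κ := Fin _ ⊕ Fin n) (β := Fin n)
        (R := fun _ E x => (∀ i, x i ∈ E (.inr i)) ∧ (SOFormula.fo φ).Sat x (E ∘ .inl)) ?_,
      fun x X => ?_⟩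
    · exact (FODefinable.forall_finite fun i =>
          .pred (ι := Empty ⊕ Fin n) (.inr i) (.inr i)).and
        ((FODefinable.of_formula φ).rename Sum.inr Sum.inl)
    · constructor
      · rintro ⟨y, hy, h⟩
        rwa [show x = y from funext fun i => (hy i).symm]
      · exact fun h => ⟨x, fun i => rfl, h⟩
  | switch _ ih =>
    obtain ⟨P, hP, hPφ⟩ := ih
    exact ⟨P, hP.switch, hPφ⟩
  | ex _ ih => exact quant_step ih
  | all _ ih => exact quant_step ih

/-! ### Ranks and elementary embeddings -/

theorem mem_vonNeumann_of_mem (x : VRank lam) {w : ZFSet.{u}} (h : w ∈ x.1) : w ∈ V_ lam :=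
  ZFSet.isTransitive_vonNeumann lam _ x.2 h

theorem ext {x y : VRank lam} (h : ∀ w : VRank lam, w.1 ∈ x.1 ↔ w.1 ∈ y.1) : x = y :=
  Subtype.ext <| ZFSet.ext fun w =>
    ⟨fun hw => (h ⟨w, x.mem_vonNeumann_of_mem hw⟩).1 hw,
      fun hw => (h ⟨w, y.mem_vonNeumann_of_mem hw⟩).2 hw⟩

theorem subset_iff {x y : VRank lam} : x.1 ⊆ y.1 ↔ ∀ w : VRank lam, w.1 ∈ x.1 → w.1 ∈ y.1 :=
  ⟨fun h _ hw => h hw, fun h w hw => h ⟨w, x.mem_vonNeumann_of_mem hw⟩ hw⟩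

theorem rank_lt (x : VRank lam) : x.1.rank < lam := ZFSet.mem_vonNeumann.1 x.2

/-- The subset of `b` cut out by a predicate. -/
noncomputable def sep (b : VRank lam) (p : VRank lam → Prop) : VRank lam :=
  ⟨ZFSet.sep (fun x => ∃ h : x ∈ V_ lam, p ⟨x, h⟩) b.1,
    ZFSet.mem_vonNeumann_of_subset (ZFSet.sep_subset ..) b.2⟩

@[simp]
theorem mem_sep {b : VRank lam} {p : VRank lam → Prop} {w : VRank lam} :
    w.1 ∈ (sep b p).1 ↔ w.1 ∈ b.1 ∧ p w := by
  simp [sep]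

/-- The level `V_α` as an element of `V_λ`. -/
noncomputable def stage (α : Ordinal.{u}) (h : α < lam) : VRank lam :=
  ⟨V_ α, ZFSet.vonNeumann_mem_of_lt h⟩

theorem mem_stage {α : Ordinal.{u}} {h : α < lam} {w : VRank lam} :
    w.1 ∈ (stage α h).1 ↔ w.1.rank < α := ZFSet.mem_vonNeumann

theorem rank_stage {α : Ordinal.{u}} (h : α < lam) : (stage α h).1.rank = α :=
  ZFSet.rank_vonNeumann α

theorem stage_inj {α β : Ordinal.{u}} {hα : α < lam} {hβ : β < lam} :
    stage α hα = stage β hβ ↔ α = β := by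
  simp [stage, Subtype.ext_iff]

theorem exists_of_rank_lt {α : Ordinal.{u}} (hα : α < lam) (A : VRank lam → Prop)
    (h : ∀ x, A x → x.1.rank < α) : ∃ z : VRank lam, ∀ w : VRank lam, w.1 ∈ z.1 ↔ A w :=
  ⟨sep (stage α hα) A, fun w => by
    rw [mem_sep, mem_stage]
    exact and_iff_right_of_imp (h w)⟩

theorem FODefinable.subset {ι κ : Type} (i k : ι) :
    FODefinable (lam := lam) (κ := κ) fun x _ => (x i).1 ⊆ (x k).1 :=
  (all (R := fun x _ w => w.1 ∈ (x i).1 → w.1 ∈ (x k).1)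
    ((mem none (some i)).imp (mem none (some k)))).congr fun _ _ => subset_iff

/-- `h` is a history: a set of levels that contains every level below each of its members,
expressed without ordinals. -/
def IsHistory (h : VRank lam) : Prop :=
  ∀ v : VRank lam, v.1 ∈ h.1 → ∀ x : VRank lam,
    x.1 ∈ v.1 ↔ ∃ w : VRank lam, (w.1 ∈ h.1 ∧ w.1 ∈ v.1) ∧ x.1 ⊆ w.1

/-- `z` is one of the levels `V_α`, expressed without ordinals. -/
def IsStage (z : VRank lam) : Prop :=
  ∃ h : VRank lam, IsHistory h ∧
    ∀ x : VRank lam, x.1 ∈ z.1 ↔ ∃ w : VRank lam, w.1 ∈ h.1 ∧ x.1 ⊆ w.1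

theorem FODefinable.isHistory {ι κ : Type} (i : ι) :
    FODefinable (lam := lam) (κ := κ) fun x _ => IsHistory (x i) :=
  all ((mem none (some i)).imp (all ((mem none (some none)).iff
    (ex (((mem none (some (some (some i)))).and (mem none (some (some none)))).and
      (subset (some none) none))))))

theorem FODefinable.isStage {ι κ : Type} (i : ι) :
    FODefinable (lam := lam) (κ := κ) fun x _ => IsStage (x i) :=
  ex ((FODefinable.isHistory none).and
    (all ((mem none (some (some i))).iff (ex ((mem none (some (some none))).and
      (subset (some none) none))))))

theorem eq_vonNeumann_rank_of_forall_mem {x : VRank lam}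
    (h : ∀ y z : ZFSet.{u}, z ∈ x.1 → y.rank ≤ z.rank → y ∈ x.1) : x.1 = V_ x.1.rank := by
  refine le_antisymm (ZFSet.subset_vonNeumann_self _) fun y hy => ?_
  rw [ZFSet.mem_vonNeumann, ZFSet.lt_rank_iff] at hy
  obtain ⟨z, hz, hyz⟩ := hy
  exact h y z hz hyz

theorem mem_of_subset_vonNeumann_rank {x w : VRank lam} {y z : ZFSet.{u}}
    (hx : ∀ y : VRank lam, y.1 ⊆ w.1 → y.1 ∈ x.1) (hw : w.1 = V_ w.1.rank) (hzw : z ⊆ w.1)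
    (hyz : y.rank ≤ z.rank) : y ∈ x.1 := by
  have hyw : y ⊆ w.1 := by
    rw [hw, ZFSet.subset_vonNeumann]
    exact hyz.trans (ZFSet.rank_mono hzw)
  exact hx ⟨y, ZFSet.mem_vonNeumann_of_subset hyw w.2⟩ hyw

theorem IsHistory.eq_vonNeumann_rank {h : VRank lam} (hh : IsHistory h) {v : VRank lam}
    (hv : v.1 ∈ h.1) : v.1 = V_ v.1.rank := by
  obtain ⟨x, hx⟩ := v
  induction x using ZFSet.inductionOn with
  | h x ih =>
    refine eq_vonNeumann_rank_of_forall_mem fun y z hz hyz => ?_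
    obtain ⟨w, ⟨hwh, hwx⟩, hzw⟩ := (hh _ hv ⟨z, mem_vonNeumann_of_mem ⟨x, hx⟩ hz⟩).1 hz
    exact mem_of_subset_vonNeumann_rank (fun y hyw => (hh _ hv y).2 ⟨w, ⟨hwh, hwx⟩, hyw⟩)
      (ih w.1 hwx w.2 hwh) hzw hyz

theorem IsStage.eq_vonNeumann_rank {z : VRank lam} (h : IsStage z) : z.1 = V_ z.1.rank := by
  obtain ⟨h, hh, hz⟩ := h
  refine eq_vonNeumann_rank_of_forall_mem fun y x hx hyx => ?_
  obtain ⟨w, hwh, hxw⟩ := (hz ⟨x, z.mem_vonNeumann_of_mem hx⟩).1 hx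
  exact mem_of_subset_vonNeumann_rank (fun y hyw => (hz y).2 ⟨w, hwh, hyw⟩)
    (hh.eq_vonNeumann_rank hwh) hxw hyx

theorem isStage_stage {α : Ordinal.{u}} (hα : α < lam) : IsStage (stage α hα) := by
  obtain ⟨h, hh⟩ :=
    exists_of_rank_lt hα (fun w => w.1.rank < α ∧ w.1 = V_ w.1.rank) fun _ hw => hw.1
  have exists_stage_iff : ∀ γ ≤ α, ∀ x : VRank lam, x.1.rank < γ ↔
      ∃ w : VRank lam, (w.1 ∈ h.1 ∧ w.1.rank < γ) ∧ x.1 ⊆ w.1 := by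
    refine fun γ hγ x => ⟨fun hx => ?_, fun ⟨w, ⟨_, hw⟩, hxw⟩ => (ZFSet.rank_mono hxw).trans_lt hw⟩
    have hrank : (stage x.1.rank x.rank_lt).1.rank = x.1.rank := rank_stage _
    refine ⟨stage x.1.rank x.rank_lt, ⟨(hh _).2 ⟨?_, ?_⟩, ?_⟩, ZFSet.subset_vonNeumann_self _⟩
    · exact hrank.trans_lt (hx.trans_le hγ)
    · rw [hrank, stage]
    · exact hrank.trans_lt hx
  refine ⟨h, fun v hv x => ?_, fun x => ?_⟩
  · obtain ⟨hvα, hv⟩ := (hh v).1 hv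
    have hmem : ∀ y : ZFSet.{u}, y ∈ v.1 ↔ y.rank < v.1.rank := fun y => by
      rw [hv, ZFSet.mem_vonNeumann, ZFSet.rank_vonNeumann]
    simp only [hmem]
    exact exists_stage_iff _ hvα.le x
  · rw [mem_stage, exists_stage_iff α le_rfl]
    exact exists_congr fun w => and_congr_left' (and_iff_left_of_imp fun hw => ((hh w).1 hw).1)

theorem isStage_iff {z : VRank lam} : IsStage z ↔ ∃ α, ∃ h : α < lam, z = stage α h :=
  ⟨fun h => ⟨_, z.rank_lt, Subtype.ext h.eq_vonNeumann_rank⟩, by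
    rintro ⟨α, hα, rfl⟩
    exact isStage_stage hα⟩

theorem eq_stage_rank_iff {x z : VRank lam} : z = stage x.1.rank x.rank_lt ↔
    IsStage z ∧ x.1 ⊆ z.1 ∧ ∀ y : VRank lam, IsStage y → x.1 ⊆ y.1 → z.1 ⊆ y.1 := by
  constructor
  · rintro rfl
    refine ⟨isStage_stage _, ZFSet.subset_vonNeumann_self _, fun y hy hxy => ?_⟩
    rw [hy.eq_vonNeumann_rank]
    exact (ZFSet.vonNeumann_subset_vonNeumann_iff).2 (ZFSet.rank_mono hxy)
  · rintro ⟨hz, hxz, hmin⟩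
    have hle := ZFSet.rank_mono (hmin _ (isStage_stage x.rank_lt) (ZFSet.subset_vonNeumann_self _))
    rw [rank_stage] at hle
    refine Subtype.ext (hz.eq_vonNeumann_rank.trans ?_)
    rw [hle.antisymm (ZFSet.rank_mono hxz), stage]

/-- `w` is an ordinal. -/
def IsOrd (w : VRank lam) : Prop :=
  (∀ a : VRank lam, a.1 ∈ w.1 → a.1 ⊆ w.1) ∧
    ∀ a : VRank lam, a.1 ∈ w.1 → ∀ b : VRank lam, b.1 ∈ a.1 → b.1 ⊆ a.1

theorem FODefinable.isOrd {ι κ : Type} (i : ι) :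
    FODefinable (lam := lam) (κ := κ) fun x _ => IsOrd (x i) :=
  (all ((mem none (some i)).imp (subset none (some i)))).and
    (all ((mem none (some i)).imp (all ((mem none (some none)).imp (subset none (some none))))))

theorem isOrd_iff {w : VRank lam} : IsOrd w ↔ w.1.IsOrdinal := by
  rw [ZFSet.isOrdinal_iff_forall_mem_isTransitive]
  refine ⟨fun h => ⟨fun a ha => h.1 ⟨a, w.mem_vonNeumann_of_mem ha⟩ ha, fun a ha b hb => ?_⟩,
    fun h => ⟨fun a => h.1 a, fun a ha b => h.2 _ ha b⟩⟩
  have hav := w.mem_vonNeumann_of_mem ha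
  exact h.2 ⟨a, hav⟩ ha ⟨b, mem_vonNeumann_of_mem ⟨a, hav⟩ hb⟩ hb

theorem mem_toZFSet_iff {α : Ordinal.{u}} (hα : α < lam) {w : VRank lam} :
    w.1 ∈ α.toZFSet ↔ w.1 ∈ (stage α hα).1 ∧ IsOrd w := by
  rw [isOrd_iff, mem_stage, Ordinal.mem_toZFSet_iff]
  constructor
  · rintro ⟨a, ha, e⟩
    rw [← e, Ordinal.rank_toZFSet]
    exact ⟨ha, ZFSet.isOrdinal_toZFSet a⟩
  · rintro ⟨hr, ho⟩
    exact ⟨_, hr, ho.toZFSet_rank_eq⟩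

theorem toZFSet_mem_vonNeumann {α : Ordinal.{u}} (hα : α < lam) : α.toZFSet ∈ V_ lam := by
  rwa [ZFSet.mem_vonNeumann, Ordinal.rank_toZFSet]

/-- Maps of `V_λ` into itself that are elementary for `∈`. -/
def IsElementary (j : VRank lam → VRank lam) : Prop :=
  ∃ e : VRank lam ↪ₑ[setLang 0] VRank lam, ⇑e = j

/-- The action of a map of `V_λ` on (indices of) levels, extended by the identity to the ordinals
`α ≥ λ`. -/
noncomputable def ordMap (j : VRank lam → VRank lam) (α : Ordinal.{u}) : Ordinal.{u} :=
  open Classical in if h : α < lam then (j (stage α h)).1.rank else α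

theorem ordMap_lt (j : VRank lam → VRank lam) {α : Ordinal.{u}} (h : α < lam) :
    ordMap j α < lam := by
  rw [ordMap, dif_pos h]
  exact rank_lt _

theorem ordMap_eq_of_map_stage {j : VRank lam → VRank lam} {α β : Ordinal.{u}} (h : α < lam)
    (hβ : β < lam) (e : j (stage α h) = stage β hβ) : ordMap j α = β := by
  rw [ordMap, dif_pos h, e]
  exact ZFSet.rank_vonNeumann β

namespace IsElementary

variable {j : VRank lam → VRank lam} {α β κ : Ordinal.{u}}

theorem iff (hj : IsElementary j) {ι : Type}
    {P : (ι → VRank lam) → (Empty → Set (VRank lam)) → Prop} (h : FODefinable P)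
    (x : ι → VRank lam) : P x nofun ↔ P (fun i => j (x i)) nofun := by
  obtain ⟨e, rfl⟩ := hj
  obtain ⟨φ, hφ⟩ := h 0 nofun
  have realize_iff : ∀ y, φ.Realize y ↔ P y nofun := fun y =>
    (hφ Fin.elim0 y).trans (iff_of_eq (congrArg (P y) (Subsingleton.elim _ _)))
  exact (realize_iff x).symm.trans ((e.map_formula φ x).symm.trans (realize_iff (e ∘ x)))

theorem iff₁ (hj : IsElementary j) {R : VRank lam → Prop}
    (h : FODefinable (ι := Fin 1) (κ := Empty) fun x _ => R (x 0)) (a : VRank lam) :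
    R a ↔ R (j a) := hj.iff h ![a]

theorem iff₂ (hj : IsElementary j) {R : VRank lam → VRank lam → Prop}
    (h : FODefinable (ι := Fin 2) (κ := Empty) fun x _ => R (x 0) (x 1)) (a b : VRank lam) :
    R a b ↔ R (j a) (j b) := hj.iff h ![a, b]

theorem iff₃ (hj : IsElementary j) {R : VRank lam → VRank lam → VRank lam → Prop}
    (h : FODefinable (ι := Fin 3) (κ := Empty) fun x _ => R (x 0) (x 1) (x 2))
    (a b c : VRank lam) : R a b c ↔ R (j a) (j b) (j c) := hj.iff h ![a, b, c]

theorem mem_iff (hj : IsElementary j) {x y : VRank lam} : (j x).1 ∈ (j y).1 ↔ x.1 ∈ y.1 :=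
  (hj.iff₂ (R := fun x y => x.1 ∈ y.1) (.mem 0 1) x y).symm

theorem injective (hj : IsElementary j) : Function.Injective j := fun x y =>
  (hj.iff₂ (R := fun x y => x = y) (.eq 0 1) x y).2

theorem map_stage (hj : IsElementary j) (h : α < lam) :
    j (stage α h) = stage (ordMap j α) (ordMap_lt j h) := by
  obtain ⟨β, hβ, e⟩ := isStage_iff.1 ((hj.iff₁ (.isStage 0) _).1 (isStage_stage h))
  rw [e, stage_inj, ordMap_eq_of_map_stage h hβ e]

theorem mem_map_stage (hj : IsElementary j) (h : α < lam) {x : VRank lam} :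
    x.1 ∈ (j (stage α h)).1 ↔ x.1.rank < ordMap j α := by
  rw [hj.map_stage, mem_stage]

theorem ordMap_lt_iff (hj : IsElementary j) (hα : α < lam) (hβ : β < lam) :
    ordMap j α < ordMap j β ↔ α < β := by
  have := hj.mem_iff (x := stage α hα) (y := stage β hβ)
  rw [hj.map_stage, hj.map_stage] at this
  simpa [stage] using this

theorem ordMap_le_iff (hj : IsElementary j) (hα : α < lam) (hβ : β < lam) :
    ordMap j α ≤ ordMap j β ↔ α ≤ β := by
  rw [← not_lt, hj.ordMap_lt_iff hβ hα, not_lt]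

theorem le_ordMap (hj : IsElementary j) (hα : α < lam) : α ≤ ordMap j α := by
  induction α using WellFoundedLT.induction with
  | ind α ih =>
    by_contra! h
    exact ((ih _ h (ordMap_lt j hα)).trans_lt ((hj.ordMap_lt_iff (ordMap_lt j hα) hα).2 h)).false

theorem rank_map (hj : IsElementary j) (x : VRank lam) : (j x).1.rank = ordMap j x.1.rank := by
  have h := (hj.iff₂ (R := fun x z : VRank lam => IsStage z ∧ x.1 ⊆ z.1 ∧
      ∀ y : VRank lam, IsStage y → x.1 ⊆ y.1 → z.1 ⊆ y.1)
    ((FODefinable.isStage 1).and ((FODefinable.subset 0 1).and (.all ((FODefinable.isStage none).imp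
      ((FODefinable.subset (some 0) none).imp (.subset (some 1) none)))))) x _).1
    (eq_stage_rank_iff.1 rfl)
  rw [← eq_stage_rank_iff, hj.map_stage, stage_inj] at h
  exact h.symm

theorem map_eq_self (hj : IsElementary j) (h : ∀ α < κ, α < lam → ordMap j α = α) (x : VRank lam)
    (hx : x.1.rank < κ) : j x = x := by
  suffices ∀ α < κ, ∀ x : VRank lam, x.1.rank = α → j x = x from this _ hx x rfl
  intro α
  induction α using WellFoundedLT.induction with
  | ind α ih =>
    intro hα x hxα
    have hrank : (j x).1.rank = α := by rw [hj.rank_map, h _ (hxα ▸ hα) x.rank_lt, hxα]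
    refine ext fun w => ⟨fun hw => ?_, fun hw => ?_⟩
    · have hwr : w.1.rank < α := hrank ▸ ZFSet.rank_lt_of_mem hw
      rwa [← ih _ hwr (hwr.trans hα) w rfl, hj.mem_iff] at hw
    · have hwr : w.1.rank < α := hxα ▸ ZFSet.rank_lt_of_mem hw
      rwa [← ih _ hwr (hwr.trans hα) w rfl, hj.mem_iff]

theorem map_ordinal (hj : IsElementary j) (h : α.toZFSet ∈ V_ lam) :
    (j ⟨α.toZFSet, h⟩).1 = (ordMap j α).toZFSet := by
  have hα : α < lam := Ordinal.rank_toZFSet α ▸ ZFSet.mem_vonNeumann.1 h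
  have hj' := (hj.iff₂ (R := fun z v : VRank lam => ∀ w, w.1 ∈ z.1 ↔ w.1 ∈ v.1 ∧ IsOrd w)
    (.all ((FODefinable.mem none (some 0)).iff
      ((FODefinable.mem none (some 1)).and (.isOrd none)))) ⟨_, h⟩ _).1
    fun _ => mem_toZFSet_iff hα
  rw [hj.map_stage] at hj'
  exact congrArg Subtype.val (ext (y := ⟨_, toZFSet_mem_vonNeumann (ordMap_lt j hα)⟩)
    fun w => (hj' w).trans (mem_toZFSet_iff (ordMap_lt j hα)).symm)

theorem critPt_eq (hj : IsElementary j) : critPt j = sInf {κ | κ < lam ∧ κ < ordMap j κ} := by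
  rw [critPt]
  congr 1
  ext κ
  constructor
  · rintro ⟨h, hκ⟩
    rw [hj.map_ordinal, Ordinal.toZFSet_mem_toZFSet_iff] at hκ
    exact ⟨Ordinal.rank_toZFSet κ ▸ ZFSet.mem_vonNeumann.1 h, hκ⟩
  · rintro ⟨h, hκ⟩
    refine ⟨toZFSet_mem_vonNeumann h, ?_⟩
    rwa [hj.map_ordinal, Ordinal.toZFSet_mem_toZFSet_iff]

theorem critPt_eq_of_forall_lt (hj : IsElementary j) (hκ : κ < lam) (h : κ < ordMap j κ)
    (hmin : ∀ α < κ, ordMap j α = α) : critPt j = κ := by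
  rw [hj.critPt_eq]
  refine le_antisymm (csInf_le' ⟨hκ, h⟩) (le_csInf ⟨κ, hκ, h⟩ ?_)
  rintro α ⟨-, hα⟩
  by_contra! hlt
  exact hα.ne' (hmin α hlt)

theorem critPt_spec (hj : IsElementary j) (hne : j ≠ id) :
    critPt j < lam ∧ critPt j < ordMap j (critPt j) ∧ ∀ α < critPt j, ordMap j α = α := by
  have hnon : {κ | κ < lam ∧ κ < ordMap j κ}.Nonempty := by
    by_contra! hemp
    refine hne (funext fun x => hj.map_eq_self (κ := lam) (fun α _ hα => ?_) x x.rank_lt)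
    by_contra hne
    exact hemp.subset ⟨hα, (hj.le_ordMap hα).lt_of_ne' hne⟩
  have hmem := csInf_mem hnon
  rw [← hj.critPt_eq] at hmem
  refine ⟨hmem.1, hmem.2, fun α hα => ?_⟩
  by_contra hne
  have hαlam := hα.trans hmem.1
  rw [hj.critPt_eq] at hα
  exact notMem_of_lt_csInf' hα ⟨hαlam, (hj.le_ordMap hαlam).lt_of_ne' hne⟩

end IsElementary

theorem rank_pair_lt {α : Ordinal.{u}} (hα : Order.IsSuccLimit α) {x y : ZFSet.{u}}
    (hx : x.rank < α) (hy : y.rank < α) : (ZFSet.pair x y).rank < α := by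
  simp only [ZFSet.pair, ZFSet.rank_pair, ZFSet.rank_singleton, max_lt_iff, hα.succ_lt_iff, hx, hy,
    and_self]

theorem rank_fst_lt_pair (x y : ZFSet.{u}) : x.rank < (ZFSet.pair x y).rank :=
  (ZFSet.rank_lt_of_mem (ZFSet.mem_singleton.2 rfl : x ∈ ({x} : ZFSet))).trans
    (ZFSet.rank_lt_of_mem (by simp [ZFSet.pair]))

theorem rank_snd_lt_pair (x y : ZFSet.{u}) : y.rank < (ZFSet.pair x y).rank :=
  (ZFSet.rank_lt_of_mem (by simp : y ∈ ({x, y} : ZFSet))).trans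
    (ZFSet.rank_lt_of_mem (by simp [ZFSet.pair]))

/-- `z` is an inductive set: it contains the empty set and is closed under successors. -/
def Inductive (z : VRank lam) : Prop :=
  (∃ e : VRank lam, e.1 ∈ z.1 ∧ ∀ u : VRank lam, ¬ u.1 ∈ e.1) ∧
    ∀ n : VRank lam, n.1 ∈ z.1 → ∃ m : VRank lam, m.1 ∈ z.1 ∧
      ∀ u : VRank lam, u.1 ∈ m.1 ↔ u.1 ∈ n.1 ∨ u = n

/-- `z` is the set of natural numbers, the least inductive set. -/
def IsOmega (z : VRank lam) : Prop :=
  Inductive z ∧ ∀ y : VRank lam, Inductive y → ∀ n : VRank lam, n.1 ∈ z.1 → n.1 ∈ y.1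

theorem FODefinable.inductive {ι κ : Type} (i : ι) :
    FODefinable (lam := lam) (κ := κ) fun x _ => Inductive (x i) :=
  (ex ((mem none (some i)).and (all (mem none (some none)).not))).and
    (all ((mem none (some i)).imp (ex ((mem none (some (some i))).and
      (all ((mem none (some none)).iff
        ((mem none (some (some none))).or (eq none (some (some none))))))))))

theorem FODefinable.isOmega {ι κ : Type} (i : ι) :
    FODefinable (lam := lam) (κ := κ) fun x _ => IsOmega (x i) :=
  (FODefinable.inductive i).and (all ((FODefinable.inductive none).imp
    (all ((mem none (some (some i))).imp (mem none (some none))))))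

theorem exists_union (x y : VRank lam) :
    ∃ z : VRank lam, ∀ w : VRank lam, w.1 ∈ z.1 ↔ w.1 ∈ x.1 ∨ w.1 ∈ y.1 :=
  exists_of_rank_lt (max_lt x.rank_lt y.rank_lt) _ fun _ hw =>
    lt_max_iff.2 (hw.imp ZFSet.rank_lt_of_mem ZFSet.rank_lt_of_mem)

theorem eq_singleton_iff {w x : VRank lam} :
    w.1 = {x.1} ↔ ∀ u : VRank lam, u.1 ∈ w.1 ↔ u = x := by
  refine ⟨fun h u => by rw [h, ZFSet.mem_singleton, Subtype.ext_iff],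
    fun h => ZFSet.ext fun u => ?_⟩
  rw [ZFSet.mem_singleton]
  exact ⟨fun hu => congrArg Subtype.val ((h ⟨u, w.mem_vonNeumann_of_mem hu⟩).1 hu),
    fun hu => hu ▸ (h x).2 rfl⟩

theorem eq_pair_set_iff {w x y : VRank lam} :
    w.1 = {x.1, y.1} ↔ ∀ u : VRank lam, u.1 ∈ w.1 ↔ u = x ∨ u = y := by
  refine ⟨fun h u => by rw [h, ZFSet.mem_pair, Subtype.ext_iff, Subtype.ext_iff],
    fun h => ZFSet.ext fun u => ?_⟩
  rw [ZFSet.mem_pair]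
  refine ⟨fun hu => ((h ⟨u, w.mem_vonNeumann_of_mem hu⟩).1 hu).imp
    (congrArg Subtype.val) (congrArg Subtype.val), ?_⟩
  rintro (rfl | rfl)
  · exact (h x).2 (.inl rfl)
  · exact (h y).2 (.inr rfl)

/-- The binary relations between two entries of a tuple that serve as atomic formulas. -/
inductive BasicRel
  | mem
  | memRev
  | eq

/-- The relation on `V_λ` named by a `BasicRel`. -/
def BasicRel.Holds : BasicRel → VRank lam → VRank lam → Prop
  | mem, a, b => a.1 ∈ b.1
  | memRev, a, b => b.1 ∈ a.1
  | eq, a, b => a = b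

/-- The converse relation. -/
def BasicRel.swap : BasicRel → BasicRel
  | mem => memRev
  | memRev => mem
  | eq => eq

theorem BasicRel.holds_swap {R : BasicRel} {a b : VRank lam} :
    R.swap.Holds a b ↔ R.Holds b a := by
  cases R
  exacts [Iff.rfl, Iff.rfl, eq_comm]

theorem BasicRel.holds_self {R : BasicRel} (a : VRank lam) : R.Holds a a ↔ R = eq := by
  cases R <;> simp [Holds, ZFSet.mem_irrefl]

instance : Finite BasicRel :=
  Set.finite_univ_iff.1 <| (Set.toFinite {.mem, .memRev, .eq}).subset fun R _ => by
    cases R <;> simp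

theorem FODefinable.basicRel {ι κ : Type} (R : BasicRel) (i k : ι) :
    FODefinable (lam := lam) (κ := κ) fun x _ => R.Holds (x i) (x k) :=
  match R with
  | .mem => mem i k
  | .memRev => mem k i
  | .eq => eq i k

/-- The critical sequence `crit j, j (crit j), j (j (crit j)), …` of an embedding. -/
noncomputable def critSeq (j : VRank lam → VRank lam) (n : ℕ) : Ordinal.{u} :=
  (ordMap j)^[n] (critPt j)

theorem critSeq_succ (j : VRank lam → VRank lam) (n : ℕ) :
    critSeq j (n + 1) = ordMap j (critSeq j n) :=
  Function.iterate_succ_apply' _ _ _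

namespace IsElementary

variable {j : VRank lam → VRank lam}

theorem critSeq_lt (hj : IsElementary j) (hne : j ≠ id) (n : ℕ) : critSeq j n < lam := by
  induction n with
  | zero => exact (hj.critPt_spec hne).1
  | succ n ih => exact critSeq_succ j n ▸ ordMap_lt j ih

theorem critSeq_lt_succ (hj : IsElementary j) (hne : j ≠ id) (n : ℕ) :
    critSeq j n < critSeq j (n + 1) := by
  induction n with
  | zero => exact (hj.critPt_spec hne).2.1
  | succ n ih =>
    rw [critSeq_succ, critSeq_succ j (n + 1)]
    exact (hj.ordMap_lt_iff (hj.critSeq_lt hne n) (hj.critSeq_lt hne (n + 1))).2 ih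

theorem critSeq_strictMono (hj : IsElementary j) (hne : j ≠ id) : StrictMono (critSeq j) :=
  strictMono_nat_of_lt_succ (hj.critSeq_lt_succ hne)

theorem stage_critPt_notMem_range (hj : IsElementary j) (hne : j ≠ id)
    (hκ : critPt j < lam) : stage (critPt j) hκ ∉ Set.range j := by
  obtain ⟨-, hlt, hfix⟩ := hj.critPt_spec hne
  rintro ⟨y, hy⟩
  obtain ⟨β, hβ, rfl⟩ := isStage_iff.1 ((hj.iff₁ (R := IsStage) (.isStage 0) y).2
    (isStage_iff.2 ⟨_, hκ, hy⟩))
  rw [hj.map_stage, stage_inj] at hy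
  rcases lt_or_ge β (critPt j) with h | h
  · exact h.ne ((hfix β h).symm.trans hy)
  · exact (hlt.trans_le ((hj.ordMap_le_iff hκ hβ).2 h)).ne' hy

end IsElementary

-- A subset of `V_μ` is coded by its intersections with countably many smaller levels.
theorem exists_injective_set_seq {μ : Ordinal.{u}} (hμ : μ < lam)
    {c : ℕ → Ordinal.{u}} (hc : ∀ n, c n < μ) (hcof : ∀ α < μ, ∃ n, α < c n) :
    ∃ e : Set {w : VRank lam // w.1 ∈ (stage μ hμ).1} →
      ℕ → {w : VRank lam // w.1 ∈ (stage μ hμ).1}, Function.Injective e := by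
  have hcl : ∀ n, c n < lam := fun n => (hc n).trans hμ
  let inter (A : Set {w : VRank lam // w.1 ∈ (stage μ hμ).1}) (n : ℕ) : VRank lam :=
    sep (stage (c n) (hcl n)) fun w => ∃ h : w.1 ∈ (stage μ hμ).1, ⟨w, h⟩ ∈ A
  have inter_mem : ∀ A n, (inter A n).1 ∈ (stage μ hμ).1 := fun A n => by
    refine mem_stage.2 (lt_of_le_of_lt (ZFSet.subset_vonNeumann.1 ?_) (hc n))
    exact (subset_iff (y := stage (c n) (hcl n))).2 fun w hw => (mem_sep.1 hw).1
  refine ⟨fun A n => ⟨inter A n, inter_mem A n⟩, fun A B h => ?_⟩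
  ext ⟨w, hw⟩
  obtain ⟨n, hn⟩ := hcof _ (mem_stage.1 hw)
  have inter_eq : inter A n = inter B n := congrArg Subtype.val (congrFun h n)
  have mem_inter : ∀ A, w.1 ∈ (inter A n).1 ↔ ⟨w, hw⟩ ∈ A := fun A =>
    mem_sep.trans ((and_iff_right (mem_stage.2 hn)).trans (exists_prop_of_true hw))
  rw [← mem_inter, ← mem_inter, inter_eq]

theorem compUpTo_succ (k : ℕ → VRank lam → VRank lam) (n : ℕ) :
    compUpTo k (n + 1) = k 0 ∘ compUpTo (fun i => k (i + 1)) n := by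
  induction n with
  | zero => rfl
  | succ n ih => rw [compUpTo, ih, compUpTo, Function.comp_assoc]

/-- `K` is the pointwise eventual value of the finite compositions `k₀ ∘ ⋯ ∘ kₙ`. This is the
inverse limit without the condition on critical points, so it applies to shifts of a sequence and
to sequences that are not known to consist of nontrivial embeddings. -/
def IsPointwiseLimit (k : ℕ → VRank lam → VRank lam) (K : VRank lam → VRank lam) : Prop :=
  ∀ a, ∀ᶠ n in Filter.atTop, compUpTo k n a = K a

namespace IsPointwiseLimit

variable {k : ℕ → VRank lam → VRank lam} {K L : VRank lam → VRank lam}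

theorem unique (hK : IsPointwiseLimit k K) (hL : IsPointwiseLimit k L) : K = L :=
  funext fun a => let ⟨_, h₁, h₂⟩ := ((hK a).and (hL a)).exists; h₁.symm.trans h₂

theorem comp (hK : IsPointwiseLimit (fun n => k (n + 1)) K) : IsPointwiseLimit k (k 0 ∘ K) := by
  intro a
  rw [← Filter.map_add_atTop_eq_nat 1, Filter.eventually_map]
  filter_upwards [hK a] with n hn
  rw [compUpTo_succ, Function.comp_apply, Function.comp_apply, hn]

theorem shift_eq {n : ℕ} (hK : IsPointwiseLimit (fun i => k (i + n)) K)
    (hL : IsPointwiseLimit (fun i => k (i + (n + 1))) L) : K = k n ∘ L := by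
  have hcomm : (fun i => k (i + (n + 1))) = fun i => k (i + 1 + n) :=
    funext fun i => congrArg k (by omega)
  rw [hcomm] at hL
  simpa only [zero_add] using hK.unique (comp (k := fun i => k (i + n)) hL)

end IsPointwiseLimit

/-- `l` reflects the property `P` of subsets of `V_λ`. -/
def Reflects (l : VRank lam → VRank lam) {κ : Type} (P : (κ → Set (VRank lam)) → Prop) : Prop :=
  ∀ E, P (fun k => extendEmb l (E k)) → P E

/-- `l` reflects all `Σ¹_m` properties. -/
def ReflectsSigma (m : ℕ) (l : VRank lam → VRank lam) : Prop :=
  ∀ (κ : Type) [Finite κ] (P : (κ → Set (VRank lam)) → Prop), SODefinable true m P → Reflects l P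

theorem reflectsSigma_of_sigmaElementary {l : VRank lam → VRank lam} {m : ℕ}
    (h : SigmaElementary m l) : ReflectsSigma m l := by
  intro κ _ P hP E hE
  obtain ⟨q, ⟨f⟩⟩ := Finite.exists_equiv_fin κ
  obtain ⟨φ, hφ, hφP⟩ := hP.exists_formula f
  have h := (h 0 q φ hφ nofun fun i => E (f.symm i)).2 ((hφP _ _).2 (by simpa using hE))
  simpa using (hφP _ _).1 h

namespace ReflectsSigma

variable {l : VRank lam → VRank lam} {m n : ℕ}

theorem map_of_holds (h : ReflectsSigma m l) {κ : Type} [Finite κ]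
    {P : (κ → Set (VRank lam)) → Prop} (hP : SODefinable true m P) {E : κ → Set (VRank lam)}
    (hE : P E) : P fun k => extendEmb l (E k) := by
  by_contra hn
  cases m with
  | zero => exact h κ _ (SODefinable.not (b := false) (m := 0) (P := P) hP) E hn hE
  | succ m =>
    obtain ⟨β, hβ, R, hR, hPR⟩ := hP
    obtain ⟨Y, hY⟩ := (hPR E).1 hE
    refine hn ((hPR _).2 ⟨fun b => extendEmb l (Y b), by_contra fun hn => ?_⟩)
    refine h _ _ hR.not.succ (Sum.elim E Y) (fun hR => hn ?_) hY
    refine (iff_of_eq (congrArg R ?_)).1 hR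
    funext k
    rcases k with k | k <;> rfl

theorem mono (h : ReflectsSigma n l) (hmn : m ≤ n) : ReflectsSigma m l :=
  fun κ _ P hP => h κ P (hP.mono hmn)

end ReflectsSigma

theorem isElementary_of_mem_irng {l h : VRank lam → VRank lam} (hh : h ∈ irng l) :
    IsElementary h := by
  obtain ⟨n, hn⟩ := Set.mem_iUnion.1 hh
  cases n with
  | zero => exact hn.1.1
  | succ n =>
    obtain ⟨f, -, hf⟩ := Set.mem_iUnion₂.1 hn
    exact hf.1.1

variable [Fact (Order.IsSuccLimit lam)]

/-- The Kuratowski pair `(x, y)`, which lies in `V_λ` because `λ` is a limit. -/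
def pair (x y : VRank lam) : VRank lam :=
  ⟨ZFSet.pair x.1 y.1, ZFSet.mem_vonNeumann.2 (rank_pair_lt Fact.out x.rank_lt y.rank_lt)⟩

theorem pair_inj {x y x' y' : VRank lam} : pair x y = pair x' y' ↔ x = x' ∧ y = y' := by
  rw [pair, pair, Subtype.mk_eq_mk, ZFSet.pair_inj, Subtype.ext_iff, Subtype.ext_iff]

theorem rank_lt_of_pair_mem {a b z : VRank lam} (h : (pair a b).1 ∈ z.1) :
    a.1.rank < z.1.rank ∧ b.1.rank < z.1.rank :=
  ⟨(rank_fst_lt_pair _ _).trans (ZFSet.rank_lt_of_mem h),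
    (rank_snd_lt_pair _ _).trans (ZFSet.rank_lt_of_mem h)⟩

theorem succ_lt {α : Ordinal.{u}} (h : α < lam) : Order.succ α < lam :=
  (Fact.out : Order.IsSuccLimit lam).succ_lt h

theorem natCast_lt (n : ℕ) : (n : Ordinal.{u}) < lam :=
  (Ordinal.natCast_lt_omega0 n).trans_le (Ordinal.omega0_le_of_isSuccLimit Fact.out)

theorem exists_singleton (x : VRank lam) : ∃ z : VRank lam, ∀ w, w.1 ∈ z.1 ↔ w = x :=
  exists_of_rank_lt (succ_lt x.rank_lt) (· = x) fun _ h => h ▸ Order.lt_succ _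

theorem exists_powerset (x : VRank lam) :
    ∃ z : VRank lam, ∀ w : VRank lam, w.1 ∈ z.1 ↔ w.1 ⊆ x.1 :=
  exists_of_rank_lt (succ_lt x.rank_lt) (fun w => w.1 ⊆ x.1)
    fun _ hw => Order.lt_succ_of_le (ZFSet.rank_mono hw)

theorem exists_prod (x y : VRank lam) : ∃ z : VRank lam, ∀ w : VRank lam,
    w.1 ∈ z.1 ↔ ∃ a b, a.1 ∈ x.1 ∧ b.1 ∈ y.1 ∧ w = pair a b := by
  refine exists_of_rank_lt (succ_lt (succ_lt (max_lt x.rank_lt y.rank_lt))) _ ?_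
  rintro _ ⟨a, b, ha, hb, rfl⟩
  have ha' : a.1.rank < max x.1.rank y.1.rank := lt_max_of_lt_left (ZFSet.rank_lt_of_mem ha)
  have hb' : b.1.rank < max x.1.rank y.1.rank := lt_max_of_lt_right (ZFSet.rank_lt_of_mem hb)
  simp only [pair, ZFSet.pair, ZFSet.rank_pair, ZFSet.rank_singleton, max_lt_iff,
    Order.succ_lt_succ_iff, ha', hb', and_self]

theorem exists_stage_superset (z : VRank lam) :
    ∃ y : VRank lam, ∀ w : VRank lam, w.1.rank ≤ z.1.rank → w.1 ∈ y.1 :=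
  ⟨stage _ (succ_lt z.rank_lt), fun _ hw => mem_stage.2 (Order.lt_succ_of_le hw)⟩

theorem mem_pair {x y w : VRank lam} : w.1 ∈ (pair x y).1 ↔
    (∀ u : VRank lam, u.1 ∈ w.1 ↔ u = x) ∨ ∀ u : VRank lam, u.1 ∈ w.1 ↔ u = x ∨ u = y := by
  rw [← eq_singleton_iff, ← eq_pair_set_iff]
  exact ZFSet.mem_pair

namespace FODefinable

variable {ι κ : Type}

theorem eq_pair (i j k : ι) :
    FODefinable (lam := lam) (κ := κ) fun x _ => x i = pair (x j) (x k) := by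
  have eq_pair_iff : ∀ z a b : VRank lam, z = pair a b ↔ ∀ w : VRank lam, w.1 ∈ z.1 ↔
      (∀ u : VRank lam, u.1 ∈ w.1 ↔ u = a) ∨ ∀ u : VRank lam, u.1 ∈ w.1 ↔ u = a ∨ u = b :=
    fun z a b => ⟨fun h w => by rw [h, mem_pair], fun h => ext fun w => (h w).trans mem_pair.symm⟩
  exact (all ((mem none (some i)).iff
    ((all ((mem none (some none)).iff (eq none (some (some j))))).or
      (all ((mem none (some none)).iff
        ((eq none (some (some j))).or (eq none (some (some k))))))))).congr
    fun x _ => eq_pair_iff (x i) (x j) (x k)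

theorem pair_mem (i j k : ι) :
    FODefinable (lam := lam) (κ := κ) fun x _ => (pair (x i) (x j)).1 ∈ (x k).1 :=
  (ex (R := fun x _ w => w = pair (x i) (x j) ∧ w.1 ∈ (x k).1)
    ((eq_pair none (some i) (some j)).and (mem none (some k)))).congr
    fun _ _ => by rw [exists_eq_left]

theorem pair_mem_pred (k : κ) (i j : ι) :
    FODefinable (lam := lam) fun x (X : κ → Set (VRank lam)) => pair (x i) (x j) ∈ X k :=
  (ex (R := fun x X w => w = pair (x i) (x j) ∧ w ∈ X k)
    ((eq_pair none (some i) (some j)).and (pred k none))).congr fun _ _ => by rw [exists_eq_left]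

theorem eq_triple (i j k m : ι) :
    FODefinable (lam := lam) (κ := κ) fun x _ => x i = pair (x j) (pair (x k) (x m)) :=
  (ex (R := fun x _ w => w = pair (x k) (x m) ∧ x i = pair (x j) w)
    ((eq_pair none (some k) (some m)).and (eq_pair (some i) (some j) none))).congr
    fun _ _ => by rw [exists_eq_left]

end FODefinable

/-- The natural number `n` as an element of `V_λ`. -/
noncomputable def numeral (n : ℕ) : VRank lam :=
  ⟨(n : Ordinal.{u}).toZFSet, toZFSet_mem_vonNeumann (natCast_lt n)⟩

theorem rank_numeral (n : ℕ) : (numeral n : VRank lam).1.rank = n := Ordinal.rank_toZFSet _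

theorem notMem_numeral_zero (u : VRank lam) : ¬ u.1 ∈ (numeral 0 : VRank lam).1 := by
  simp [numeral]

theorem mem_numeral_succ (n : ℕ) (u : VRank lam) :
    u.1 ∈ (numeral (n + 1) : VRank lam).1 ↔ u.1 ∈ (numeral n : VRank lam).1 ∨ u = numeral n := by
  simp only [numeral, Nat.cast_add, Nat.cast_one, Ordinal.toZFSet_add_one, ZFSet.mem_insert_iff,
    Subtype.ext_iff]
  exact or_comm

theorem numeral_injective : Function.Injective (numeral : ℕ → VRank lam) := fun _ _ h =>
  Nat.cast_injective (Ordinal.toZFSet_injective (congrArg Subtype.val h))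

theorem Inductive.numeral_mem {z : VRank lam} (hz : Inductive z) (n : ℕ) :
    (numeral n : VRank lam).1 ∈ z.1 := by
  induction n with
  | zero =>
    obtain ⟨e, he, h⟩ := hz.1
    rwa [show (numeral 0 : VRank lam) = e from
      ext fun u => iff_of_false (notMem_numeral_zero u) (h u)]
  | succ n ih =>
    obtain ⟨m, hm, h⟩ := hz.2 _ ih
    rwa [show (numeral (n + 1) : VRank lam) = m from
      ext fun u => (mem_numeral_succ n u).trans (h u).symm]

theorem inductive_of_mem_iff {z : VRank lam}
    (hz : ∀ w : VRank lam, w.1 ∈ z.1 ↔ ∃ n, w = numeral n) : Inductive z := by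
  refine ⟨⟨numeral 0, (hz _).2 ⟨0, rfl⟩, notMem_numeral_zero⟩, fun n hn => ?_⟩
  obtain ⟨k, rfl⟩ := (hz n).1 hn
  exact ⟨numeral (k + 1), (hz _).2 ⟨_, rfl⟩, mem_numeral_succ k⟩

theorem exists_isOmega (h : Ordinal.omega0 < lam) : ∃ z : VRank lam, IsOmega z := by
  obtain ⟨z, hz⟩ := exists_of_rank_lt h (fun w => ∃ n, w = numeral n) (by
    rintro _ ⟨n, rfl⟩
    exact (rank_numeral n).trans_lt (Ordinal.natCast_lt_omega0 n))
  refine ⟨z, inductive_of_mem_iff hz, fun y hy n hn => ?_⟩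
  obtain ⟨k, rfl⟩ := (hz n).1 hn
  exact hy.numeral_mem k

namespace IsOmega

variable {z z' : VRank lam}

theorem mem_iff (hz : IsOmega z) (w : VRank lam) : w.1 ∈ z.1 ↔ ∃ n, w = numeral n := by
  constructor
  · intro hw
    have hsep : Inductive (sep z fun w => ∃ n, w = numeral n) := inductive_of_mem_iff fun w => by
      rw [mem_sep, and_iff_right_iff_imp]
      rintro ⟨n, rfl⟩
      exact hz.1.numeral_mem n
    exact (mem_sep.1 (hz.2 _ hsep w hw)).2
  · rintro ⟨n, rfl⟩
    exact hz.1.numeral_mem n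

theorem numeral_mem (hz : IsOmega z) (n : ℕ) : (numeral n : VRank lam).1 ∈ z.1 := hz.1.numeral_mem n

theorem unique (hz : IsOmega z) (hz' : IsOmega z') : z = z' :=
  ext fun w => by rw [hz.mem_iff, hz'.mem_iff]

end IsOmega

namespace IsElementary

variable {j : VRank lam → VRank lam} {α : Ordinal.{u}}

theorem map_pair (hj : IsElementary j) (x y : VRank lam) : j (pair x y) = pair (j x) (j y) :=
  (hj.iff₃ (R := fun z x y => z = pair x y) (.eq_pair 0 1 2) (pair x y) x y).1 rfl

theorem ordMap_succ (hj : IsElementary j) (hα : α < lam) :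
    ordMap j (Order.succ α) = Order.succ (ordMap j α) := by
  have mem_stage_succ : ∀ {β : Ordinal.{u}} (hβ : β < lam) (w : VRank lam),
      w.1 ∈ (stage (Order.succ β) (succ_lt hβ)).1 ↔ w.1 ⊆ (stage β hβ).1 := fun hβ w => by
    rw [mem_stage, Order.lt_succ_iff, stage, ZFSet.subset_vonNeumann]
  have h := (hj.iff₂ (R := fun z x : VRank lam => ∀ w : VRank lam, w.1 ∈ z.1 ↔ w.1 ⊆ x.1)
    (.all ((FODefinable.mem none (some 0)).iff (.subset none (some 1)))) _ _).1
    (mem_stage_succ hα)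
  rw [hj.map_stage, hj.map_stage] at h
  exact (stage_inj (hα := ordMap_lt j (succ_lt hα)) (hβ := succ_lt (ordMap_lt j hα))).1
    (ext fun w => (h w).trans (mem_stage_succ (ordMap_lt j hα) w).symm)

theorem ordMap_zero (hj : IsElementary j) : ordMap j 0 = 0 := by
  have hlam : (0 : Ordinal.{u}) < lam := mod_cast natCast_lt (lam := lam) 0
  have h := (hj.iff₁ (R := fun z : VRank lam => ∀ w : VRank lam, ¬ w.1 ∈ z.1)
    (.all (FODefinable.mem none (some 0)).not) (stage 0 hlam)).1
    fun w hw => not_lt_zero (mem_stage.1 hw)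
  rw [hj.map_stage] at h
  by_contra hne
  exact h (stage 0 hlam) (mem_stage.2 ((rank_stage _).trans_lt (pos_iff_ne_zero.2 hne)))

theorem ordMap_natCast (hj : IsElementary j) (n : ℕ) : ordMap j n = n := by
  induction n with
  | zero => exact_mod_cast hj.ordMap_zero
  | succ n ih => rw [Nat.cast_succ, ← Order.succ_eq_add_one, hj.ordMap_succ (natCast_lt n), ih]

theorem map_numeral (hj : IsElementary j) (n : ℕ) : j (numeral n) = numeral n := by
  refine Subtype.ext ((hj.map_ordinal _).trans ?_)
  rw [hj.ordMap_natCast]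
  rfl

theorem omega0_lt (hj : IsElementary j) (hne : j ≠ id) : Ordinal.omega0 < lam := by
  obtain ⟨hlam, hlt, -⟩ := hj.critPt_spec hne
  refine lt_of_le_of_lt ?_ hlam
  by_contra! hω
  obtain ⟨n, hn⟩ := Ordinal.lt_omega0.1 hω
  rw [hn, hj.ordMap_natCast] at hlt
  exact hlt.false

end IsElementary

/-! ### Basic embeddings -/

/-- Names of the finitely many set operations that generate the first-order definable sets of
tuples. All of them are given two arguments, some of which they ignore. -/
inductive BasicOp
  | union
  | sdiff
  | singleton
  | prod
  | snd
  | insertMiddle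
  | triple (R : BasicRel)

namespace BasicOp

instance : Finite BasicOp :=
  Set.finite_univ_iff.1 <| (Set.toFinite
    ({.union, .sdiff, .singleton, .prod, .snd, .insertMiddle} ∪ Set.range .triple)).subset
      fun o _ => by cases o <;> simp

/-- The elements of the result of a basic operation with arguments `x` and `y`. -/
def Mem : BasicOp → VRank lam → VRank lam → VRank lam → Prop
  | union, x, y, w => w.1 ∈ x.1 ∨ w.1 ∈ y.1
  | sdiff, x, y, w => w.1 ∈ x.1 ∧ ¬ w.1 ∈ y.1
  | singleton, x, _, w => w = x
  | prod, x, y, w => ∃ a b, a.1 ∈ x.1 ∧ b.1 ∈ y.1 ∧ w = pair a b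
  | snd, x, _, w => ∃ a, (pair a w).1 ∈ x.1
  | insertMiddle, x, y, w => ∃ a b c, ((pair a c).1 ∈ x.1 ∧ b.1 ∈ y.1) ∧ w = pair a (pair b c)
  | triple R, x, y, w =>
    ∃ a b c, (c.1 ∈ x.1 ∧ a.1 ∈ y.1 ∧ b.1 ∈ y.1 ∧ R.Holds a b) ∧ w = pair a (pair b c)

/-- `z` is the result of a basic operation with arguments `x` and `y`. -/
def IsValue (o : BasicOp) (x y z : VRank lam) : Prop :=
  ∀ w : VRank lam, w.1 ∈ z.1 ↔ o.Mem x y w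

theorem exists_triples (x y : VRank lam) (R : VRank lam → VRank lam → VRank lam → Prop)
    (hR : ∀ a b c, R a b c → ∀ d ∈ [a, b, c], d.1.rank < max x.1.rank y.1.rank) :
    ∃ z : VRank lam, ∀ w : VRank lam, w.1 ∈ z.1 ↔ ∃ a b c, R a b c ∧ w = pair a (pair b c) := by
  have hα : max x.1.rank y.1.rank < lam := max_lt x.rank_lt y.rank_lt
  obtain ⟨p, hp⟩ := exists_prod (stage _ hα) (stage _ hα)
  obtain ⟨q, hq⟩ := exists_prod (stage _ hα) p
  refine ⟨sep q fun w => ∃ a b c, R a b c ∧ w = pair a (pair b c), fun w => ?_⟩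
  rw [mem_sep, and_iff_right_iff_imp]
  rintro ⟨a, b, c, h, rfl⟩
  have mem_stage_of_mem : ∀ d ∈ [a, b, c], d.1 ∈ (stage _ hα).1 := fun d hd =>
    mem_stage.2 (hR a b c h d hd)
  exact (hq _).2 ⟨a, _, mem_stage_of_mem a (by simp),
    (hp _).2 ⟨b, c, mem_stage_of_mem b (by simp), mem_stage_of_mem c (by simp), rfl⟩, rfl⟩

theorem exists_isValue (o : BasicOp) (x y : VRank lam) : ∃ z, o.IsValue x y z := by
  cases o with
  | union => exact exists_union x y
  | sdiff => exact ⟨sep x fun w => ¬ w.1 ∈ y.1, fun w => mem_sep⟩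
  | singleton => exact exists_singleton x
  | prod => exact exists_prod x y
  | snd => exact exists_of_rank_lt x.rank_lt _ fun w ⟨a, h⟩ => (rank_lt_of_pair_mem h).2
  | insertMiddle =>
    refine exists_triples x y (fun a b c => (pair a c).1 ∈ x.1 ∧ b.1 ∈ y.1)
      fun a b c ⟨hac, hb⟩ => ?_
    simp [(rank_lt_of_pair_mem hac).1, (rank_lt_of_pair_mem hac).2, ZFSet.rank_lt_of_mem hb]
  | triple R =>
    refine exists_triples x y (fun a b c => c.1 ∈ x.1 ∧ a.1 ∈ y.1 ∧ b.1 ∈ y.1 ∧ R.Holds a b)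
      fun a b c ⟨hc, ha, hb, _⟩ => ?_
    simp [ZFSet.rank_lt_of_mem ha, ZFSet.rank_lt_of_mem hb, ZFSet.rank_lt_of_mem hc]

end BasicOp

namespace FODefinable

variable {ι κ : Type}

theorem basicOp (o : BasicOp) (i j k : ι) :
    FODefinable (lam := lam) (κ := κ) fun x _ => o.Mem (x i) (x j) (x k) := by
  cases o with
  | union => exact (mem k i).or (mem k j)
  | sdiff => exact (mem k i).and (mem k j).not
  | singleton => exact eq k i
  | prod =>
    exact ex (ex ((mem (some none) (some (some i))).and
      ((mem none (some (some j))).and (eq_pair (some (some k)) (some none) none))))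
  | snd => exact ex (pair_mem none (some k) (some i))
  | insertMiddle =>
    exact ex (ex (ex (((pair_mem (some (some none)) none (some (some (some i)))).and
      (mem (some none) (some (some (some j))))).and
        (eq_triple (some (some (some k))) (some (some none)) (some none) none))))
  | triple R =>
    exact ex (ex (ex (((mem none (some (some (some i)))).and
      ((mem (some (some none)) (some (some (some j)))).and
        ((mem (some none) (some (some (some j)))).and
          (basicRel R (some (some none)) (some none))))).and
        (eq_triple (some (some (some k))) (some (some none)) (some none) none))))

theorem isValue (o : BasicOp) (i j k : ι) :
    FODefinable (lam := lam) (κ := κ) fun x _ => o.IsValue (x i) (x j) (x k) :=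
  all ((mem none (some k)).iff (basicOp o (some i) (some j) none))

end FODefinable

/-- A finite list of first-order conditions on a map of `V_λ`, which imply elementarity when `λ` has
countable cofinality. -/
structure IsBasicEmbedding (l : VRank lam → VRank lam) : Prop where
  map_isValue : ∀ {o : BasicOp} {x y z : VRank lam}, o.IsValue x y z → o.IsValue (l x) (l y) (l z)
  cofinal : ∀ y : VRank lam, ∃ x, y.1 ∈ (l x).1
  map_isOmega : ∀ z : VRank lam, IsOmega z → l z = z
  map_mem_isOmega : ∀ z : VRank lam, IsOmega z → ∀ n : VRank lam, n.1 ∈ z.1 → l n = n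

theorem mem_graphEmb {l : VRank lam → VRank lam} {z : VRank lam} :
    z ∈ graphEmb l ↔ ∃ x, z = pair x (l x) := by
  simp only [graphEmb, Set.mem_ofPred_eq, Subtype.ext_iff, pair]

theorem pair_mem_graphEmb {l : VRank lam → VRank lam} {x y : VRank lam} :
    pair x y ∈ graphEmb l ↔ y = l x := by
  simp only [mem_graphEmb, pair_inj, exists_eq_left']

theorem IsElementary.isBasicEmbedding {j : VRank lam → VRank lam} (hj : IsElementary j) :
    IsBasicEmbedding j where
  map_isValue {o x y z} := (hj.iff₃ (.isValue o 0 1 2) x y z).1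
  cofinal y := by
    refine ⟨stage _ (succ_lt y.rank_lt), ?_⟩
    rw [hj.map_stage, mem_stage]
    exact (Order.lt_succ _).trans_le (hj.le_ordMap (succ_lt y.rank_lt))
  map_isOmega z hz := ((hj.iff₁ (.isOmega 0) z).1 hz).unique hz
  map_mem_isOmega z hz n hn := by
    obtain ⟨k, rfl⟩ := (hz.mem_iff n).1 hn
    exact hj.map_numeral k

theorem exists_graphEmb_eq_iff {L : Set (VRank lam)} : (∃ l, graphEmb l = L) ↔
    (∀ w, w ∈ L → ∃ x y, w = pair x y) ∧
      ∀ x, ∃ y, pair x y ∈ L ∧ ∀ y', pair x y' ∈ L → y' = y := by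
  constructor
  · rintro ⟨l, rfl⟩
    refine ⟨fun w hw => ?_, fun x => ⟨l x, pair_mem_graphEmb.2 rfl, fun _ => pair_mem_graphEmb.1⟩⟩
    obtain ⟨x, hx⟩ := mem_graphEmb.1 hw
    exact ⟨x, _, hx⟩
  · rintro ⟨isPair, existsUnique⟩
    choose l hl hunique using existsUnique
    refine ⟨l, Set.ext fun w => mem_graphEmb.trans ⟨?_, fun hw => ?_⟩⟩
    · rintro ⟨x, rfl⟩
      exact hl x
    · obtain ⟨x, y, rfl⟩ := isPair w hw
      exact ⟨x, by rw [hunique x y hw]⟩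

theorem isBasicEmbedding_iff_graphEmb {l : VRank lam → VRank lam} : IsBasicEmbedding l ↔
    (∀ (o : BasicOp) (x y z x' y' z' : VRank lam),
      pair x x' ∈ graphEmb l → pair y y' ∈ graphEmb l → pair z z' ∈ graphEmb l →
        o.IsValue x y z → o.IsValue x' y' z') ∧
    (∀ y : VRank lam, ∃ x x' : VRank lam, pair x x' ∈ graphEmb l ∧ y.1 ∈ x'.1) ∧
    ∀ z, IsOmega z →
      pair z z ∈ graphEmb l ∧ ∀ n : VRank lam, n.1 ∈ z.1 → pair n n ∈ graphEmb l := by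
  simp only [pair_mem_graphEmb, exists_eq_left]
  constructor
  · refine fun h => ⟨?_, h.cofinal, fun z hz => ⟨(h.map_isOmega z hz).symm, fun n hn =>
      (h.map_mem_isOmega z hz n hn).symm⟩⟩
    rintro o x y z _ _ _ rfl rfl rfl
    exact h.map_isValue
  · exact fun ⟨hval, hcof, homega⟩ => ⟨fun {o x y z} => hval o x y z _ _ _ rfl rfl rfl, hcof,
      fun z hz => (homega z hz).1.symm, fun z hz n hn => ((homega z hz).2 n hn).symm⟩

theorem FODefinable.isBasicEmbeddingGraph {ι κ : Type} (k : κ) :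
    FODefinable (lam := lam) (ι := ι) fun _ X => ∃ l, IsBasicEmbedding l ∧ graphEmb l = X k := by
  have isPair : FODefinable (lam := lam) (ι := ι) fun _ (X : κ → Set (VRank lam)) =>
      ∀ w, w ∈ X k → ∃ x y, w = pair x y :=
    all ((pred k none).imp (ex (ex (eq_pair (some (some none)) (some none) none))))
  have existsUnique : FODefinable (lam := lam) (ι := ι) fun _ (X : κ → Set (VRank lam)) =>
      ∀ x, ∃ y, pair x y ∈ X k ∧ ∀ y', pair x y' ∈ X k → y' = y :=
    all (ex ((pair_mem_pred k (some none) none).and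
      (all ((pair_mem_pred k (some (some none)) none).imp (eq none (some none))))))
  have map_isValue : FODefinable (lam := lam) (ι := ι) fun _ (X : κ → Set (VRank lam)) =>
      ∀ (o : BasicOp) (x y z x' y' z' : VRank lam), pair x x' ∈ X k → pair y y' ∈ X k →
        pair z z' ∈ X k → o.IsValue x y z → o.IsValue x' y' z' :=
    forall_finite fun o => all (all (all (all (all (all
      ((pair_mem_pred k (some (some (some (some (some none))))) (some (some none))).imp
        ((pair_mem_pred k (some (some (some (some none)))) (some none)).imp
          ((pair_mem_pred k (some (some (some none))) none).imp
            ((isValue o (some (some (some (some (some none)))))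
              (some (some (some (some none)))) (some (some (some none)))).imp
                (isValue o (some (some none)) (some none) none))))))))))
  have cofinal : FODefinable (lam := lam) (ι := ι) fun _ (X : κ → Set (VRank lam)) =>
      ∀ y : VRank lam, ∃ x x' : VRank lam, pair x x' ∈ X k ∧ y.1 ∈ x'.1 :=
    all (ex (ex ((pair_mem_pred k (some none) none).and (mem (some (some none)) none))))
  have map_isOmega : FODefinable (lam := lam) (ι := ι) fun _ (X : κ → Set (VRank lam)) =>
      ∀ z, IsOmega z → pair z z ∈ X k ∧ ∀ n : VRank lam, n.1 ∈ z.1 → pair n n ∈ X k :=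
    all ((FODefinable.isOmega none).imp ((pair_mem_pred k none none).and
      (all ((mem none (some none)).imp (pair_mem_pred k none none)))))
  refine ((isPair.and existsUnique).and (map_isValue.and (cofinal.and map_isOmega))).congr
    fun x X => ?_
  rw [← exists_graphEmb_eq_iff]
  constructor
  · rintro ⟨l, hl, e⟩
    exact ⟨⟨l, e⟩, e ▸ isBasicEmbedding_iff_graphEmb.1 hl⟩
  · rintro ⟨⟨l, e⟩, h⟩
    exact ⟨l, isBasicEmbedding_iff_graphEmb.2 (e ▸ h), e⟩

namespace IsBasicEmbedding

variable {l : VRank lam → VRank lam} (hl : IsBasicEmbedding l)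

include hl

theorem map_union {x y z : VRank lam} (h : ∀ w : VRank lam, w.1 ∈ z.1 ↔ w.1 ∈ x.1 ∨ w.1 ∈ y.1)
    (w : VRank lam) : w.1 ∈ (l z).1 ↔ w.1 ∈ (l x).1 ∨ w.1 ∈ (l y).1 :=
  hl.map_isValue (o := .union) h w

theorem map_subset {x y : VRank lam} (h : x.1 ⊆ y.1) : (l x).1 ⊆ (l y).1 :=
  subset_iff.2 fun w hw => (hl.map_union (x := x) (y := y) (z := y)
    (fun _ => (or_iff_right_of_imp fun hx => h hx).symm) w).2 (.inl hw)

theorem notMem_of_disjoint {x y w : VRank lam} (h : ∀ w : VRank lam, w.1 ∈ x.1 → ¬ w.1 ∈ y.1)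
    (hw : w.1 ∈ (l x).1) : ¬ w.1 ∈ (l y).1 :=
  ((hl.map_isValue (o := .sdiff) (x := x) (y := y) (z := x)
    (fun w => (and_iff_left_of_imp (h w)).symm) w).1 hw).2

theorem map_singleton {x z : VRank lam} (h : ∀ w : VRank lam, w.1 ∈ z.1 ↔ w = x) (w : VRank lam) :
    w.1 ∈ (l z).1 ↔ w = l x :=
  hl.map_isValue (o := .singleton) (y := x) h w

theorem map_prod {x y z : VRank lam}
    (h : ∀ w : VRank lam, w.1 ∈ z.1 ↔ ∃ a b, a.1 ∈ x.1 ∧ b.1 ∈ y.1 ∧ w = pair a b)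
    (w : VRank lam) : w.1 ∈ (l z).1 ↔ ∃ a b, a.1 ∈ (l x).1 ∧ b.1 ∈ (l y).1 ∧ w = pair a b :=
  hl.map_isValue (o := .prod) h w

theorem map_snd {x z : VRank lam} (h : ∀ w : VRank lam, w.1 ∈ z.1 ↔ ∃ a, (pair a w).1 ∈ x.1)
    (w : VRank lam) : w.1 ∈ (l z).1 ↔ ∃ a, (pair a w).1 ∈ (l x).1 :=
  hl.map_isValue (o := .snd) (y := x) h w

theorem map_pair (x y : VRank lam) : l (pair x y) = pair (l x) (l y) := by
  obtain ⟨a, ha⟩ := exists_singleton x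
  obtain ⟨b, hb⟩ := exists_singleton y
  obtain ⟨c, hc⟩ := exists_singleton (pair x y)
  have mem_map_c := hl.map_prod (x := a) (y := b) (z := c) fun w => by simp [ha, hb, hc]
  obtain ⟨x', y', hx, hy, e⟩ := (mem_map_c _).1 ((hl.map_singleton hc _).2 rfl)
  rw [e, (hl.map_singleton ha _).1 hx, (hl.map_singleton hb _).1 hy]

theorem mem_extendEmb {A : Set (VRank lam)} {y : VRank lam} :
    y ∈ extendEmb l A ↔ ∃ a : VRank lam, (∀ w : VRank lam, w.1 ∈ a.1 → w ∈ A) ∧ y.1 ∈ (l a).1 := by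
  constructor
  · rintro ⟨α, hα, hy⟩
    refine ⟨_, fun w hw => ?_, hy⟩
    simp only [truncSet, ZFSet.mem_sep] at hw
    exact hw.2.2
  · rintro ⟨a, ha, hy⟩
    refine ⟨_, a.rank_lt, hl.map_subset (subset_iff.2 fun w hw => ?_) hy⟩
    simp only [truncSet, ZFSet.mem_sep]
    exact ⟨ZFSet.mem_vonNeumann.2 (ZFSet.rank_lt_of_mem hw), w.2, ha w hw⟩

theorem extendEmb_mono {A B : Set (VRank lam)} (h : A ⊆ B) : extendEmb l A ⊆ extendEmb l B :=
  fun y hy => by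
    obtain ⟨a, ha, hy⟩ := hl.mem_extendEmb.1 hy
    exact hl.mem_extendEmb.2 ⟨a, fun w hw => h (ha w hw), hy⟩

theorem notMem_extendEmb_of_disjoint {A B : Set (VRank lam)} (h : Disjoint A B) {y : VRank lam}
    (hy : y ∈ extendEmb l A) : y ∉ extendEmb l B := fun hy' => by
  obtain ⟨a, ha, hya⟩ := hl.mem_extendEmb.1 hy
  obtain ⟨b, hb, hyb⟩ := hl.mem_extendEmb.1 hy'
  exact hl.notMem_of_disjoint
    (fun w hw hw' => Set.disjoint_left.1 h (ha w hw) (hb w hw')) hya hyb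

theorem extendEmb_univ : extendEmb l Set.univ = Set.univ :=
  Set.eq_univ_of_forall fun y => by
    obtain ⟨x, hx⟩ := hl.cofinal y
    exact hl.mem_extendEmb.2 ⟨x, fun _ _ => trivial, hx⟩

theorem extendEmb_union (A B : Set (VRank lam)) :
    extendEmb l (A ∪ B) = extendEmb l A ∪ extendEmb l B := by
  refine subset_antisymm (fun y hy => ?_) (Set.union_subset
    (hl.extendEmb_mono Set.subset_union_left) (hl.extendEmb_mono Set.subset_union_right))
  obtain ⟨a, ha, hya⟩ := hl.mem_extendEmb.1 hy
  have mem_or_mem := (hl.map_union (x := sep a (· ∈ A)) (y := sep a (· ∈ B)) (z := a) (fun w => by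
    rw [mem_sep, mem_sep, ← and_or_left]
    exact (and_iff_left_of_imp (ha w)).symm) y).1 hya
  exact mem_or_mem.imp (fun h => hl.mem_extendEmb.2 ⟨_, fun w hw => (mem_sep.1 hw).2, h⟩)
    (fun h => hl.mem_extendEmb.2 ⟨_, fun w hw => (mem_sep.1 hw).2, h⟩)

theorem extendEmb_compl (A : Set (VRank lam)) : extendEmb l Aᶜ = (extendEmb l A)ᶜ := by
  refine subset_antisymm (fun y => hl.notMem_extendEmb_of_disjoint disjoint_compl_left)
    (Set.compl_subset_iff_union.2 ?_)
  rw [← hl.extendEmb_union, Set.union_compl_self, hl.extendEmb_univ]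

theorem extendEmb_sdiff (A B : Set (VRank lam)) :
    extendEmb l (A \ B) = extendEmb l A \ extendEmb l B := by
  rw [← compl_compl (A \ B), Set.compl_sdiff, hl.extendEmb_compl, hl.extendEmb_union,
    hl.extendEmb_compl, ← Set.compl_sdiff, compl_compl]

theorem extendEmb_empty : extendEmb l ∅ = ∅ := by
  rw [← Set.compl_univ, hl.extendEmb_compl, hl.extendEmb_univ]

theorem extendEmb_coe (a : VRank lam) :
    extendEmb l {w | w.1 ∈ a.1} = {w | w.1 ∈ (l a).1} := by
  ext y
  refine hl.mem_extendEmb.trans ⟨?_, fun hy => ⟨a, fun w hw => hw, hy⟩⟩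
  rintro ⟨b, hb, hy⟩
  exact hl.map_subset (subset_iff.2 hb) hy

theorem extendEmb_singleton (x : VRank lam) : extendEmb l {x} = {l x} := by
  obtain ⟨z, hz⟩ := exists_singleton x
  have h := hl.extendEmb_coe z
  simp only [hz, hl.map_singleton hz] at h
  exact h

theorem map_mem_extendEmb {A : Set (VRank lam)} {x : VRank lam} : l x ∈ extendEmb l A ↔ x ∈ A := by
  have hx : l x ∈ extendEmb l {x} := by rw [hl.extendEmb_singleton]; rfl
  refine ⟨fun h => ?_, fun h => hl.extendEmb_mono (Set.singleton_subset_iff.2 h) hx⟩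
  by_contra hxA
  exact hl.notMem_extendEmb_of_disjoint (Set.disjoint_singleton_left.2 hxA) hx h

theorem extendEmb_injective : Function.Injective (extendEmb l) := fun A B h => by
  ext x
  rw [← hl.map_mem_extendEmb, h, hl.map_mem_extendEmb]

end IsBasicEmbedding

/-- The set of pairs with components in `A` and `B`. -/
def prodSet (A B : Set (VRank lam)) : Set (VRank lam) := {w | ∃ a ∈ A, ∃ b ∈ B, w = pair a b}

/-- The set of second components of the pairs in `A`. -/
def sndImage (A : Set (VRank lam)) : Set (VRank lam) := {c | ∃ a, pair a c ∈ A}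

/-- The set of triples obtained from pairs in `A` by inserting an arbitrary middle component. -/
def insertMiddle (A : Set (VRank lam)) : Set (VRank lam) :=
  {w | ∃ a b c, pair a c ∈ A ∧ w = pair a (pair b c)}

/-- The set of triples with last component in `C` and first two components related by `R`. -/
def relTriple (R : BasicRel) (C : Set (VRank lam)) : Set (VRank lam) :=
  {w | ∃ a b c, (c ∈ C ∧ R.Holds a b) ∧ w = pair a (pair b c)}

theorem pair_mem_prodSet {A B : Set (VRank lam)} {a b : VRank lam} :
    pair a b ∈ prodSet A B ↔ a ∈ A ∧ b ∈ B := by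
  constructor
  · rintro ⟨a', ha, b', hb, e⟩
    obtain ⟨rfl, rfl⟩ := pair_inj.1 e
    exact ⟨ha, hb⟩
  · exact fun ⟨ha, hb⟩ => ⟨a, ha, b, hb, rfl⟩

theorem triple_inj {a b c a' b' c' : VRank lam} :
    pair a (pair b c) = pair a' (pair b' c') ↔ a = a' ∧ b = b' ∧ c = c' := by
  rw [pair_inj, pair_inj]

theorem triple_mem_insertMiddle {A : Set (VRank lam)} {a b c : VRank lam} :
    pair a (pair b c) ∈ insertMiddle A ↔ pair a c ∈ A := by
  refine ⟨?_, fun h => ⟨a, b, c, h, rfl⟩⟩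
  rintro ⟨a', b', c', h, e⟩
  obtain ⟨rfl, rfl, rfl⟩ := triple_inj.1 e
  exact h

theorem triple_mem_relTriple {R : BasicRel} {C : Set (VRank lam)} {a b c : VRank lam} :
    pair a (pair b c) ∈ relTriple R C ↔ c ∈ C ∧ R.Holds a b := by
  refine ⟨?_, fun h => ⟨a, b, c, h, rfl⟩⟩
  rintro ⟨a', b', c', h, e⟩
  obtain ⟨rfl, rfl, rfl⟩ := triple_inj.1 e
  exact h

namespace IsBasicEmbedding

variable {l : VRank lam → VRank lam} (hl : IsBasicEmbedding l)

include hl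

theorem prodSet_extendEmb_subset (A B : Set (VRank lam)) :
    prodSet (extendEmb l A) (extendEmb l B) ⊆ extendEmb l (prodSet A B) := by
  rintro _ ⟨a, ha, b, hb, rfl⟩
  obtain ⟨x, hx, hax⟩ := hl.mem_extendEmb.1 ha
  obtain ⟨y, hy, hby⟩ := hl.mem_extendEmb.1 hb
  obtain ⟨z, hz⟩ := exists_prod x y
  refine hl.mem_extendEmb.2 ⟨z, fun w hw => ?_, (hl.map_prod hz _).2 ⟨a, b, hax, hby, rfl⟩⟩
  obtain ⟨a', b', ha', hb', rfl⟩ := (hz w).1 hw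
  exact ⟨a', hx _ ha', b', hy _ hb', rfl⟩

theorem exists_pair_of_mem_extendEmb {A : Set (VRank lam)} (hA : ∀ w ∈ A, ∃ a b, w = pair a b)
    {w : VRank lam} (hw : w ∈ extendEmb l A) : ∃ a b, w = pair a b := by
  obtain ⟨z, hz, hwz⟩ := hl.mem_extendEmb.1 hw
  obtain ⟨y, hy⟩ := exists_stage_superset z
  obtain ⟨p, hp⟩ := exists_prod y y
  have z_subset_p : z.1 ⊆ p.1 := subset_iff.2 fun v hv => by
    obtain ⟨a, b, rfl⟩ := hA v (hz v hv)
    obtain ⟨ha, hb⟩ := rank_lt_of_pair_mem hv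
    exact (hp _).2 ⟨a, b, hy _ ha.le, hy _ hb.le, rfl⟩
  obtain ⟨a, b, -, -, rfl⟩ := (hl.map_prod hp w).1 (hl.map_subset z_subset_p hwz)
  exact ⟨a, b, rfl⟩

theorem extendEmb_prodSet (A B : Set (VRank lam)) :
    extendEmb l (prodSet A B) = prodSet (extendEmb l A) (extendEmb l B) := by
  refine subset_antisymm (fun w hw => ?_) (hl.prodSet_extendEmb_subset A B)
  obtain ⟨a, b, rfl⟩ := hl.exists_pair_of_mem_extendEmb
    (by rintro _ ⟨a, -, b, -, rfl⟩; exact ⟨a, b, rfl⟩) hw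
  have disjoint_compl_left : Disjoint (prodSet Aᶜ Set.univ) (prodSet A B) :=
    Set.disjoint_left.2 fun _ ⟨a, ha, b, _, e⟩ h => ha (pair_mem_prodSet.1 (e ▸ h)).1
  have disjoint_compl_right : Disjoint (prodSet Set.univ Bᶜ) (prodSet A B) :=
    Set.disjoint_left.2 fun _ ⟨a, _, b, hb, e⟩ h => hb (pair_mem_prodSet.1 (e ▸ h)).2
  refine pair_mem_prodSet.2 ⟨?_, ?_⟩ <;> by_contra hnot
  · refine hl.notMem_extendEmb_of_disjoint disjoint_compl_left
      (hl.prodSet_extendEmb_subset _ _ (pair_mem_prodSet.2 ⟨?_, ?_⟩)) hw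
    · rwa [hl.extendEmb_compl]
    · rw [hl.extendEmb_univ]; trivial
  · refine hl.notMem_extendEmb_of_disjoint disjoint_compl_right
      (hl.prodSet_extendEmb_subset _ _ (pair_mem_prodSet.2 ⟨?_, ?_⟩)) hw
    · rw [hl.extendEmb_univ]; trivial
    · rwa [hl.extendEmb_compl]

theorem exists_triple_of_mem_extendEmb {A C : Set (VRank lam)}
    (hA : A ⊆ prodSet Set.univ (prodSet Set.univ C)) {w : VRank lam} (hw : w ∈ extendEmb l A) :
    ∃ a b c, c ∈ extendEmb l C ∧ w = pair a (pair b c) := by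
  have hw' := hl.extendEmb_mono hA hw
  rw [hl.extendEmb_prodSet, hl.extendEmb_prodSet] at hw'
  obtain ⟨a, -, _, ⟨b, -, c, hc, rfl⟩, rfl⟩ := hw'
  exact ⟨a, b, c, hc, rfl⟩

theorem insertMiddle_extendEmb_subset (A : Set (VRank lam)) :
    insertMiddle (extendEmb l A) ⊆ extendEmb l (insertMiddle A) := by
  rintro _ ⟨a, b, c, hac, rfl⟩
  obtain ⟨x, hx, hacx⟩ := hl.mem_extendEmb.1 hac
  obtain ⟨y, hy⟩ := hl.cofinal b
  obtain ⟨z, hz⟩ := BasicOp.exists_isValue .insertMiddle x y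
  refine hl.mem_extendEmb.2
    ⟨z, fun w hw => ?_, (hl.map_isValue hz _).2 ⟨a, b, c, ⟨hacx, hy⟩, rfl⟩⟩
  obtain ⟨a', b', c', ⟨h, -⟩, rfl⟩ := (hz w).1 hw
  exact ⟨a', b', c', hx _ h, rfl⟩

theorem extendEmb_insertMiddle (A : Set (VRank lam)) :
    extendEmb l (insertMiddle A) = insertMiddle (extendEmb l A) := by
  refine subset_antisymm (fun w hw => ?_) (hl.insertMiddle_extendEmb_subset A)
  obtain ⟨a, b, c, -, rfl⟩ := hl.exists_triple_of_mem_extendEmb (C := Set.univ)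
    (by rintro _ ⟨a, b, c, -, rfl⟩; exact ⟨a, trivial, _, ⟨b, trivial, c, trivial, rfl⟩, rfl⟩) hw
  rw [triple_mem_insertMiddle]
  by_contra hnot
  have disjoint_compl : Disjoint (insertMiddle Aᶜ) (insertMiddle A) :=
    Set.disjoint_left.2 fun _ ⟨a, b, c, h, e⟩ h' => h (triple_mem_insertMiddle.1 (e ▸ h'))
  exact hl.notMem_extendEmb_of_disjoint disjoint_compl (hl.insertMiddle_extendEmb_subset _
    (triple_mem_insertMiddle.2 (by rwa [hl.extendEmb_compl]))) hw

theorem holds_of_triple_mem_extendEmb {R : BasicRel} {C : Set (VRank lam)} {a b c : VRank lam}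
    (h : pair a (pair b c) ∈ extendEmb l (relTriple R C)) : R.Holds a b := by
  obtain ⟨z, hz, hmem⟩ := hl.mem_extendEmb.1 h
  obtain ⟨y, hy⟩ := exists_stage_superset z
  obtain ⟨p, hp⟩ := BasicOp.exists_isValue (.triple R) y y
  have z_subset_p : z.1 ⊆ p.1 := subset_iff.2 fun v hv => by
    obtain ⟨a, b, c, ⟨-, hR⟩, rfl⟩ := hz v hv
    obtain ⟨ha, hbc⟩ := rank_lt_of_pair_mem hv
    exact (hp _).2 ⟨a, b, c, ⟨hy _ ((rank_snd_lt_pair b c).trans hbc).le, hy _ ha.le,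
      hy _ ((rank_fst_lt_pair b c).trans hbc).le, hR⟩, rfl⟩
  obtain ⟨a', b', c', ⟨-, -, -, hR⟩, e⟩ :=
    (hl.map_isValue hp _).1 (hl.map_subset z_subset_p hmem)
  obtain ⟨rfl, rfl, -⟩ := triple_inj.1 e
  exact hR

theorem extendEmb_relTriple (R : BasicRel) (C : Set (VRank lam)) :
    extendEmb l (relTriple R C) = relTriple R (extendEmb l C) := by
  apply subset_antisymm
  · intro w hw
    obtain ⟨a, b, c, hc, rfl⟩ := hl.exists_triple_of_mem_extendEmb (C := C)
      (by rintro _ ⟨a, b, c, h, rfl⟩; exact ⟨a, trivial, _, ⟨b, trivial, c, h.1, rfl⟩, rfl⟩) hw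
    exact triple_mem_relTriple.2 ⟨hc, hl.holds_of_triple_mem_extendEmb hw⟩
  · rintro _ ⟨a, b, c, ⟨hc, hR⟩, rfl⟩
    obtain ⟨x, hx, hcx⟩ := hl.mem_extendEmb.1 hc
    obtain ⟨y₁, hy₁⟩ := hl.cofinal a
    obtain ⟨y₂, hy₂⟩ := hl.cofinal b
    obtain ⟨y, hy⟩ := exists_union y₁ y₂
    obtain ⟨z, hz⟩ := BasicOp.exists_isValue (.triple R) x y
    refine hl.mem_extendEmb.2 ⟨z, fun w hw => ?_, (hl.map_isValue hz _).2
      ⟨a, b, c, ⟨hcx, (hl.map_union hy a).2 (.inl hy₁), (hl.map_union hy b).2 (.inr hy₂), hR⟩, rfl⟩⟩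
    obtain ⟨a', b', c', ⟨hc', -, -, hR'⟩, rfl⟩ := (hz w).1 hw
    exact ⟨a', b', c', ⟨hx _ hc', hR'⟩, rfl⟩

theorem sndImage_extendEmb_subset (A : Set (VRank lam)) :
    sndImage (extendEmb l A) ⊆ extendEmb l (sndImage A) := by
  rintro c ⟨a, hac⟩
  obtain ⟨x, hx, hacx⟩ := hl.mem_extendEmb.1 hac
  obtain ⟨z, hz⟩ := BasicOp.exists_isValue .snd x x
  refine hl.mem_extendEmb.2 ⟨z, fun w hw => ?_, (hl.map_snd hz _).2 ⟨a, hacx⟩⟩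
  obtain ⟨a', ha'⟩ := (hz w).1 hw
  exact ⟨a', hx _ ha'⟩

theorem mem_map_of_pair_mem {a t y : VRank lam}
    (h : ∀ c : VRank lam, (pair a c).1 ∈ t.1 → c.1 ∈ y.1) {w : VRank lam}
    (hw : (pair (l a) w).1 ∈ (l t).1) : w.1 ∈ (l y).1 := by
  by_contra hwy
  have disjoint_compl : Disjoint {v : VRank lam | v.1 ∈ t.1} (prodSet {a} {c | c.1 ∈ y.1}ᶜ) := by
    rw [Set.disjoint_left]
    rintro _ ht ⟨_, rfl, c, hc, rfl⟩
    exact hc (h c ht)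
  refine hl.notMem_extendEmb_of_disjoint disjoint_compl (y := pair (l a) w) ?_ ?_
  · rwa [hl.extendEmb_coe]
  · rw [hl.extendEmb_prodSet, hl.extendEmb_singleton, hl.extendEmb_compl, hl.extendEmb_coe]
    exact pair_mem_prodSet.2 ⟨rfl, hwy⟩

-- `l` fixes `ω` and its elements, so it preserves every section of `⋃ₙ {n} × s n`.
theorem map_iUnion (hω : Ordinal.omega0 < lam) {s : ℕ → VRank lam} {x : VRank lam}
    (h : ∀ w : VRank lam, w.1 ∈ x.1 ↔ ∃ n, w.1 ∈ (s n).1) (w : VRank lam) :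
    w.1 ∈ (l x).1 ↔ ∃ n, w.1 ∈ (l (s n)).1 := by
  refine ⟨fun hw => ?_, fun ⟨n, hn⟩ =>
    hl.map_subset (subset_iff.2 fun w hw => (h w).2 ⟨n, hw⟩) hn⟩
  obtain ⟨z, hz⟩ := exists_isOmega hω
  obtain ⟨p, hp⟩ := exists_prod z x
  let t := sep p fun w => ∃ n, ∃ c : VRank lam, c.1 ∈ (s n).1 ∧ w = pair (numeral n) c
  have mem_of_mem_t : ∀ n (c : VRank lam), (pair (numeral n) c).1 ∈ t.1 → c.1 ∈ (s n).1 := by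
    intro n c hc
    obtain ⟨-, m, c', hc', e⟩ := mem_sep.1 hc
    obtain ⟨e₁, rfl⟩ := pair_inj.1 e
    rwa [numeral_injective e₁]
  have mem_x_iff : ∀ c : VRank lam, c.1 ∈ x.1 ↔ ∃ a, (pair a c).1 ∈ t.1 := by
    refine fun c => ⟨fun hc => ?_, fun ⟨a, ha⟩ => ?_⟩
    · obtain ⟨n, hn⟩ := (h c).1 hc
      exact ⟨numeral n, mem_sep.2
        ⟨(hp _).2 ⟨numeral n, c, (hz.mem_iff _).2 ⟨n, rfl⟩, hc, rfl⟩, n, c, hn, rfl⟩⟩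
    · obtain ⟨-, n, c', hc', e⟩ := mem_sep.1 ha
      exact (h c).2 ⟨n, (pair_inj.1 e).2 ▸ hc'⟩
  obtain ⟨a, haw⟩ := (hl.map_snd mem_x_iff w).1 hw
  have t_subset_p : t.1 ⊆ p.1 := subset_iff.2 fun w hw => (mem_sep.1 hw).1
  obtain ⟨a', w', ha', -, e⟩ := (hl.map_prod hp _).1 (hl.map_subset t_subset_p haw)
  obtain ⟨rfl, -⟩ := pair_inj.1 e
  rw [hl.map_isOmega z hz, hz.mem_iff] at ha'
  obtain ⟨n, rfl⟩ := ha'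
  refine ⟨n, hl.mem_map_of_pair_mem (a := numeral n) (mem_of_mem_t n) ?_⟩
  rwa [hl.map_mem_isOmega z hz _ ((hz.mem_iff _).2 ⟨n, rfl⟩)]

end IsBasicEmbedding

/-- `V_λ` is a union of countably many of its levels, and `λ > ω`. -/
def HasCountableCofinality (lam : Ordinal.{u}) : Prop :=
  Ordinal.omega0 < lam ∧ ∃ s : ℕ → Ordinal.{u}, (∀ n, s n < lam) ∧ ∀ α < lam, ∃ n, α < s n

theorem IsBasicEmbedding.extendEmb_sndImage (hlam : HasCountableCofinality lam)
    {l : VRank lam → VRank lam} (hl : IsBasicEmbedding l) (A : Set (VRank lam)) :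
    extendEmb l (sndImage A) = sndImage (extendEmb l A) := by
  refine subset_antisymm (fun c hc => ?_) (hl.sndImage_extendEmb_subset A)
  obtain ⟨hω, s, hs, s_cofinal⟩ := hlam
  obtain ⟨x, hx, hcx⟩ := hl.mem_extendEmb.1 hc
  obtain ⟨n, hn⟩ := (hl.map_iUnion hω
    (s := fun n => sep x fun c => ∃ a : VRank lam, a.1.rank < s n ∧ pair a c ∈ A) (x := x)
    (fun w => by
      simp only [mem_sep]
      refine ⟨fun hw => ?_, fun ⟨n, h⟩ => h.1⟩
      obtain ⟨a, ha⟩ := hx w hw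
      obtain ⟨n, hn⟩ := s_cofinal _ a.rank_lt
      exact ⟨n, hw, a, hn, ha⟩) c).1 hcx
  obtain ⟨p, hp⟩ := exists_prod (stage (s n) (hs n)) x
  obtain ⟨a, ha⟩ := (hl.map_snd (x := sep p (· ∈ A)) (fun c => by
    rw [mem_sep]
    constructor
    · rintro ⟨hcx, a, ha, hA⟩
      exact ⟨a, mem_sep.2 ⟨(hp _).2 ⟨a, c, mem_stage.2 ha, hcx, rfl⟩, hA⟩⟩
    · rintro ⟨a, ha⟩
      obtain ⟨hap, hA⟩ := mem_sep.1 ha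
      obtain ⟨a', c', ha', hc', e⟩ := (hp _).1 hap
      obtain ⟨rfl, rfl⟩ := pair_inj.1 e
      exact ⟨hc', a, mem_stage.1 ha', hA⟩) c).1 hn
  exact ⟨a, hl.mem_extendEmb.2 ⟨_, fun w hw => (mem_sep.1 hw).2, ha⟩⟩

/-- A tuple of elements of `V_λ` coded as an iterated pair, starting from its last entry. -/
noncomputable def tupleCode : {n : ℕ} → (Fin n → VRank lam) → VRank lam
  | 0, _ => numeral 0
  | n + 1, x => pair (x (Fin.last n)) (tupleCode fun i : Fin n => x i.castSucc)

theorem tupleCode_injective :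
    ∀ {n : ℕ}, Function.Injective (tupleCode : (Fin n → VRank lam) → VRank lam)
  | 0 => fun _ _ _ => Subsingleton.elim _ _
  | n + 1 => fun x y h => by
    simp only [tupleCode, pair_inj] at h
    obtain ⟨last_eq, init_eq⟩ := h
    funext i
    induction i using Fin.lastCases with
    | last => exact last_eq
    | cast i => exact congrFun (tupleCode_injective init_eq) i

theorem tupleCode_snoc {n : ℕ} (x : Fin n → VRank lam) (a : VRank lam) :
    tupleCode (Fin.snoc x a : Fin (n + 1) → VRank lam) = pair a (tupleCode x) := by
  simp [tupleCode]

/-- The set of codes of the tuples with property `P`; this turns the connectives of first-order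
logic into operations on subsets of `V_λ`. -/
def codeSet {n : ℕ} (P : (Fin n → VRank lam) → Prop) : Set (VRank lam) :=
  {w | ∃ x, w = tupleCode x ∧ P x}

section codeSet

variable {n : ℕ}

theorem tupleCode_mem_codeSet {P : (Fin n → VRank lam) → Prop} {x : Fin n → VRank lam} :
    tupleCode x ∈ codeSet P ↔ P x := by
  refine ⟨?_, fun h => ⟨x, rfl, h⟩⟩
  rintro ⟨y, h, hy⟩
  rwa [tupleCode_injective h]

theorem codeSet_congr {P Q : (Fin n → VRank lam) → Prop} (h : ∀ x, P x ↔ Q x) :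
    codeSet P = codeSet Q := by
  rw [show P = Q from funext fun x => propext (h x)]

theorem codeSet_false : codeSet (lam := lam) (fun _ : Fin n → VRank lam => False) = ∅ :=
  Set.eq_empty_of_forall_notMem fun _ ⟨_, _, h⟩ => h

theorem mem_codeSet_succ {P : (Fin (n + 1) → VRank lam) → Prop} {w : VRank lam} :
    w ∈ codeSet P ↔ ∃ (a : VRank lam) (x : Fin n → VRank lam),
      w = pair a (tupleCode x) ∧ P (Fin.snoc x a : Fin (n + 1) → VRank lam) := by
  constructor
  · rintro ⟨x, rfl, h⟩
    refine ⟨x (Fin.last n), fun i => x i.castSucc, rfl, ?_⟩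
    convert h
    exact Fin.snoc_init_self x
  · rintro ⟨a, x, rfl, h⟩
    exact ⟨_, (tupleCode_snoc x a).symm, h⟩

theorem codeSet_init (P : (Fin n → VRank lam) → Prop) :
    codeSet (fun x : Fin (n + 1) → VRank lam => P fun i => x i.castSucc) =
      prodSet Set.univ (codeSet P) := by
  ext w
  simp only [mem_codeSet_succ, Fin.snoc_castSucc]
  constructor
  · rintro ⟨a, x, rfl, h⟩
    exact ⟨a, trivial, _, ⟨x, rfl, h⟩, rfl⟩
  · rintro ⟨a, -, _, ⟨x, rfl, h⟩, rfl⟩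
    exact ⟨a, x, rfl, h⟩

theorem codeSet_last (A : Set (VRank lam)) :
    codeSet (fun x : Fin (n + 1) → VRank lam => x (Fin.last n) ∈ A) =
      prodSet A (codeSet fun _ : Fin n → VRank lam => True) := by
  ext w
  simp only [mem_codeSet_succ, Fin.snoc_last]
  constructor
  · rintro ⟨a, x, rfl, h⟩
    exact ⟨a, h, _, ⟨x, rfl, trivial⟩, rfl⟩
  · rintro ⟨a, ha, _, ⟨x, rfl, -⟩, rfl⟩
    exact ⟨a, x, rfl, ha⟩

theorem codeSet_last_last (R : BasicRel) :
    codeSet (fun x : Fin (n + 2) → VRank lam =>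
        R.Holds (x (Fin.last _)) (x (Fin.last n).castSucc)) =
      relTriple R (codeSet fun _ : Fin n → VRank lam => True) := by
  ext w
  simp only [mem_codeSet_succ, Fin.snoc_last, Fin.snoc_castSucc]
  constructor
  · rintro ⟨a, x, rfl, h⟩
    exact ⟨a, x (Fin.last n), _, ⟨tupleCode_mem_codeSet.2 trivial, h⟩, rfl⟩
  · rintro ⟨a, b, _, ⟨⟨x, rfl, -⟩, h⟩, rfl⟩
    exact ⟨a, Fin.snoc x b, by rw [tupleCode_snoc], by simpa using h⟩

theorem codeSet_last_init (R : BasicRel) (i : Fin n) :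
    codeSet (fun x : Fin (n + 2) → VRank lam => R.Holds (x (Fin.last _)) (x i.castSucc.castSucc)) =
      insertMiddle
        (codeSet fun x : Fin (n + 1) → VRank lam => R.Holds (x (Fin.last _)) (x i.castSucc)) := by
  ext w
  simp only [mem_codeSet_succ, Fin.snoc_last, Fin.snoc_castSucc]
  constructor
  · rintro ⟨a, x, rfl, h⟩
    refine ⟨a, x (Fin.last n), tupleCode fun i : Fin n => x i.castSucc, ?_, rfl⟩
    exact mem_codeSet_succ.2 ⟨a, _, rfl, by simpa using h⟩
  · rintro ⟨a, b, c, h, rfl⟩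
    obtain ⟨a', x, e, hx⟩ := mem_codeSet_succ.1 h
    obtain ⟨rfl, rfl⟩ := pair_inj.1 e
    exact ⟨a, Fin.snoc x b, by rw [tupleCode_snoc], by simpa using hx⟩

theorem codeSet_forall (P : (Fin (n + 1) → VRank lam) → Prop) :
    codeSet (fun x : Fin n → VRank lam => ∀ a, P (Fin.snoc x a : Fin (n + 1) → VRank lam)) =
      codeSet (fun _ : Fin n → VRank lam => True) \
        sndImage (codeSet (fun _ : Fin (n + 1) → VRank lam => True) \ codeSet P) := by
  ext w
  constructor
  · rintro ⟨x, rfl, h⟩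
    refine ⟨tupleCode_mem_codeSet.2 trivial, ?_⟩
    rintro ⟨a, -, ha⟩
    exact ha (mem_codeSet_succ.2 ⟨a, x, rfl, h a⟩)
  · rintro ⟨⟨x, rfl, -⟩, h⟩
    refine ⟨x, rfl, fun a => ?_⟩
    by_contra hne
    refine h ⟨a, mem_codeSet_succ.2 ⟨a, x, rfl, trivial⟩, fun hmem => hne ?_⟩
    rwa [← tupleCode_snoc, tupleCode_mem_codeSet] at hmem

theorem codeSet_imp (P Q : (Fin n → VRank lam) → Prop) :
    codeSet (fun x => P x → Q x) =
      codeSet (fun _ : Fin n → VRank lam => True) \ (codeSet P \ codeSet Q) := by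
  ext w
  constructor
  · rintro ⟨x, rfl, h⟩
    simp only [Set.mem_sdiff, tupleCode_mem_codeSet]
    tauto
  · rintro ⟨⟨x, rfl, -⟩, h⟩
    simp only [Set.mem_sdiff, tupleCode_mem_codeSet] at h ⊢
    tauto

end codeSet

namespace IsBasicEmbedding

variable {l : VRank lam → VRank lam} (hl : IsBasicEmbedding l)

include hl

theorem map_numeral_zero : l (numeral 0) = numeral 0 := by
  have hempty : ∀ w : VRank lam, ¬ w.1 ∈ (l (numeral 0)).1 := fun w hw =>
    hl.notMem_of_disjoint (fun w hw => absurd hw (notMem_numeral_zero w)) hw hw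
  exact ext fun w => iff_of_false (hempty w) (notMem_numeral_zero w)

theorem map_tupleCode :
    ∀ {n : ℕ} (x : Fin n → VRank lam), l (tupleCode x) = tupleCode fun i => l (x i)
  | 0, _ => hl.map_numeral_zero
  | n + 1, x => by rw [tupleCode, hl.map_pair, map_tupleCode, tupleCode]

theorem extendEmb_codeSet_true (n : ℕ) :
    extendEmb l (codeSet fun _ : Fin n → VRank lam => True) =
      codeSet fun _ : Fin n → VRank lam => True := by
  induction n with
  | zero =>
    have codeSet_zero : codeSet (lam := lam) (fun _ : Fin 0 → VRank lam => True) = {numeral 0} :=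
      Set.ext fun w => ⟨fun ⟨_, h, _⟩ => h, fun h => ⟨Fin.elim0, h, trivial⟩⟩
    rw [codeSet_zero, hl.extendEmb_singleton, hl.map_numeral_zero]
  | succ n ih =>
    rw [codeSet_init fun _ : Fin n → VRank lam => True, hl.extendEmb_prodSet, hl.extendEmb_univ, ih]

theorem extendEmb_codeSet_mem (A : Set (VRank lam)) {n : ℕ} (i : Fin n) :
    extendEmb l (codeSet fun x : Fin n → VRank lam => x i ∈ A) =
      codeSet fun x : Fin n → VRank lam => x i ∈ extendEmb l A := by
  induction n with
  | zero => exact i.elim0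
  | succ n ih =>
    induction i using Fin.lastCases with
    | last => rw [codeSet_last, codeSet_last, hl.extendEmb_prodSet, hl.extendEmb_codeSet_true]
    | cast i =>
      rw [codeSet_init fun x => x i ∈ A, codeSet_init fun x => x i ∈ extendEmb l A,
        hl.extendEmb_prodSet, hl.extendEmb_univ, ih]

theorem extendEmb_codeSet_last_holds (R : BasicRel) {n : ℕ} (i : Fin n) :
    extendEmb l
      (codeSet fun x : Fin (n + 1) → VRank lam => R.Holds (x (Fin.last n)) (x i.castSucc)) =
      codeSet fun x : Fin (n + 1) → VRank lam => R.Holds (x (Fin.last n)) (x i.castSucc) := by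
  induction n with
  | zero => exact i.elim0
  | succ n ih =>
    induction i using Fin.lastCases with
    | last => rw [codeSet_last_last, hl.extendEmb_relTriple, hl.extendEmb_codeSet_true]
    | cast i => rw [codeSet_last_init, hl.extendEmb_insertMiddle, ih]

theorem extendEmb_codeSet_holds (R : BasicRel) {n : ℕ} (i k : Fin n) :
    extendEmb l (codeSet fun x : Fin n → VRank lam => R.Holds (x i) (x k)) =
      codeSet fun x : Fin n → VRank lam => R.Holds (x i) (x k) := by
  induction n with
  | zero => exact i.elim0
  | succ n ih =>
    induction i using Fin.lastCases with
    | last =>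
      induction k using Fin.lastCases with
      | last =>
        simp only [BasicRel.holds_self]
        by_cases hR : R = .eq
        · simpa only [hR] using hl.extendEmb_codeSet_true (n + 1)
        · simpa only [hR, codeSet_false] using hl.extendEmb_empty
      | cast k => exact hl.extendEmb_codeSet_last_holds R k
    | cast i =>
      induction k using Fin.lastCases with
      | last =>
        simp only [← BasicRel.holds_swap (R := R)]
        exact hl.extendEmb_codeSet_last_holds R.swap i
      | cast k =>
        rw [codeSet_init fun x => R.Holds (x i) (x k), hl.extendEmb_prodSet, hl.extendEmb_univ, ih]

end IsBasicEmbedding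

theorem exists_eq_var {p n : ℕ} (t : (setLang p).Term (Empty ⊕ Fin n)) :
    ∃ i : Fin n, t = Language.Term.var (Sum.inr i) := by
  cases t with
  | var v =>
    rcases v with v | v
    · exact v.elim
    · exact ⟨v, rfl⟩
  | func f _ => exact (nomatch f)

/-- The set of codes of the tuples that satisfy `φ` in `V_λ` with predicates `X`. -/
def realizeSet {p n : ℕ} (φ : (setLang p).BoundedFormula Empty n) (X : Fin p → Set (VRank lam)) :
    Set (VRank lam) :=
  codeSet fun x => @Language.BoundedFormula.Realize _ _ (rankStructure lam X) _ _ φ default x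

theorem exists_realizeSet_mem {p n : ℕ} (ts : Fin 2 → (setLang p).Term (Empty ⊕ Fin n)) :
    ∃ i k : Fin n, ∀ X : Fin p → Set (VRank lam),
      realizeSet (.rel (MemRel.mem : MemRel p 2) ts) X =
        codeSet fun x => BasicRel.mem.Holds (x i) (x k) := by
  obtain ⟨i, hi⟩ := exists_eq_var (ts 0)
  obtain ⟨k, hk⟩ := exists_eq_var (ts 1)
  refine ⟨i, k, fun X => codeSet_congr fun x => ?_⟩
  change (@Language.Term.realize _ _ (rankStructure lam X) _ _ (ts 0)).1 ∈
    (@Language.Term.realize _ _ (rankStructure lam X) _ _ (ts 1)).1 ↔ _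
  rw [hi, hk]
  rfl

theorem exists_realizeSet_pred {p n : ℕ} (q : Fin p)
    (ts : Fin 1 → (setLang p).Term (Empty ⊕ Fin n)) :
    ∃ i : Fin n, ∀ X : Fin p → Set (VRank lam),
      realizeSet (.rel (MemRel.pred q : MemRel p 1) ts) X = codeSet fun x => x i ∈ X q := by
  obtain ⟨i, hi⟩ := exists_eq_var (ts 0)
  refine ⟨i, fun X => codeSet_congr fun x => ?_⟩
  change @Language.Term.realize _ _ (rankStructure lam X) _ _ (ts 0) ∈ X q ↔ _
  rw [hi]
  rfl

theorem realizeSet_imp {p n : ℕ} (φ ψ : (setLang p).BoundedFormula Empty n)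
    (X : Fin p → Set (VRank lam)) : realizeSet (φ.imp ψ) X =
      codeSet (fun _ : Fin n → VRank lam => True) \ (realizeSet φ X \ realizeSet ψ X) :=
  codeSet_imp _ _

theorem realizeSet_all {p n : ℕ} (φ : (setLang p).BoundedFormula Empty (n + 1))
    (X : Fin p → Set (VRank lam)) : realizeSet φ.all X =
      codeSet (fun _ : Fin n → VRank lam => True) \
        sndImage (codeSet (fun _ : Fin (n + 1) → VRank lam => True) \ realizeSet φ X) :=
  codeSet_forall _

namespace IsBasicEmbedding

variable {l : VRank lam → VRank lam} (hlam : HasCountableCofinality lam) (hl : IsBasicEmbedding l)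

include hlam hl

theorem extendEmb_realizeSet {p n : ℕ} (φ : (setLang p).BoundedFormula Empty n)
    (X : Fin p → Set (VRank lam)) :
    extendEmb l (realizeSet φ X) = realizeSet φ fun i => extendEmb l (X i) := by
  induction φ with
  | falsum =>
    change extendEmb l (codeSet fun _ => False) = codeSet fun _ => False
    rw [codeSet_false, hl.extendEmb_empty]
  | equal t₁ t₂ =>
    obtain ⟨i, rfl⟩ := exists_eq_var t₁
    obtain ⟨k, rfl⟩ := exists_eq_var t₂
    exact hl.extendEmb_codeSet_holds .eq i k
  | rel R ts =>
    cases R with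
    | mem =>
      obtain ⟨i, k, h⟩ := exists_realizeSet_mem (lam := lam) ts
      rw [h, h, hl.extendEmb_codeSet_holds]
    | pred q =>
      obtain ⟨i, h⟩ := exists_realizeSet_pred (lam := lam) q ts
      rw [h, h, hl.extendEmb_codeSet_mem]
  | imp φ ψ ih₁ ih₂ =>
    rw [realizeSet_imp, realizeSet_imp, hl.extendEmb_sdiff, hl.extendEmb_sdiff, ih₁, ih₂,
      hl.extendEmb_codeSet_true]
  | all φ ih =>
    rw [realizeSet_all, realizeSet_all, hl.extendEmb_sdiff, hl.extendEmb_sndImage hlam,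
      hl.extendEmb_sdiff, ih, hl.extendEmb_codeSet_true, hl.extendEmb_codeSet_true]

theorem realize_iff {p n : ℕ} (φ : (setLang p).Formula (Fin n)) (X : Fin p → Set (VRank lam))
    (x : Fin n → VRank lam) :
    @Language.Formula.Realize _ _ (rankStructure lam X) _ φ x ↔
      @Language.Formula.Realize _ _ (rankStructure lam fun i => extendEmb l (X i)) _ φ
        fun i => l (x i) := by
  let ψ : (setLang p).BoundedFormula Empty n := Language.BoundedFormula.relabel Sum.inr φ
  have mem_realizeSet : ∀ (X : Fin p → Set (VRank lam)) x, tupleCode x ∈ realizeSet ψ X ↔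
      @Language.Formula.Realize _ _ (rankStructure lam X) _ φ x := fun X x => by
    let _ := rankStructure lam X
    exact tupleCode_mem_codeSet.trans (Language.Formula.realize_relabel_sumInr φ)
  rw [← mem_realizeSet, ← mem_realizeSet, ← hl.extendEmb_realizeSet hlam, ← hl.map_tupleCode,
    hl.map_mem_extendEmb]

theorem isElementary : IsElementary l :=
  ⟨⟨l, fun n φ x => by
    have h := hl.realize_iff hlam φ Fin.elim0 x
    rw [show (fun i : Fin 0 => extendEmb l (Fin.elim0 i)) = Fin.elim0 from funext nofun] at h
    exact h.symm⟩, rfl⟩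

theorem iff {n p : ℕ} {P : (Fin n → VRank lam) → (Fin p → Set (VRank lam)) → Prop}
    (h : FODefinable P) (x : Fin n → VRank lam) (X : Fin p → Set (VRank lam)) :
    P x X ↔ P (fun i => l (x i)) fun i => extendEmb l (X i) := by
  obtain ⟨φ, hφ⟩ := h p id
  exact (hφ X x).symm.trans ((hl.realize_iff hlam φ X x).trans (hφ _ _))

theorem iff₀ {R : Set (VRank lam) → Prop}
    (h : FODefinable (ι := Fin 0) (κ := Fin 1) fun _ X => R (X 0)) (A : Set (VRank lam)) :
    R A ↔ R (extendEmb l A) :=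
  hl.iff hlam h nofun ![A]

theorem iff₁ {R : VRank lam → Set (VRank lam) → Prop}
    (h : FODefinable (ι := Fin 1) (κ := Fin 1) fun x X => R (x 0) (X 0)) (a : VRank lam)
    (A : Set (VRank lam)) : R a A ↔ R (l a) (extendEmb l A) :=
  hl.iff hlam h ![a] ![A]

theorem iff₂ {R : VRank lam → VRank lam → Set (VRank lam) → Prop}
    (h : FODefinable (ι := Fin 2) (κ := Fin 1) fun x X => R (x 0) (x 1) (X 0)) (a b : VRank lam)
    (A : Set (VRank lam)) : R a b A ↔ R (l a) (l b) (extendEmb l A) :=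
  hl.iff hlam h ![a, b] ![A]

theorem iff₃ {R : VRank lam → VRank lam → VRank lam → Set (VRank lam) → Prop}
    (h : FODefinable (ι := Fin 3) (κ := Fin 1) fun x X => R (x 0) (x 1) (x 2) (X 0))
    (a b c : VRank lam) (A : Set (VRank lam)) :
    R a b c A ↔ R (l a) (l b) (l c) (extendEmb l A) :=
  hl.iff hlam h ![a, b, c] ![A]

end IsBasicEmbedding

/-! ### Cofinality of the critical sequence -/

/-- `g` contains the graph of an injective function from `M` to `M`, and is itself the graph of an
injective partial function. -/
def IsInjOn (g M : VRank lam) : Prop :=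
  (∀ u : VRank lam, u.1 ∈ M.1 → ∃ v : VRank lam, v.1 ∈ M.1 ∧ (pair u v).1 ∈ g.1) ∧
  (∀ u v v' : VRank lam, (pair u v).1 ∈ g.1 → (pair u v').1 ∈ g.1 → v = v') ∧
  ∀ u u' v : VRank lam, (pair u v).1 ∈ g.1 → (pair u' v).1 ∈ g.1 → u = u'

/-- `e` is the graph of a function from `z` to `M`. -/
def IsSeq (e M z : VRank lam) : Prop :=
  (∀ w : VRank lam, w.1 ∈ e.1 → ∃ n u : VRank lam, n.1 ∈ z.1 ∧ u.1 ∈ M.1 ∧ w = pair n u) ∧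
  ∀ n : VRank lam, n.1 ∈ z.1 → ∃ u : VRank lam, (pair n u).1 ∈ e.1 ∧
    ∀ u' : VRank lam, (pair n u').1 ∈ e.1 → u' = u

/-- `e'` is the composition of the relations `e` and `g`, with `e` applied first. -/
def IsComp (e g e' : VRank lam) : Prop :=
  ∀ w : VRank lam, w.1 ∈ e'.1 ↔
    ∃ n u v : VRank lam, ((pair n u).1 ∈ e.1 ∧ (pair u v).1 ∈ g.1) ∧ w = pair n v

/-- `F` is an `ω`-Jónsson function for `M`, with `z` in the role of `ω`: a partial function which
maps the `z`-sequences of every injective image of `M` in `M` onto `M`. -/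
def IsJonsson (F M z : VRank lam) : Prop :=
  (∀ e y y' : VRank lam, (pair e y).1 ∈ F.1 → (pair e y').1 ∈ F.1 → y = y') ∧
  ∀ g : VRank lam, IsInjOn g M → ∀ y : VRank lam, y.1 ∈ M.1 → ∃ e e' : VRank lam,
    IsSeq e M z ∧ IsComp e g e' ∧ (pair e' y).1 ∈ F.1

namespace FODefinable

variable {ι κ : Type}

theorem isInjOn (i k : ι) :
    FODefinable (lam := lam) (κ := κ) fun x _ => IsInjOn (x i) (x k) := by
  refine and (all ((mem none (some k)).imp (ex ((mem none (some (some k))).and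
    (pair_mem (some none) none (some (some i))))))) (and (all (all (all ?_))) (all (all (all ?_))))
  · exact (pair_mem (some (some none)) (some none) (some (some (some i)))).imp
      ((pair_mem (some (some none)) none (some (some (some i)))).imp (eq (some none) none))
  · exact (pair_mem (some (some none)) none (some (some (some i)))).imp
      ((pair_mem (some none) none (some (some (some i)))).imp (eq (some (some none)) (some none)))

theorem isSeq (i k m : ι) :
    FODefinable (lam := lam) (κ := κ) fun x _ => IsSeq (x i) (x k) (x m) := by
  refine and (all ((mem none (some i)).imp (ex (ex ?_))))
    (all ((mem none (some m)).imp (ex (and ?_ (all ?_)))))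
  · exact (mem (some none) (some (some (some m)))).and ((mem none (some (some (some k)))).and
      (eq_pair (some (some none)) (some none) none))
  · exact pair_mem (some none) none (some (some i))
  · exact (pair_mem (some (some none)) none (some (some (some i)))).imp (eq none (some none))

theorem isComp (i k m : ι) :
    FODefinable (lam := lam) (κ := κ) fun x _ => IsComp (x i) (x k) (x m) :=
  all ((mem none (some m)).iff (ex (ex (ex
    (((pair_mem (some (some none)) (some none) (some (some (some (some i))))).and
      (pair_mem (some none) none (some (some (some (some k)))))).and
      (eq_pair (some (some (some none))) (some (some none)) none))))))

theorem isJonsson (i k m : ι) :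
    FODefinable (lam := lam) (κ := κ) fun x _ => IsJonsson (x i) (x k) (x m) := by
  refine and (all (all (all ?_))) (all ((isInjOn none (some k)).imp
    (all ((mem none (some (some k))).imp (ex (ex (and ?_ (and ?_ ?_))))))))
  · exact (pair_mem (some (some none)) (some none) (some (some (some i)))).imp
      ((pair_mem (some (some none)) none (some (some (some i)))).imp (eq (some none) none))
  · exact isSeq (some none) (some (some (some (some k)))) (some (some (some (some m))))
  · exact isComp (some none) (some (some (some none))) none
  · exact pair_mem none (some (some none)) (some (some (some (some i))))

end FODefinable

/-- `s` codes the sequence `t`: it is the set of all pairs `(n, t n)`. -/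
def IsSeqCode (s : VRank lam) (t : ℕ → VRank lam) : Prop :=
  ∀ w : VRank lam, w.1 ∈ s.1 ↔ ∃ n, w = pair (numeral n) (t n)

namespace IsSeqCode

variable {s z g : VRank lam} {t t' : ℕ → VRank lam}

theorem pair_mem_iff (hs : IsSeqCode s t) {n : ℕ} {u : VRank lam} :
    (pair (numeral n) u).1 ∈ s.1 ↔ u = t n := by
  rw [hs]
  constructor
  · rintro ⟨m, h⟩
    obtain ⟨hnm, rfl⟩ := pair_inj.1 h
    rw [numeral_injective hnm]
  · rintro rfl
    exact ⟨n, rfl⟩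

theorem unique (hs : IsSeqCode s t) (hs' : IsSeqCode s t') : t = t' :=
  funext fun _ => hs'.pair_mem_iff.1 (hs.pair_mem_iff.2 rfl)

theorem isComp_iff (hs : IsSeqCode s t) (hg : ∀ n v, (pair (t n) v).1 ∈ g.1 ↔ v = t' n)
    {s' : VRank lam} : IsComp s g s' ↔ IsSeqCode s' t' := by
  refine forall_congr' fun w => iff_congr Iff.rfl ⟨?_, ?_⟩
  · rintro ⟨a, u, v, ⟨hau, huv⟩, rfl⟩
    obtain ⟨n, hn⟩ := (hs _).1 hau
    obtain ⟨rfl, rfl⟩ := pair_inj.1 hn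
    exact ⟨n, by rw [(hg n v).1 huv]⟩
  · rintro ⟨n, rfl⟩
    exact ⟨_, t n, _, ⟨hs.pair_mem_iff.2 rfl, (hg n _).2 rfl⟩, rfl⟩

theorem map (hω : Ordinal.omega0 < lam) {l : VRank lam → VRank lam} (hl : IsBasicEmbedding l)
    (hs : IsSeqCode s t) : IsSeqCode (l s) fun n => l (t n) := by
  choose a ha using fun n => exists_singleton (pair (numeral n) (t n))
  obtain ⟨z, hz⟩ := exists_isOmega hω
  intro w
  rw [hl.map_iUnion hω (s := a) (fun w => by simp only [ha, hs w]) w]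
  simp only [hl.map_singleton (ha _), hl.map_pair, hl.map_mem_isOmega z hz _ (hz.numeral_mem _)]

end IsSeqCode

theorem IsOmega.isSeq_iff {z s M : VRank lam} (hz : IsOmega z) :
    IsSeq s M z ↔ ∃ t, IsSeqCode s t ∧ ∀ n, (t n).1 ∈ M.1 := by
  constructor
  · rintro ⟨hpair, hfun⟩
    choose t ht ht_unique using fun n => hfun (numeral n) (hz.numeral_mem n)
    refine ⟨t, fun w => ⟨fun hw => ?_, fun ⟨n, hn⟩ => hn ▸ ht n⟩, fun n => ?_⟩
    · obtain ⟨a, u, ha, -, rfl⟩ := hpair w hw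
      obtain ⟨n, rfl⟩ := (hz.mem_iff a).1 ha
      exact ⟨n, by rw [ht_unique n u hw]⟩
    · obtain ⟨a, u, -, hu, h⟩ := hpair _ (ht n)
      rwa [(pair_inj.1 h).2]
  · rintro ⟨t, hs, ht⟩
    refine ⟨fun w hw => ?_, fun a ha => ?_⟩
    · obtain ⟨n, rfl⟩ := (hs w).1 hw
      exact ⟨numeral n, t n, hz.numeral_mem n, ht n, rfl⟩
    · obtain ⟨n, rfl⟩ := (hz.mem_iff a).1 ha
      exact ⟨t n, hs.pair_mem_iff.2 rfl, fun u => hs.pair_mem_iff.1⟩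

section Jonsson

variable {μ : Ordinal.{u}} (hμ : μ < lam)

theorem numeral_mem_stage (hlim : Order.IsSuccLimit μ) (n : ℕ) :
    (numeral n : VRank lam).1 ∈ (stage μ hμ).1 := by
  rw [mem_stage, rank_numeral]
  exact (Ordinal.natCast_lt_omega0 n).trans_le (Ordinal.omega0_le_of_isSuccLimit hlim)

theorem exists_isSeqCode (hlim : Order.IsSuccLimit μ) {t : ℕ → VRank lam}
    (ht : ∀ n, (t n).1 ∈ (stage μ hμ).1) : ∃ s, IsSeqCode s t ∧ s.1 ⊆ (stage μ hμ).1 := by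
  have rank_lt : ∀ w : VRank lam, (∃ n, w = pair (numeral n) (t n)) → w.1.rank < μ := by
    rintro _ ⟨n, rfl⟩
    exact rank_pair_lt hlim (mem_stage.1 (numeral_mem_stage hμ hlim n)) (mem_stage.1 (ht n))
  obtain ⟨s, hs⟩ := exists_of_rank_lt hμ _ rank_lt
  exact ⟨s, hs, subset_iff.2 fun w hw => mem_stage.2 (rank_lt w ((hs w).1 hw))⟩

theorem infinite_stage (hlim : Order.IsSuccLimit μ) :
    Infinite {w : VRank lam // w.1 ∈ (stage μ hμ).1} :=
  .of_injective (fun n => ⟨numeral n, numeral_mem_stage hμ hlim n⟩) fun _ _ h =>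
    numeral_injective (congrArg Subtype.val h)

theorem exists_isJonsson {c : ℕ → Ordinal.{u}} (hc : ∀ n, c n < μ)
    (hcof : ∀ α < μ, ∃ n, α < c n) {z : VRank lam} (hz : IsOmega z) :
    ∃ F : VRank lam, IsJonsson F (stage μ hμ) z := by
  have hlim : Order.IsSuccLimit μ := by
    refine ⟨fun h => (hc 0).not_ge (h (hc 0).le), fun α hα => ?_⟩
    obtain ⟨n, hn⟩ := hcof α hα.lt
    exact hα.2 hn (hc n)
  have := infinite_stage hμ hlim
  obtain ⟨e, he⟩ := exists_injective_set_seq hμ hc hcof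
  obtain ⟨F, hF⟩ := exists_jonsson he
  choose s hs hsM using fun t : ℕ → {w : VRank lam // w.1 ∈ (stage μ hμ).1} =>
    exists_isSeqCode hμ hlim fun n => (t n).2
  obtain ⟨q, hq⟩ := exists_powerset (stage μ hμ)
  obtain ⟨p, hp⟩ := exists_prod q (stage μ hμ)
  refine ⟨sep p fun w => ∃ t, w = pair (s t) (F t).1, fun x y y' h h' => ?_, ?_⟩
  · obtain ⟨-, t, ht⟩ := mem_sep.1 h
    obtain ⟨-, t', ht'⟩ := mem_sep.1 h'
    obtain ⟨rfl, rfl⟩ := pair_inj.1 ht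
    obtain ⟨hst, rfl⟩ := pair_inj.1 ht'
    have : t = t' := funext fun n =>
      Subtype.ext (congrFun ((hs t).unique (hst ▸ hs t')) n)
    rw [this]
  · rintro g ⟨hgM, hgfun, hginj⟩ y hy
    choose f hfM hfg using fun u : {w : VRank lam // w.1 ∈ (stage μ hμ).1} => hgM u.1 u.2
    have f_injective : Function.Injective fun u => (⟨f u, hfM u⟩ :
        {w : VRank lam // w.1 ∈ (stage μ hμ).1}) := fun a b h => by
      have hab : f a = f b := congrArg Subtype.val h
      exact Subtype.ext (hginj _ _ _ (hfg a) (hab ▸ hfg b))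
    obtain ⟨t, ht⟩ := hF _ f_injective ⟨y, hy⟩
    refine ⟨s t, s _, hz.isSeq_iff.2 ⟨_, hs t, fun n => (t n).2⟩,
      ((hs t).isComp_iff fun n v => ⟨fun h => hgfun _ _ _ h (hfg (t n)), ?_⟩).2 (hs _),
      mem_sep.2 ⟨(hp _).2 ⟨_, _, (hq _).2 (hsM _), hy, rfl⟩, _, by rw [ht]⟩⟩
    rintro rfl
    exact hfg (t n)

end Jonsson

theorem exists_graph_restrict {f : VRank lam → VRank lam} {M : VRank lam}
    (hf : ∀ u : VRank lam, u.1 ∈ M.1 → (f u).1 ∈ M.1) :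
    ∃ g : VRank lam, ∀ u v : VRank lam, (pair u v).1 ∈ g.1 ↔ u.1 ∈ M.1 ∧ v = f u := by
  obtain ⟨p, hp⟩ := exists_prod M M
  refine ⟨sep p fun w => ∃ u, w = pair u (f u), fun u v => ?_⟩
  rw [mem_sep, hp]
  constructor
  · rintro ⟨⟨a, b, ha, -, h⟩, u', h'⟩
    obtain ⟨rfl, rfl⟩ := pair_inj.1 h
    obtain ⟨rfl, rfl⟩ := pair_inj.1 h'
    exact ⟨ha, rfl⟩
  · rintro ⟨hu, rfl⟩
    exact ⟨⟨u, _, hu, hf u hu, rfl⟩, u, rfl⟩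

namespace IsElementary

variable {j : VRank lam → VRank lam}

theorem mem_range_of_isJonsson (hj : IsElementary j) (hω : Ordinal.omega0 < lam)
    {F M z : VRank lam} (hz : IsOmega z) (hM : j M = M) (hF : IsJonsson F M z) {y : VRank lam}
    (hy : y.1 ∈ M.1) : y ∈ Set.range j := by
  have hjF : IsJonsson (j F) M z := by
    have h := (hj.iff₃ (R := IsJonsson) (.isJonsson 0 1 2) F M z).1 hF
    rwa [hM, hj.isBasicEmbedding.map_isOmega z hz] at h
  have map_mem : ∀ u : VRank lam, u.1 ∈ M.1 → (j u).1 ∈ M.1 := fun u hu => by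
    rwa [← hM, hj.mem_iff]
  obtain ⟨g, hg⟩ := exists_graph_restrict map_mem
  have hgM : IsInjOn g M :=
    ⟨fun u hu => ⟨j u, map_mem u hu, (hg _ _).2 ⟨hu, rfl⟩⟩,
      fun u v v' h h' => ((hg _ _).1 h).2.trans ((hg _ _).1 h').2.symm,
      fun u u' v h h' => hj.injective (((hg _ _).1 h).2.symm.trans ((hg _ _).1 h').2)⟩
  obtain ⟨e, e', he, hee', hmem⟩ := hjF.2 g hgM y hy
  obtain ⟨t, het, htM⟩ := hz.isSeq_iff.1 he
  obtain rfl : j e = e' := by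
    have he' : IsSeqCode e' fun n => j (t n) :=
      (het.isComp_iff fun n v => (hg _ _).trans (and_iff_right (htM n))).1 hee'
    exact ext fun w => (het.map hω hj.isBasicEmbedding w).trans (he' w).symm
  obtain ⟨x, hx⟩ := (hj.iff₂ (R := fun e F : VRank lam => ∃ y, (pair e y).1 ∈ F.1)
    (FODefinable.ex (FODefinable.pair_mem (some 0) none (some 1))) e F).2 ⟨y, hmem⟩
  have hjx : (pair (j e) (j x)).1 ∈ (j F).1 := by
    rwa [← hj.map_pair, hj.mem_iff]
  exact ⟨x, hjF.1 _ _ _ hjx hmem⟩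

theorem map_stage_of_critSeq_cofinal (hj : IsElementary j) (hne : j ≠ id) {μ : Ordinal.{u}}
    (hμ : μ < lam) (hsup : ∀ α, α < μ ↔ ∃ n, α < critSeq j n) :
    j (stage μ hμ) = stage μ hμ := by
  refine ext fun w => ?_
  rw [hj.isBasicEmbedding.map_iUnion (hj.omega0_lt hne)
    (s := fun n => stage (critSeq j n) (hj.critSeq_lt hne n))
    (fun w => by simp only [mem_stage, hsup]) w]
  simp only [hj.map_stage, mem_stage, ← critSeq_succ, hsup]
  exact ⟨fun ⟨n, h⟩ => ⟨n + 1, h⟩, fun ⟨n, h⟩ => ⟨n, h.trans (hj.critSeq_lt_succ hne n)⟩⟩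

-- Kunen's argument: were `μ := sup critSeq` below `λ`, then `j` would fix `V_μ`, so a Jónsson
-- function on `V_μ` would put the critical level, an element of `V_μ`, into the range of `j`.
theorem exists_lt_critSeq (hj : IsElementary j) (hne : j ≠ id) {α : Ordinal.{u}} (hα : α < lam) :
    ∃ n, α < critSeq j n := by
  by_contra! hbd
  let μ := ⨆ n, critSeq j n
  have hsup : ∀ β, β < μ ↔ ∃ n, β < critSeq j n := fun β => Ordinal.lt_iSup_iff
  have hμ : μ < lam := (Ordinal.iSup_le hbd).trans_lt hα
  have critSeq_lt_sup : ∀ n, critSeq j n < μ := fun n =>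
    (hsup _).2 ⟨n + 1, hj.critSeq_lt_succ hne n⟩
  have hω := hj.omega0_lt hne
  obtain ⟨z, hz⟩ := exists_isOmega hω
  obtain ⟨F, hF⟩ := exists_isJonsson hμ critSeq_lt_sup (fun β => (hsup β).1) hz
  have hκ := hj.critSeq_lt hne 0
  have stage_mem : (stage (critPt j) hκ).1 ∈ (stage μ hμ).1 := by
    exact mem_stage.2 ((rank_stage _).trans_lt (critSeq_lt_sup 0))
  exact hj.stage_critPt_notMem_range hne hκ
    (hj.mem_range_of_isJonsson hω hz (hj.map_stage_of_critSeq_cofinal hne hμ hsup) hF stage_mem)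

theorem hasCountableCofinality (hj : IsElementary j) (hne : j ≠ id) :
    HasCountableCofinality lam :=
  ⟨hj.omega0_lt hne, critSeq j, hj.critSeq_lt hne, fun _ hα => hj.exists_lt_critSeq hne hα⟩

theorem exists_le_ordMap (hj : IsElementary j) (hne : j ≠ id) {θ : Ordinal.{u}} (hθ : θ < lam)
    (h : critPt j < θ) : ∃ σ < θ, θ ≤ ordMap j σ := by
  by_contra! hlt
  obtain ⟨n, hn⟩ := hj.exists_lt_critSeq hne hθ
  have critSeq_lt_bound : ∀ n, critSeq j n < θ := fun n => by
    induction n with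
    | zero => exact h
    | succ n ih => exact critSeq_succ j n ▸ hlt _ ih
  exact (critSeq_lt_bound n).not_gt hn

end IsElementary

/-! ### Inverse limits -/

section Composition

variable {l l' : VRank lam → VRank lam} (hlam : HasCountableCofinality lam)

theorem isBasicEmbedding_id : IsBasicEmbedding (id : VRank lam → VRank lam) :=
  IsElementary.isBasicEmbedding ⟨Language.ElementaryEmbedding.refl _ _, rfl⟩

include hlam

theorem IsBasicEmbedding.comp (hl : IsBasicEmbedding l) (hl' : IsBasicEmbedding l') :
    IsBasicEmbedding (l ∘ l') := by
  obtain ⟨e, rfl⟩ := hl.isElementary hlam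
  obtain ⟨e', rfl⟩ := hl'.isElementary hlam
  exact IsElementary.isBasicEmbedding ⟨e.comp e', rfl⟩

theorem IsBasicEmbedding.extendEmb_comp (hl : IsBasicEmbedding l) (hl' : IsBasicEmbedding l')
    (A : Set (VRank lam)) : extendEmb (l ∘ l') A = extendEmb l (extendEmb l' A) := by
  have hsub : ∀ A, extendEmb (l ∘ l') A ⊆ extendEmb l (extendEmb l' A) := fun A y hy =>
    let ⟨a, ha, hy⟩ := (hl.comp hlam hl').mem_extendEmb.1 hy
    hl.mem_extendEmb.2 ⟨l' a, fun w hw => hl'.mem_extendEmb.2 ⟨a, ha, hw⟩, hy⟩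
  refine (hsub A).antisymm (Set.compl_subset_compl.1 ?_)
  simpa only [(hl.comp hlam hl').extendEmb_compl, hl'.extendEmb_compl, hl.extendEmb_compl]
    using hsub Aᶜ

end Composition

/-- `kₙ` fixes the elements of `B n`, and `B n` itself under the extension to subsets, and the sets
`B n` eventually capture every set together with its elements. -/
structure Stabilizes (k : ℕ → VRank lam → VRank lam) (B : ℕ → Set (VRank lam)) : Prop where
  isBasicEmbedding : ∀ n, IsBasicEmbedding (k n)
  map_eq_self : ∀ n, ∀ b ∈ B n, k n b = b
  extendEmb_eq_self : ∀ n, extendEmb (k n) (B n) = B n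
  eventually_mem : ∀ a : VRank lam, ∀ᶠ n in Filter.atTop, a ∈ B n
  eventually_subset : ∀ a : VRank lam, ∀ᶠ n in Filter.atTop, ∀ w : VRank lam, w.1 ∈ a.1 → w ∈ B n

section InverseLimit

variable {k : ℕ → VRank lam → VRank lam} {K : VRank lam → VRank lam} {B : ℕ → Set (VRank lam)}

namespace Stabilizes

theorem shift (hk : Stabilizes k B) (s : ℕ) :
    Stabilizes (fun n => k (n + s)) fun n => B (n + s) where
  isBasicEmbedding _ := hk.isBasicEmbedding _
  map_eq_self _ := hk.map_eq_self _
  extendEmb_eq_self _ := hk.extendEmb_eq_self _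
  eventually_mem a := (Filter.tendsto_add_atTop_nat s).eventually (hk.eventually_mem a)
  eventually_subset a := (Filter.tendsto_add_atTop_nat s).eventually (hk.eventually_subset a)

theorem exists_isPointwiseLimit (hk : Stabilizes k B) : ∃ K, IsPointwiseLimit k K := by
  have eventually_const : ∀ a, ∃ y, ∀ᶠ n in Filter.atTop, compUpTo k n a = y := fun a => by
    obtain ⟨N, hN⟩ := Filter.eventually_atTop.1 (hk.eventually_mem a)
    refine ⟨compUpTo k N a, Filter.eventually_atTop.2 ⟨N, fun n hn => ?_⟩⟩
    induction n, hn using Nat.le_induction with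
    | base => rfl
    | succ n hn ih =>
      rw [← ih, compUpTo, Function.comp_apply, hk.map_eq_self _ _ (hN _ (hn.trans n.le_succ))]
  choose K hK using eventually_const
  exact ⟨K, hK⟩

theorem mem_iff (hk : Stabilizes k B) {Y : ℕ → Set (VRank lam)}
    (hY : ∀ n, extendEmb (k n) (Y (n + 1)) = Y n) {N : ℕ} {w : VRank lam}
    (hw : ∀ n, N ≤ n → w ∈ B n) {n : ℕ} (hn : N ≤ n) : w ∈ Y n ↔ w ∈ Y N := by
  induction n, hn using Nat.le_induction with
  | base => rfl
  | succ n hn ih =>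
    rw [← ih, ← (hk.isBasicEmbedding n).map_mem_extendEmb, hY, hk.map_eq_self n w (hw n hn)]

theorem mem_liminf_iff (hk : Stabilizes k B) {Y : ℕ → Set (VRank lam)}
    (hY : ∀ n, extendEmb (k n) (Y (n + 1)) = Y n) {N : ℕ} {w : VRank lam}
    (hw : ∀ n, N ≤ n → w ∈ B n) {n : ℕ} (hn : N ≤ n) :
    w ∈ Filter.liminf Y Filter.atTop ↔ w ∈ Y n := by
  rw [Filter.mem_liminf_iff_eventually_mem]
  constructor
  · intro h
    obtain ⟨m, hm, hNm⟩ := (h.and (Filter.eventually_ge_atTop N)).exists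
    exact (hk.mem_iff hY hw hn).2 ((hk.mem_iff hY hw hNm).1 hm)
  · intro h
    filter_upwards [Filter.eventually_ge_atTop N] with m hm
    exact (hk.mem_iff hY hw hm).2 ((hk.mem_iff hY hw hn).1 h)

end Stabilizes

variable (hlam : HasCountableCofinality lam)

include hlam

theorem isBasicEmbedding_compUpTo (hk : ∀ n, IsBasicEmbedding (k n)) :
    ∀ n, IsBasicEmbedding (compUpTo k n)
  | 0 => hk 0
  | n + 1 => (isBasicEmbedding_compUpTo hk n).comp hlam (hk (n + 1))

theorem extendEmb_compUpTo (hk : ∀ n, IsBasicEmbedding (k n)) {Y : ℕ → Set (VRank lam)}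
    (hY : ∀ n, extendEmb (k n) (Y (n + 1)) = Y n) (n : ℕ) :
    extendEmb (compUpTo k n) (Y (n + 1)) = Y 0 := by
  induction n with
  | zero => exact hY 0
  | succ n ih =>
    rw [compUpTo, (isBasicEmbedding_compUpTo hlam hk n).extendEmb_comp hlam (hk _), hY, ih]

theorem IsPointwiseLimit.isBasicEmbedding (hk : ∀ n, IsBasicEmbedding (k n))
    (hK : IsPointwiseLimit k K) : IsBasicEmbedding K := by
  refine IsElementary.isBasicEmbedding ⟨⟨K, fun n φ x => ?_⟩, rfl⟩
  obtain ⟨N, hN⟩ := (Filter.eventually_all.2 fun i => hK (x i)).exists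
  obtain ⟨e, he⟩ := (isBasicEmbedding_compUpTo hlam hk N).isElementary hlam
  rw [show K ∘ x = e ∘ x from funext fun i => (hN i).symm.trans (congrFun he.symm _)]
  exact e.map_formula φ x

theorem IsPointwiseLimit.extendEmb_subset (hk : ∀ n, IsBasicEmbedding (k n))
    (hK : IsPointwiseLimit k K) {Y : ℕ → Set (VRank lam)}
    (hY : ∀ n, extendEmb (k n) (Y (n + 1)) = Y n) {A : Set (VRank lam)}
    (hA : ∀ a : VRank lam, (∀ w : VRank lam, w.1 ∈ a.1 → w ∈ A) →
      ∀ᶠ n in Filter.atTop, ∀ w : VRank lam, w.1 ∈ a.1 → w ∈ Y n) :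
    extendEmb K A ⊆ Y 0 := by
  intro y hy
  obtain ⟨a, ha, hy⟩ := (hK.isBasicEmbedding hlam hk).mem_extendEmb.1 hy
  obtain ⟨n, hn, hKa⟩ := (((Filter.tendsto_add_atTop_nat 1).eventually (hA a ha)).and (hK a)).exists
  rw [← extendEmb_compUpTo hlam hk hY n]
  exact (isBasicEmbedding_compUpTo hlam hk n).mem_extendEmb.2 ⟨a, hn, hKa ▸ hy⟩

theorem Stabilizes.extendEmb_liminf (hk : Stabilizes k B) (hK : IsPointwiseLimit k K)
    {Y : ℕ → Set (VRank lam)} (hY : ∀ n, extendEmb (k n) (Y (n + 1)) = Y n) :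
    extendEmb K (Filter.liminf Y Filter.atTop) = Y 0 := by
  have eventually_iff : ∀ a : VRank lam, ∀ᶠ n in Filter.atTop, ∀ w : VRank lam, w.1 ∈ a.1 →
      (w ∈ Filter.liminf Y Filter.atTop ↔ w ∈ Y n) := fun a => by
    obtain ⟨N, hN⟩ := Filter.eventually_atTop.1 (hk.eventually_subset a)
    filter_upwards [Filter.eventually_ge_atTop N] with n hn w hw
    exact hk.mem_liminf_iff hY (fun n hn => hN n hn w hw) hn
  refine subset_antisymm (hK.extendEmb_subset hlam hk.isBasicEmbedding hY fun a ha => ?_) ?_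
  · filter_upwards [eventually_iff a] with n hn w hw using (hn w hw).1 (ha w hw)
  · rw [← Set.compl_subset_compl,
      ← (hK.isBasicEmbedding hlam hk.isBasicEmbedding).extendEmb_compl]
    refine hK.extendEmb_subset hlam hk.isBasicEmbedding (Y := fun n => (Y n)ᶜ)
      (fun n => by rw [(hk.isBasicEmbedding n).extendEmb_compl, hY]) fun a ha => ?_
    filter_upwards [eventually_iff a] with n hn w hw using fun h => ha w hw ((hn w hw).2 h)

end InverseLimit

/-! ### Reflection of `Σ¹` properties -/

/-- `Y` is the image of `X` under the extension to subsets of the map with graph `L`. -/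
def IsImage (L X Y : Set (VRank lam)) : Prop :=
  ∀ y, y ∈ Y ↔ ∃ a b, pair a b ∈ L ∧ (∀ w : VRank lam, w.1 ∈ a.1 → w ∈ X) ∧ y.1 ∈ b.1

theorem FODefinable.isImage {ι κ : Type} (i j k : κ) :
    FODefinable (lam := lam) (ι := ι) fun _ X => IsImage (X i) (X j) (X k) :=
  all (iff (pred k none) (ex (ex ((pair_mem_pred i (some none) none).and
    ((all (imp (mem none (some (some none))) (pred j none))).and
      (mem (some (some none)) none))))))

/-- `Reflects` as a property of the graph of a map, so that it can be expressed by a second-order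
formula. -/
def GraphReflects (L : Set (VRank lam)) {κ : Type} (P : (κ → Set (VRank lam)) → Prop) : Prop :=
  ∀ E E' : κ → Set (VRank lam), (∀ k, IsImage L (E k) (E' k)) → P E' → P E

namespace IsBasicEmbedding

variable {l : VRank lam → VRank lam} (hl : IsBasicEmbedding l)

include hl

theorem isImage_iff {X Y : Set (VRank lam)} : IsImage (graphEmb l) X Y ↔ extendEmb l X = Y := by
  have mem_iff : ∀ y, (∃ a b, pair a b ∈ graphEmb l ∧
      (∀ w : VRank lam, w.1 ∈ a.1 → w ∈ X) ∧ y.1 ∈ b.1) ↔ y ∈ extendEmb l X := fun y => by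
    simp only [hl.mem_extendEmb, pair_mem_graphEmb, exists_eq_left]
  simp only [IsImage, mem_iff]
  exact ⟨fun h => (Set.ext h).symm, fun h y => by rw [h]⟩

theorem graphReflects_iff {κ : Type} {P : (κ → Set (VRank lam)) → Prop} :
    GraphReflects (graphEmb l) P ↔ Reflects l P := by
  simp only [GraphReflects, hl.isImage_iff]
  exact ⟨fun h E => h E _ fun _ => rfl, fun h E E' e hE => h E (funext e ▸ hE)⟩

theorem reflects_of_foDefinable (hlam : HasCountableCofinality lam) {κ : Type} [Finite κ]
    {P : (κ → Set (VRank lam)) → Prop} (hP : FODefinable (ι := Empty) fun _ X => P X) :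
    Reflects l P := by
  intro E hE
  obtain ⟨q, ⟨f⟩⟩ := Finite.exists_equiv_fin κ
  have h := (hl.iff hlam (hP.rename (nofun : Empty → Fin 0) f) nofun fun i => E (f.symm i)).2
  simp only [Equiv.symm_apply_apply] at h
  exact h hE

end IsBasicEmbedding

theorem SODefinable.graphReflects {κ κ' : Type} [Finite κ] {P : (κ → Set (VRank lam)) → Prop}
    {m : ℕ} (hP : SODefinable true m P) (i : κ') :
    SODefinable false (m + 1) fun E : κ' → Set (VRank lam) => GraphReflects (E i) P := by
  refine quants (R := fun E W => ∀ E' : κ → Set (VRank lam),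
    (∀ k, IsImage (E i) (W k) (E' k)) → P E' → P W)
    (quants (R := fun (E : κ' ⊕ κ → Set (VRank lam)) W' =>
      (∀ k, IsImage (E (.inl i)) (E (.inr k)) (W' k)) → P W' → P fun k => E (.inr k)) ?_)
  have not_isImage : FODefinable (ι := Empty) fun _ (E : (κ' ⊕ κ) ⊕ κ → Set (VRank lam)) =>
      ¬ ∀ k, IsImage (E (.inl (.inl i))) (E (.inl (.inr k))) (E (.inr k)) :=
    (FODefinable.forall_finite fun _ => .isImage _ _ _).not
  refine (((of_foDefinable not_isImage).or (hP.rename Sum.inr).not.succ).or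
    (hP.rename fun k => .inl (.inr k)).switch).congr fun E => ?_
  tauto

/-- A property of a family of subsets of `V_λ`, packed with the index type of the family. -/
abbrev SOProperty (lam : Ordinal.{u}) : Type (u + 1) :=
  Σ κ : Type, (κ → Set (VRank lam)) → Prop

/-- `l` fixes `B`, both pointwise and as a set, and reflects the properties in `F`. -/
structure FixesReflects (F : List (SOProperty lam)) (B : Set (VRank lam))
    (l : VRank lam → VRank lam) : Prop where
  isBasicEmbedding : IsBasicEmbedding l
  map_eq_self : ∀ b ∈ B, l b = b
  extendEmb_eq_self : extendEmb l B = B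
  reflects : ∀ f ∈ F, Reflects l f.2

/-- Some embedding that fixes `B` and reflects the properties in `F` sends `A` to `A'` and has `Y`
in its range. -/
def ExistsLift (F : List (SOProperty lam)) {κ β : Type} (A A' : κ → Set (VRank lam))
    (Y : β → Set (VRank lam)) (B : Set (VRank lam)) : Prop :=
  ∃ l, FixesReflects F B l ∧ (∀ k, extendEmb l (A k) = A' k) ∧
    ∃ Y' : β → Set (VRank lam), ∀ b, extendEmb l (Y' b) = Y b

theorem existsLift_iff_graph {F : List (SOProperty lam)} {κ β : Type} {A A' : κ → Set (VRank lam)}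
    {Y : β → Set (VRank lam)} {B : Set (VRank lam)} : ExistsLift F A A' Y B ↔
      ∃ (L : Set (VRank lam)) (Y' : β → Set (VRank lam)),
        ((∃ l, IsBasicEmbedding l ∧ graphEmb l = L) ∧ (∀ k, IsImage L (A k) (A' k)) ∧
          (∀ b, IsImage L (Y' b) (Y b)) ∧ (∀ b, b ∈ B → pair b b ∈ L) ∧ IsImage L B B) ∧
        ∀ f ∈ F, GraphReflects L f.2 := by
  constructor
  · rintro ⟨l, ⟨hl, hfix, hB, hF⟩, hA, Y', hY⟩
    exact ⟨graphEmb l, Y', ⟨⟨l, hl, rfl⟩, fun k => hl.isImage_iff.2 (hA k),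
      fun b => hl.isImage_iff.2 (hY b), fun b hb => pair_mem_graphEmb.2 (hfix b hb).symm,
      hl.isImage_iff.2 hB⟩, fun f hf => hl.graphReflects_iff.2 (hF f hf)⟩
  · rintro ⟨_, Y', ⟨⟨l, hl, rfl⟩, hA, hY, hfix, hB⟩, hF⟩
    exact ⟨l, ⟨hl, fun b hb => (pair_mem_graphEmb.1 (hfix b hb)).symm, hl.isImage_iff.1 hB,
      fun f hf => hl.graphReflects_iff.1 (hF f hf)⟩, fun k => hl.isImage_iff.1 (hA k), Y',
      fun b => hl.isImage_iff.1 (hY b)⟩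

theorem SODefinable.existsLift {F : List (SOProperty lam)} {m : ℕ}
    (hF : ∀ f ∈ F, Finite f.1 ∧ ∃ c < m, SODefinable true c f.2) {κ β : Type} [Finite κ]
    [Finite β] :
    SODefinable true (m + 1) fun E : (κ ⊕ κ) ⊕ (β ⊕ Unit) → Set (VRank lam) =>
      ExistsLift F (fun k => E (.inl (.inl k))) (fun k => E (.inl (.inr k)))
        (fun b => E (.inr (.inl b))) (E (.inr (.inr ()))) := by
  refine (quant (b := true) (R := fun E L => ∃ Y' : β → Set (VRank lam), _) (quants (b := true)
    (R := fun (E : ((κ ⊕ κ) ⊕ (β ⊕ Unit)) ⊕ Unit → Set (VRank lam)) (Y' : β → Set (VRank lam)) =>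
      ((∃ l, IsBasicEmbedding l ∧ graphEmb l = E (.inr ())) ∧
        (∀ k, IsImage (E (.inr ())) (E (.inl (.inl (.inl k)))) (E (.inl (.inl (.inr k))))) ∧
        (∀ b, IsImage (E (.inr ())) (Y' b) (E (.inl (.inr (.inl b))))) ∧
        (∀ b, b ∈ E (.inl (.inr (.inr ()))) → pair b b ∈ E (.inr ())) ∧
        IsImage (E (.inr ())) (E (.inl (.inr (.inr ())))) (E (.inl (.inr (.inr ()))))) ∧
      ∀ f ∈ F, GraphReflects (E (.inr ())) f.2)
    (and ?_ ?_))).congr fun E => existsLift_iff_graph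
  · exact of_foDefinable ((FODefinable.isBasicEmbeddingGraph _).and
      ((FODefinable.forall_finite fun _ => .isImage _ _ _).and
        ((FODefinable.forall_finite fun _ => .isImage _ _ _).and
          ((FODefinable.all ((FODefinable.pred _ none).imp (.pair_mem_pred _ none none))).and
            (.isImage _ _ _)))))
  · refine forall_list F fun f hf => ?_
    obtain ⟨hfin, c, hc, hf⟩ := hF f hf
    exact ((hf.graphReflects (Sum.inl (Sum.inr ()))).mono hc).switch

section Reflection

variable {k : ℕ → VRank lam → VRank lam} {K : VRank lam → VRank lam} {B : ℕ → Set (VRank lam)}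
  (hlam : HasCountableCofinality lam)

include hlam

theorem Stabilizes.exists_preimages (hk : Stabilizes k B) (hK : IsPointwiseLimit k K)
    (A : Set (VRank lam)) : ∃ X : ℕ → Set (VRank lam), X 0 = extendEmb K A ∧
      (∀ n, extendEmb (k n) (X (n + 1)) = X n) ∧ Filter.liminf X Filter.atTop = A := by
  choose T hT using fun n => (hk.shift n).exists_isPointwiseLimit
  have hT_basic : ∀ n, IsBasicEmbedding (T n) := fun n =>
    (hT n).isBasicEmbedding hlam (hk.shift n).isBasicEmbedding
  have hT_succ : ∀ n, extendEmb (k n) (extendEmb (T (n + 1)) A) = extendEmb (T n) A := fun n => by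
    rw [(hT n).shift_eq (hT (n + 1)), (hk.isBasicEmbedding n).extendEmb_comp hlam (hT_basic _)]
  have hT_zero : T 0 = K := (hT 0).unique hK
  refine ⟨fun n => extendEmb (T n) A, congrArg (extendEmb · A) hT_zero, hT_succ,
    (hK.isBasicEmbedding hlam hk.isBasicEmbedding).extendEmb_injective ?_⟩
  rw [hk.extendEmb_liminf hlam hK hT_succ, hT_zero]

-- The new sequence is chosen recursively: the preimages `V (n + 1)` of `V n` given by the lift at
-- stage `n` are the targets of the lift at stage `n + 1`.
theorem Stabilizes.exists_lift (hk : Stabilizes k B) (hK : IsPointwiseLimit k K)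
    {F : List (SOProperty lam)} {κ β : Type} (E : κ → Set (VRank lam)) (Y : β → Set (VRank lam))
    (hlift : ∀ n (A : κ → Set (VRank lam)) (W : β → Set (VRank lam)),
      ExistsLift F A (fun i => extendEmb (k n) (A i)) W (B n)) :
    ∃ (l : ℕ → VRank lam → VRank lam) (L : VRank lam → VRank lam) (Y' : β → Set (VRank lam)),
      Stabilizes l B ∧ IsPointwiseLimit l L ∧ (∀ n, ∀ f ∈ F, Reflects (l n) f.2) ∧
      (∀ i, extendEmb L (E i) = extendEmb K (E i)) ∧ ∀ b, extendEmb L (Y' b) = Y b := by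
  choose X hX_zero hX_succ hX_liminf using fun i => hk.exists_preimages hlam hK (E i)
  choose g hg hgX W hW using fun n => hlift n fun i => X i (n + 1)
  let V (n : ℕ) : β → Set (VRank lam) := Nat.rec Y W n
  have hl : Stabilizes (fun n => g n (V n)) B :=
    ⟨fun n => (hg n _).isBasicEmbedding, fun n => (hg n _).map_eq_self,
      fun n => (hg n _).extendEmb_eq_self, hk.eventually_mem, hk.eventually_subset⟩
  obtain ⟨L, hL⟩ := hl.exists_isPointwiseLimit
  refine ⟨_, L, fun b => Filter.liminf (fun n => V n b) Filter.atTop, hl, hL,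
    fun n => (hg n _).reflects, fun i => ?_, fun b => ?_⟩
  · rw [← hX_zero, ← hl.extendEmb_liminf hlam hL (Y := X i) fun n => ?_, hX_liminf]
    exact (hgX n _ i).trans (hX_succ i n)
  · exact hl.extendEmb_liminf hlam hL (Y := fun n => V n b) fun n => hW n (V n) b

theorem exists_reflecting_list (a : ℕ) {κ : Type} [Finite κ] {P : (κ → Set (VRank lam)) → Prop}
    (hP : SODefinable true (2 * a) P) : ∃ F : List (SOProperty lam),
      (∀ f ∈ F, Finite f.1 ∧ ∃ c < 2 * a, SODefinable true c f.2) ∧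
      ∀ {k : ℕ → VRank lam → VRank lam} {B : ℕ → Set (VRank lam)} {K : VRank lam → VRank lam},
        Stabilizes k B → IsPointwiseLimit k K → (∀ n, ∀ f ∈ F, Reflects (k n) f.2) →
        Reflects K P := by
  induction a generalizing κ with
  | zero => exact ⟨[], by simp, fun hk hK _ =>
      (hK.isBasicEmbedding hlam hk.isBasicEmbedding).reflects_of_foDefinable hlam hP⟩
  | succ a ih =>
    obtain ⟨β, hβ, R, ⟨γ, hγ, T, hT, hRT⟩, hPR⟩ := hP
    obtain ⟨F, hF, hF_reflects⟩ := ih hT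
    let S (E : (κ ⊕ κ) ⊕ (β ⊕ Unit) → Set (VRank lam)) : Prop :=
      ExistsLift F (fun k => E (.inl (.inl k))) (fun k => E (.inl (.inr k)))
        (fun b => E (.inr (.inl b))) (E (.inr (.inr ())))
    refine ⟨⟨_, S⟩ :: F, ?_, ?_⟩
    · rw [List.forall_mem_cons]
      refine ⟨⟨inferInstance, 2 * a + 1, by omega, .existsLift hF⟩, fun f hf => ?_⟩
      obtain ⟨hfin, c, hc, hf⟩ := hF f hf
      exact ⟨hfin, c, by omega, hf⟩
    · intro k B K hk hK hk_reflects E hE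
      obtain ⟨Y, hY⟩ := (hPR _).1 hE
      have hlift : ∀ n (A : κ → Set (VRank lam)) (W : β → Set (VRank lam)),
          ExistsLift F A (fun i => extendEmb (k n) (A i)) W (B n) := fun n A W => by
        -- `k n` itself is a lift of the image under `k n` of the data, and `k n` reflects `S`.
        refine hk_reflects n _ List.mem_cons_self
          (Sum.elim (Sum.elim A fun i => extendEmb (k n) (A i)) (Sum.elim W fun _ => B n))
          ⟨k n, ⟨hk.isBasicEmbedding n, ?_, ?_, fun f hf =>
            hk_reflects n f (List.mem_cons_of_mem _ hf)⟩, fun _ => rfl, W, fun _ => rfl⟩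
        · change ∀ b ∈ extendEmb (k n) (B n), k n b = b
          rw [hk.extendEmb_eq_self]
          exact hk.map_eq_self n
        · exact congrArg _ (hk.extendEmb_eq_self n)
      obtain ⟨l, L, Y', hl, hL, hl_reflects, hLE, hLY⟩ := hk.exists_lift hlam hK E Y hlift
      refine (hPR E).2 ⟨Y', (hRT _).2 fun Z => hF_reflects hl hL hl_reflects _ ?_⟩
      refine (iff_of_eq (congrArg T ?_)).1 ((hRT _).1 hY fun i => extendEmb L (Z i))
      funext i
      rcases i with (i | i) | i
      exacts [(hLE i).symm, (hLY i).symm, rfl]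

end Reflection

theorem Stabilizes.reflectsSigma (hlam : HasCountableCofinality lam)
    {k : ℕ → VRank lam → VRank lam} {B : ℕ → Set (VRank lam)} {K : VRank lam → VRank lam}
    (hk : Stabilizes k B) (hK : IsPointwiseLimit k K) {a : ℕ}
    (h : ∀ n, ReflectsSigma (2 * a + 1) (k n)) : ReflectsSigma (2 * a + 2) K := by
  intro κ _ P hP
  obtain ⟨F, hF, hF_reflects⟩ := exists_reflecting_list hlam (a + 1) hP
  refine hF_reflects hk hK fun n f hf => ?_
  obtain ⟨hfin, c, hc, hf⟩ := hF f hf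
  exact h n _ _ (hf.mono (Nat.le_of_lt_succ hc))

namespace ReflectsSigma

variable {j k l : VRank lam → VRank lam} {m : ℕ}

-- `j` is the inverse limit of the sequence `j, id, id, …`.
theorem succ (hlam : HasCountableCofinality lam) (hj : IsBasicEmbedding j) {a : ℕ}
    (h : ReflectsSigma (2 * a + 1) j) : ReflectsSigma (2 * a + 2) j := by
  have extendEmb_id : ∀ A : Set (VRank lam), extendEmb id A = A := fun A =>
    isBasicEmbedding_id.extendEmb_injective
      (isBasicEmbedding_id.extendEmb_comp hlam isBasicEmbedding_id A).symm
  let k : ℕ → VRank lam → VRank lam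
    | 0 => j
    | _ + 1 => id
  let B : ℕ → Set (VRank lam)
    | 0 => ∅
    | _ + 1 => Set.univ
  have eventually_B : ∀ᶠ n in Filter.atTop, B n = Set.univ :=
    Filter.eventually_atTop.2 ⟨1, fun | _ + 1, _ => rfl⟩
  have hk : Stabilizes k B :=
    { isBasicEmbedding := fun
        | 0 => hj
        | _ + 1 => isBasicEmbedding_id
      map_eq_self := fun
        | 0 => fun _ hb => hb.elim
        | _ + 1 => fun _ _ => rfl
      extendEmb_eq_self := fun
        | 0 => hj.extendEmb_empty
        | _ + 1 => extendEmb_id _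
      eventually_mem := fun _ => eventually_B.mono fun _ h => h ▸ trivial
      eventually_subset := fun _ => eventually_B.mono fun _ h _ _ => h ▸ trivial }
  have compUpTo_k : ∀ n, compUpTo k n = j := by
    intro n
    induction n with
    | zero => rfl
    | succ _ ih => exact ih
  refine hk.reflectsSigma hlam (fun a => .of_forall fun n => congrFun (compUpTo_k n) a) fun n => ?_
  match n with
  | 0 => exact h
  | _ + 1 => exact fun κ _ P _ E hE => by simpa only [k, extendEmb_id] using hE

theorem apply (hlam : HasCountableCofinality lam) (hj : IsBasicEmbedding j)
    (hk : IsBasicEmbedding k) (hl : IsBasicEmbedding l)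
    (e : graphEmb l = extendEmb j (graphEmb k)) {a : ℕ} (hj_reflects : ReflectsSigma (2 * a + 1) j)
    (hk_reflects : ReflectsSigma (2 * a + 1) k) : ReflectsSigma (2 * a + 1) l := by
  intro κ _ P hP
  by_contra hn
  rw [← hl.graphReflects_iff, e] at hn
  exact hj_reflects.succ hlam hj Unit _ (hP.graphReflects ()).not (fun _ => graphEmb k) hn
    (hk.graphReflects_iff.2 (hk_reflects κ P hP))

theorem sigmaElementary (h : ReflectsSigma m l) (hl : IsBasicEmbedding l) :
    SigmaElementary m l := by
  intro n p φ hφ x X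
  obtain ⟨P, hP, hPφ⟩ := exists_soDefinable_of_isLevel (lam := lam) hφ
  have extendEmb_sumElim : (fun k => extendEmb l (Sum.elim X (fun i => {x i}) k)) =
      Sum.elim (fun i => extendEmb l (X i)) fun i => {l (x i)} := by
    funext k
    rcases k with k | k
    · rfl
    · exact hl.extendEmb_singleton _
  rw [← hPφ, ← hPφ, ← extendEmb_sumElim]
  exact ⟨h.map_of_holds hP, h _ P hP _⟩

end ReflectsSigma

/-! ### Iterated ranges -/

namespace IsBasicEmbedding

variable {j k l : VRank lam → VRank lam}

theorem apply_map (hj : IsBasicEmbedding j) (e : graphEmb l = extendEmb j (graphEmb k))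
    (x : VRank lam) : l (j x) = j (k x) := by
  have h : j (pair x (k x)) ∈ extendEmb j (graphEmb k) :=
    hj.map_mem_extendEmb.2 (pair_mem_graphEmb.2 rfl)
  rw [hj.map_pair, ← e, pair_mem_graphEmb] at h
  exact h.symm

variable (hlam : HasCountableCofinality lam)

include hlam

theorem exists_apply (hj : IsBasicEmbedding j) (hk : IsBasicEmbedding k) :
    ∃ l, IsBasicEmbedding l ∧ graphEmb l = extendEmb j (graphEmb k) :=
  (hj.iff₀ hlam (R := fun L => ∃ l, IsBasicEmbedding l ∧ graphEmb l = L)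
    (.isBasicEmbeddingGraph 0) _).1 ⟨k, hk, rfl⟩

theorem apply (hj : IsBasicEmbedding j) (hk : IsBasicEmbedding k)
    (e : graphEmb l = extendEmb j (graphEmb k)) : IsBasicEmbedding l := by
  obtain ⟨l', hl', e'⟩ := hj.exists_apply hlam hk
  have eq_l : l' = l := funext fun x => by
    have h : pair x (l' x) ∈ graphEmb l := e.trans e'.symm ▸ pair_mem_graphEmb.2 rfl
    exact pair_mem_graphEmb.1 h
  exact eq_l ▸ hl'

theorem apply_eq_self (hj : IsBasicEmbedding j) (e : graphEmb l = extendEmb j (graphEmb k))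
    {v : VRank lam} (hv : ∀ x : VRank lam, x.1 ∈ v.1 → k x = x) {x : VRank lam}
    (hx : x.1 ∈ (j v).1) : l x = x := by
  have h := (hj.iff₁ hlam (R := fun v L => ∀ y : VRank lam, y.1 ∈ v.1 → pair y y ∈ L)
    (.all (.imp (.mem none (some 0)) (.pair_mem_pred 0 none none))) v (graphEmb k)).1
    (fun y hy => pair_mem_graphEmb.2 (hv y hy).symm) x hx
  rw [← e, pair_mem_graphEmb] at h
  exact h.symm

end IsBasicEmbedding

/-- The binary relation coded by the pairs in `D` is single-valued. -/
def Functional (D : Set (VRank lam)) : Prop :=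
  ∀ a z z' : VRank lam, pair a z ∈ D → pair a z' ∈ D → z = z'

namespace FODefinable

variable {ι κ : Type}

theorem functional (k : κ) : FODefinable (lam := lam) (ι := ι) fun _ X => Functional (X k) :=
  all (all (all ((pair_mem_pred k (some (some none)) (some none)).imp
    ((pair_mem_pred k (some (some none)) none).imp (eq (some none) none)))))

theorem functional_coe (i : ι) :
    FODefinable (lam := lam) (κ := κ) fun x _ => Functional {w : VRank lam | w.1 ∈ (x i).1} :=
  all (all (all ((pair_mem (some (some none)) (some none) (some (some (some i)))).imp
    ((pair_mem (some (some none)) none (some (some (some i)))).imp (eq (some none) none)))))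

theorem eq_pair_pair (i j k m : ι) :
    FODefinable (lam := lam) (κ := κ) fun x _ => x i = pair (pair (x j) (x k)) (x m) :=
  (ex (R := fun x _ p => p = pair (x j) (x k) ∧ x i = pair p (x m))
    ((eq_pair none (some j) (some k)).and (eq_pair (some i) none (some m)))).congr
      fun _ _ => by rw [exists_eq_left]

end FODefinable

theorem functional_graphEmb (l : VRank lam → VRank lam) : Functional (graphEmb l) :=
  fun _ _ _ h h' => (pair_mem_graphEmb.1 h).trans (pair_mem_graphEmb.1 h').symm

theorem functional_singleton_pair (a z : VRank lam) : Functional {pair a z} :=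
  fun _ _ _ h h' => (pair_inj.1 h).2.trans (pair_inj.1 h').2.symm

theorem IsBasicEmbedding.functional_iff (hlam : HasCountableCofinality lam)
    {l : VRank lam → VRank lam} (hl : IsBasicEmbedding l) {D : Set (VRank lam)} :
    Functional D ↔ Functional (extendEmb l D) :=
  hl.iff₀ hlam (.functional 0) D

section Bounds

variable (hlam : HasCountableCofinality lam) {f : VRank lam → VRank lam} (hf : IsBasicEmbedding f)
  {κ : Ordinal.{u}} (hκ : κ < lam) (hfix : ∀ x : VRank lam, x.1.rank < κ → f x = x)
  {D : Set (VRank lam)} (hD : Functional D)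

include hlam hf hκ hfix hD

theorem rank_lt_of_pair_mem_extendEmb {a z : VRank lam} (ha : a.1.rank < κ)
    (hz : z.1.rank < ordMap f κ) (h : pair a z ∈ extendEmb f D) : z.1.rank < κ := by
  obtain ⟨w, hw, hwD⟩ := (hf.iff₂ hlam
    (R := fun a v D => ∃ z : VRank lam, z.1 ∈ v.1 ∧ pair a z ∈ D)
    (.ex (.and (.mem none (some 1)) (.pair_mem_pred 0 (some 0) none))) a (stage κ hκ) D).2
    ⟨z, ((hf.isElementary hlam).mem_map_stage hκ).2 hz, (hfix a ha).symm ▸ h⟩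
  have hwD' := hf.map_mem_extendEmb.2 hwD
  rw [hf.map_pair, hfix a ha, hfix w (mem_stage.1 hw)] at hwD'
  rw [(hf.functional_iff hlam).1 hD a z w h hwD']
  exact mem_stage.1 hw

-- Otherwise the values are unbounded in `V_κ`, and so there are values in `V_{f κ} \ V_κ` of the
-- image of `D` under `f`.
theorem exists_bound_of_functional (hmove : κ < ordMap f κ) {τ : Ordinal.{u}} (hτ : τ < κ) :
    ∃ σ < κ, ∀ a z : VRank lam, a.1.rank < τ → z.1.rank < κ → pair a z ∈ D → z.1.rank < σ := by
  by_contra! hunb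
  have hf_elem := hf.isElementary hlam
  have hτ' := hτ.trans hκ
  obtain ⟨a, z, ha, hz, hD', hzκ⟩ := (hf.iff₂ hlam (R := fun s t D =>
    ∀ v : VRank lam, v.1 ∈ t.1 → IsStage v → ∃ a z : VRank lam, a.1 ∈ s.1 ∧ z.1 ∈ t.1 ∧
      pair a z ∈ D ∧ ¬ z.1 ∈ v.1)
    (.all (.imp (.mem none (some 1)) (.imp (.isStage none) (.ex (.ex
      (.and (.mem (some none) (some (some (some 0)))) (.and (.mem none (some (some (some 1))))
        (.and (.pair_mem_pred 0 (some none) none) (.not (.mem none (some (some none))))))))))))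
    (stage τ hτ') (stage κ hκ) D).1
    (fun v hv hv_stage => by
      obtain ⟨σ, hσ, rfl⟩ := isStage_iff.1 hv_stage
      obtain ⟨a, z, ha, hz, hD, hzσ⟩ := hunb σ (rank_stage hσ ▸ mem_stage.1 hv)
      exact ⟨a, z, mem_stage.2 ha, mem_stage.2 hz, hD, fun h => (mem_stage.1 h).not_ge hzσ⟩)
    (stage κ hκ) ((hf_elem.mem_map_stage hκ).2 ((rank_stage hκ).trans_lt hmove)) (isStage_stage hκ)
  rw [hfix (stage τ hτ') ((rank_stage hτ').trans_lt hτ), mem_stage] at ha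
  exact hzκ (mem_stage.2 (rank_lt_of_pair_mem_extendEmb hlam hf hκ hfix hD (ha.trans hτ)
    ((hf_elem.mem_map_stage hκ).1 hz) hD'))

end Bounds

/-- Functions in the range of `l` do not lead from `V_θ` to `V_ν \ V_θ`. -/
def Avoids (l : VRank lam → VRank lam) (θ ν : Ordinal.{u}) : Prop :=
  ∀ D : Set (VRank lam), Functional D → ∀ a z : VRank lam, a.1.rank < θ → z.1.rank < ν →
    pair a z ∈ extendEmb l D → z.1.rank < θ

theorem IsBasicEmbedding.avoids (hlam : HasCountableCofinality lam) {l f : VRank lam → VRank lam}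
    (hl : IsBasicEmbedding l) (hf : IsBasicEmbedding f) {κ θ : Ordinal.{u}} (hκ : κ < lam)
    (hfix : ∀ x : VRank lam, x.1.rank < κ → f x = x) (hmove : κ < ordMap f κ)
    (hθ : ∀ ρ, ρ < θ ↔ ∃ σ < κ, ρ < ordMap l σ) : Avoids l θ (ordMap l κ) := by
  intro D hD a z ha hz hDz
  have hl_elem := hl.isElementary hlam
  obtain ⟨τ, hτ, ha⟩ := (hθ _).1 ha
  obtain ⟨σ, hσ, hbound⟩ := exists_bound_of_functional hlam hf hκ hfix hD hmove hτ
  have hτ' := hτ.trans hκ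
  have hσ' := hσ.trans hκ
  have hz_mem := (hl.iff₃ hlam (R := fun s t v D =>
    ∀ a z : VRank lam, a.1 ∈ s.1 → z.1 ∈ t.1 → pair a z ∈ D → z.1 ∈ v.1)
    (.all (.all (.imp (.mem (some none) (some (some 0))) (.imp (.mem none (some (some 1)))
      (.imp (.pair_mem_pred 0 (some none) none) (.mem none (some (some 2))))))))
    (stage τ hτ') (stage κ hκ) (stage σ hσ') D).1
    (fun a z ha hz h => mem_stage.2 (hbound a z (mem_stage.1 ha) (mem_stage.1 hz) h)) a z
    ((hl_elem.mem_map_stage hτ').2 ha) ((hl_elem.mem_map_stage hκ).2 hz) hDz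
  exact (hθ _).2 ⟨σ, hσ, (hl_elem.mem_map_stage hσ').1 hz_mem⟩

/-- The relation with value `e(a)` at `(a, x)`, where `e` is the value at `x` of the relation
`D`. -/
def uncurry (D : Set (VRank lam)) : Set (VRank lam) :=
  {w | ∃ a x z e : VRank lam, w = pair (pair a x) z ∧ pair x e ∈ D ∧ (pair a z).1 ∈ e.1 ∧
    Functional {w : VRank lam | w.1 ∈ e.1}}

theorem Functional.uncurry {D : Set (VRank lam)} (hD : Functional D) :
    Functional (VRank.uncurry D) := by
  rintro p z z' ⟨a, x, y, e, hp, hxe, hay, he⟩ ⟨a', x', y', e', hp', hxe', hay', -⟩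
  obtain ⟨rfl, rfl⟩ := pair_inj.1 hp
  obtain ⟨hax, rfl⟩ := pair_inj.1 hp'
  obtain ⟨rfl, rfl⟩ := pair_inj.1 hax
  obtain rfl := hD _ _ _ hxe hxe'
  exact he _ _ _ hay hay'

theorem IsBasicEmbedding.extendEmb_uncurry (hlam : HasCountableCofinality lam)
    {l : VRank lam → VRank lam} (hl : IsBasicEmbedding l) (D : Set (VRank lam)) :
    extendEmb l (uncurry D) = uncurry (extendEmb l D) :=
  Set.ext ((hl.iff hlam (P := fun (_ : Fin 0 → VRank lam) (X : Fin 2 → Set (VRank lam)) =>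
      ∀ w, w ∈ X 0 ↔ ∃ a x z e : VRank lam, w = pair (pair a x) z ∧ pair x e ∈ X 1 ∧
        (pair a z).1 ∈ e.1 ∧ Functional {w : VRank lam | w.1 ∈ e.1})
    (.all (.iff (.pred 0 none) (.ex (.ex (.ex (.ex
      (.and (.eq_pair_pair (some (some (some (some none)))) (some (some (some none)))
        (some (some none)) (some none))
      (.and (.pair_mem_pred 1 (some (some none)) none)
      (.and (.pair_mem (some (some (some none))) (some none) none)
        (.functional_coe none)))))))))) nofun ![uncurry D, D]).1 fun _ => Iff.rfl)

theorem rank_pair_le {x y : ZFSet.{u}} {σ : Ordinal.{u}} (hx : x.rank < σ) (hy : y.rank < σ) :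
    (ZFSet.pair x y).rank ≤ Order.succ σ := by
  simp only [ZFSet.pair, ZFSet.rank_pair, ZFSet.rank_singleton, max_le_iff, Order.succ_le_iff,
    max_lt_iff, Order.succ_lt_succ_iff]
  exact ⟨hx, hx, hy⟩

theorem IsBasicEmbedding.exists_functional_restrict (hlam : HasCountableCofinality lam)
    {l : VRank lam → VRank lam} (hl : IsBasicEmbedding l) {D : Set (VRank lam)} (hD : Functional D)
    {σ : Ordinal.{u}} (hσ : σ < lam) : ∃ c : VRank lam,
      c.1.rank ≤ Order.succ (Order.succ σ) ∧ Functional {w : VRank lam | w.1 ∈ (l c).1} ∧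
      ∀ a z : VRank lam, a.1.rank < ordMap l σ → z.1.rank < ordMap l σ →
        pair a z ∈ extendEmb l D → (pair a z).1 ∈ (l c).1 := by
  have hl_elem := hl.isElementary hlam
  let IsRestriction (c v : VRank lam) (D : Set (VRank lam)) : Prop := ∀ w : VRank lam,
    w.1 ∈ c.1 ↔ w ∈ D ∧ ∃ x y : VRank lam, x.1 ∈ v.1 ∧ y.1 ∈ v.1 ∧ w = pair x y
  have rank_lt : ∀ w : VRank lam, (w ∈ D ∧ ∃ x y : VRank lam, x.1 ∈ (stage σ hσ).1 ∧
      y.1 ∈ (stage σ hσ).1 ∧ w = pair x y) → w.1.rank < Order.succ (Order.succ σ) := by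
    rintro _ ⟨-, x, y, hx, hy, rfl⟩
    exact Order.lt_succ_iff.2 (rank_pair_le (mem_stage.1 hx) (mem_stage.1 hy))
  obtain ⟨c, hc⟩ : ∃ c, IsRestriction c (stage σ hσ) D :=
    exists_of_rank_lt (succ_lt (succ_lt hσ)) _ rank_lt
  have hlc : IsRestriction (l c) (l (stage σ hσ)) (extendEmb l D) := (hl.iff₂ hlam
    (.all (.iff (.mem none (some 0)) (.and (.pred 0 none) (.ex (.ex
      (.and (.mem (some none) (some (some (some 1)))) (.and (.mem none (some (some (some 1))))
        (.eq_pair (some (some none)) (some none) none)))))))) c (stage σ hσ) D).1 hc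
  refine ⟨c, ?_, ?_, fun a z ha hz h => (hlc _).2 ⟨h, a, z, (hl_elem.mem_map_stage hσ).2 ha,
    (hl_elem.mem_map_stage hσ).2 hz, rfl⟩⟩
  · exact ZFSet.rank_le_iff.2 fun w hw =>
      rank_lt ⟨w, c.mem_vonNeumann_of_mem hw⟩ ((hc ⟨w, c.mem_vonNeumann_of_mem hw⟩).1 hw)
  · exact fun a z z' h h' => (hl.functional_iff hlam).1 hD a z z' ((hlc _).1 h).1 ((hlc _).1 h').1

namespace Avoids

variable {l h : VRank lam → VRank lam} {θ ν : Ordinal.{u}}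

theorem le_ordMap (hA : Avoids l θ ν) (hlam : HasCountableCofinality lam) (hl : IsBasicEmbedding l)
    (hh : IsElementary h) {B : Set (VRank lam)} (e : extendEmb l B = graphEmb h) {σ : Ordinal.{u}}
    (hσ : σ < lam) (hσθ : σ < θ) (hθσ : θ ≤ ordMap h σ) : ν ≤ ordMap h σ := by
  have hB : Functional B := (hl.functional_iff hlam).2 (e ▸ functional_graphEmb h)
  have hrank : (h (stage σ hσ)).1.rank = ordMap h σ := by rw [hh.rank_map, rank_stage]
  by_contra! hlt
  have hlt_θ := hA B hB (stage σ hσ) (h (stage σ hσ)) ((rank_stage hσ).trans_lt hσθ)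
    (hrank.trans_lt hlt) (e ▸ pair_mem_graphEmb.2 rfl)
  exact hlt_θ.not_ge (hθσ.trans_eq hrank.symm)

-- A function in the range of `h`, restricted to a set, is a value of `h`; so it is obtained by
-- uncurrying from the graph of `h`, which is in the range of `l`.
theorem of_graph (hA : Avoids l θ ν) (hlam : HasCountableCofinality lam) (hl : IsBasicEmbedding l)
    (hh : IsElementary h) (hne : h ≠ id) (hθ : Order.IsSuccLimit θ) (hθ_lt : θ < lam)
    {B : Set (VRank lam)} (e : extendEmb l B = graphEmb h) (hcrit : critPt h < θ) :
    Avoids h θ ν := by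
  intro D hD a z ha hz hDz
  obtain ⟨σ, hσ, hθσ⟩ := hh.exists_le_ordMap hne hθ_lt hcrit
  have hν := hA.le_ordMap hlam hl hh e (hσ.trans hθ_lt) hσ hθσ
  obtain ⟨c, hc_rank, hc, hc_mem⟩ :=
    hh.isBasicEmbedding.exists_functional_restrict hlam hD (hσ.trans hθ_lt)
  have hB : Functional B := (hl.functional_iff hlam).2 (e ▸ functional_graphEmb h)
  have hc_lt : c.1.rank < θ := hc_rank.trans_lt (hθ.succ_lt (hθ.succ_lt hσ))
  refine hA _ hB.uncurry (pair a c) z (rank_pair_lt hθ ha hc_lt) hz ?_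
  rw [hl.extendEmb_uncurry hlam, e]
  exact ⟨a, c, z, h c, rfl, pair_mem_graphEmb.2 rfl,
    hc_mem a z (ha.trans_le hθσ) (hz.trans_le hν) hDz, hc⟩

theorem rank_lt (hA : Avoids l θ ν) (hl : IsElementary l) (hθ : 0 < θ) {x : VRank lam}
    (hx : (l x).1.rank < ν) : (l x).1.rank < θ := by
  refine hA {pair (numeral 0) x} (functional_singleton_pair _ x) (numeral 0) (l x) ?_ hx ?_
  · rwa [rank_numeral, Nat.cast_zero]
  · rw [hl.isBasicEmbedding.extendEmb_singleton, hl.map_pair, hl.map_numeral]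
    rfl

end Avoids

namespace IsElementary

variable {j : VRank lam → VRank lam} (hj : IsElementary j)

include hj

theorem isSuccLimit_critPt (hne : j ≠ id) : Order.IsSuccLimit (critPt j) := by
  obtain ⟨hlt, hmove, hfix⟩ := hj.critPt_spec hne
  refine ⟨fun h => ?_, Order.isSuccPrelimit_of_succ_ne fun α hα => ?_⟩
  · rw [isMin_iff_eq_bot.1 h] at hmove
    exact hmove.ne' hj.ordMap_zero
  · have hα_lt : α < critPt j := hα ▸ Order.lt_succ α
    rw [← hα, hj.ordMap_succ (hα_lt.trans hlt), hfix α hα_lt] at hmove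
    exact hmove.false

theorem exists_sup_ordMap {κ : Ordinal.{u}} (hκ : Order.IsSuccLimit κ) (hκ_lt : κ < lam) :
    ∃ θ, (∀ ρ, ρ < θ ↔ ∃ σ < κ, ρ < ordMap j σ) ∧ Order.IsSuccLimit θ ∧ κ ≤ θ ∧
      θ ≤ ordMap j κ := by
  have ordMap_lt : ∀ σ < κ, ordMap j σ < ordMap j κ := fun σ hσ =>
    (hj.ordMap_lt_iff (hσ.trans hκ_lt) hκ_lt).2 hσ
  have hbdd : BddAbove (ordMap j '' Set.Iio κ) :=
    ⟨ordMap j κ, Set.forall_mem_image.2 fun σ hσ => (ordMap_lt σ hσ).le⟩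
  have hθ : ∀ ρ, ρ < sSup (ordMap j '' Set.Iio κ) ↔ ∃ σ < κ, ρ < ordMap j σ := fun ρ => by
    rw [lt_csSup_iff hbdd ⟨_, 0, hκ.pos, rfl⟩, Set.exists_mem_image]
    rfl
  have hle : κ ≤ sSup (ordMap j '' Set.Iio κ) := le_of_forall_lt fun σ hσ =>
    (hθ σ).2 ⟨Order.succ σ, hκ.succ_lt hσ,
      (Order.lt_succ σ).trans_le (hj.le_ordMap ((hκ.succ_lt hσ).trans hκ_lt))⟩
  refine ⟨_, hθ, ⟨fun hmin => ?_, Order.isSuccPrelimit_of_succ_lt fun ρ hρ => ?_⟩, hle,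
    le_of_forall_lt fun ρ hρ => ?_⟩
  · exact (hκ.pos.trans_le hle).ne' (isMin_iff_eq_bot.1 hmin)
  · obtain ⟨σ, hσ, hρ⟩ := (hθ ρ).1 hρ
    refine (hθ _).2 ⟨Order.succ σ, hκ.succ_lt hσ, ?_⟩
    rw [hj.ordMap_succ (hσ.trans hκ_lt)]
    exact Order.succ_lt_succ hρ
  · obtain ⟨σ, hσ, hρ⟩ := (hθ ρ).1 hρ
    exact hρ.trans (ordMap_lt σ hσ)

end IsElementary

theorem eventually_avoids_of_mem_irng (hlam : HasCountableCofinality lam)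
    {l h : VRank lam → VRank lam} (hl : IsBasicEmbedding l) {θ ν : ℕ → Ordinal.{u}}
    (hθ : ∀ s, Order.IsSuccLimit (θ s)) (hθ_lt : ∀ s, θ s < lam)
    (hθ_cof : ∀ α < lam, ∀ᶠ s in Filter.atTop, α < θ s) (hA : ∀ s, Avoids l (θ s) (ν s))
    (hh : h ∈ irng l) : ∀ᶠ s in Filter.atTop, Avoids h (θ s) (ν s) := by
  have of_mem_irngZero : ∀ {f h : VRank lam → VRank lam}, IsBasicEmbedding f →
      (∀ᶠ s in Filter.atTop, Avoids f (θ s) (ν s)) → h ∈ irngZero f →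
      ∀ᶠ s in Filter.atTop, Avoids h (θ s) (ν s) := by
    rintro f h hf hAf ⟨⟨hh, hne⟩, B, e⟩
    filter_upwards [hAf, hθ_cof _ (IsElementary.critPt_spec hh hne).1] with s hs hcrit
    exact hs.of_graph hlam hf hh hne (hθ s) (hθ_lt s) e hcrit
  obtain ⟨n, hn⟩ := Set.mem_iUnion.1 hh
  clear hh
  induction n generalizing h with
  | zero => exact of_mem_irngZero hl (.of_forall hA) hn
  | succ n ih =>
    obtain ⟨f, hf, hn⟩ := Set.mem_iUnion₂.1 hn
    exact of_mem_irngZero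
      (isElementary_of_mem_irng (Set.mem_iUnion.2 ⟨n, hf⟩)).isBasicEmbedding (ih hf) hn

/-! ### Right powers -/

theorem IsElementary.exists_isRightPowers {j : VRank lam → VRank lam} (hj : IsElementary j)
    (hne : j ≠ id) : ∃ r, IsRightPowers j r := by
  have hlam := hj.hasCountableCofinality hne
  choose f hf hf_graph using
    fun l : {l : VRank lam → VRank lam // IsBasicEmbedding l} => l.2.exists_apply hlam l.2
  let r : ℕ → {l : VRank lam → VRank lam // IsBasicEmbedding l} := fun n =>
    Nat.rec ⟨j, hj.isBasicEmbedding⟩ (fun _ l => ⟨f l, hf l⟩) n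
  exact ⟨fun n => (r n).1, rfl, fun n => hf_graph (r n)⟩

end VRank

namespace IsRightPowers

open VRank Filter

variable {lam : Ordinal.{u}} [Fact (Order.IsSuccLimit lam)] {j : VRank lam → VRank lam}
  {r : ℕ → VRank lam → VRank lam} (hr : IsRightPowers j r) (hj : IsElementary j) (hne : j ≠ id)

include hr hj hne

theorem isBasicEmbedding (n : ℕ) : IsBasicEmbedding (r n) := by
  induction n with
  | zero => exact hr.1 ▸ hj.isBasicEmbedding
  | succ n ih => exact ih.apply (hj.hasCountableCofinality hne) ih (hr.2 n)

theorem isElementary (n : ℕ) : IsElementary (r n) :=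
  (hr.isBasicEmbedding hj hne n).isElementary (hj.hasCountableCofinality hne)

theorem map_stage {m n : ℕ} (hnm : n ≤ m) : r n (stage (critSeq j m) (hj.critSeq_lt hne m)) =
    stage (critSeq j (m + 1)) (hj.critSeq_lt hne (m + 1)) := by
  induction n generalizing m with
  | zero => rw [hr.1, hj.map_stage, stage_inj, critSeq_succ]
  | succ n ih =>
    obtain ⟨m, rfl⟩ := Nat.exists_eq_add_one.2 (Nat.zero_lt_of_lt hnm)
    have hnm' := Nat.le_of_succ_le_succ hnm
    rw [← ih hnm', (hr.isBasicEmbedding hj hne n).apply_map (hr.2 n), ih hnm',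
      ih (hnm'.trans m.le_succ)]

theorem ordMap_critSeq {m n : ℕ} (hnm : n ≤ m) : ordMap (r n) (critSeq j m) = critSeq j (m + 1) :=
  ordMap_eq_of_map_stage _ _ (hr.map_stage hj hne hnm)

theorem lt_ordMap (n : ℕ) : critSeq j n < ordMap (r n) (critSeq j n) :=
  (hj.critSeq_lt_succ hne n).trans_eq (hr.ordMap_critSeq hj hne le_rfl).symm

theorem map_eq_self (n : ℕ) (x : VRank lam) (hx : x.1.rank < critSeq j n) : r n x = x := by
  induction n generalizing x with
  | zero => exact hr.1 ▸ hj.map_eq_self (fun α hα _ => (hj.critPt_spec hne).2.2 α hα) x hx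
  | succ n ih =>
    refine (hr.isBasicEmbedding hj hne n).apply_eq_self (hj.hasCountableCofinality hne) (hr.2 n)
      (v := stage (critSeq j n) (hj.critSeq_lt hne n)) (fun y hy => ih y (mem_stage.1 hy)) ?_
    rw [hr.map_stage hj hne le_rfl]
    exact mem_stage.2 hx

theorem critPt_eq (n : ℕ) : critPt (r n) = critSeq j n := by
  refine (hr.isElementary hj hne n).critPt_eq_of_forall_lt (hj.critSeq_lt hne n)
    (hr.lt_ordMap hj hne n) fun α hα => ?_
  have hα_lt := hα.trans (hj.critSeq_lt hne n)
  exact ordMap_eq_of_map_stage hα_lt hα_lt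
    (hr.map_eq_self hj hne n _ ((rank_stage hα_lt).trans_lt hα))

theorem mem_rankEmb (n : ℕ) : r n ∈ RankEmb lam := by
  refine ⟨hr.isElementary hj hne n, fun h => (hr.lt_ordMap hj hne n).ne' ?_⟩
  exact ordMap_eq_of_map_stage (hj.critSeq_lt hne n) (hj.critSeq_lt hne n) (by rw [h]; rfl)

theorem liminf_critPt (t : ℕ) : liminf (fun n => critPt (r (n + t))) atTop = lam := by
  have setOf_eventually_le : {a | ∀ᶠ n in atTop, a ≤ critSeq j (n + t)} = Set.Iio lam := by
    refine Set.ext fun a => ⟨fun ha => ?_, fun ha => ?_⟩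
    · obtain ⟨n, hn⟩ := ha.exists
      exact hn.trans_lt (hj.critSeq_lt hne _)
    · obtain ⟨N, hN⟩ := hj.exists_lt_critSeq hne ha
      filter_upwards [eventually_ge_atTop N] with n hn
      exact hN.le.trans ((hj.critSeq_strictMono hne).monotone (by omega))
  have hlim : Order.IsSuccLimit lam := Fact.out
  simp only [hr.critPt_eq hj hne, liminf_eq, setOf_eventually_le]
  exact hlim.isSuccPrelimit.isLUB_Iio.csSup_eq ⟨0, hlim.pos⟩

theorem stabilizes : Stabilizes r fun n => {x | ∃ m, n = m + 1 ∧ x.1.rank < critSeq j m} := by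
  have hmono := hj.critSeq_strictMono hne
  have eventually_rank_lt : ∀ a : VRank lam, ∀ᶠ n in atTop, ∃ m, n = m + 1 ∧
      a.1.rank < critSeq j m := fun a => by
    obtain ⟨N, hN⟩ := hj.exists_lt_critSeq hne a.rank_lt
    filter_upwards [eventually_ge_atTop (N + 1)] with n hn
    obtain ⟨m, rfl⟩ := Nat.exists_eq_add_one.2 (Nat.zero_lt_of_lt hn)
    exact ⟨m, rfl, hN.trans_le (hmono.monotone (Nat.le_of_succ_le_succ hn))⟩
  refine ⟨hr.isBasicEmbedding hj hne, ?_, fun n => ?_, eventually_rank_lt, fun a => ?_⟩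
  · rintro _ b ⟨m, rfl, hb⟩
    exact hr.map_eq_self hj hne _ b (hb.trans (hmono m.lt_succ_self))
  · cases n with
    | zero => simpa using (hr.isBasicEmbedding hj hne 0).extendEmb_empty
    | succ m =>
      have hm := hj.critSeq_lt hne m
      have h := (hr.isBasicEmbedding hj hne (m + 1)).extendEmb_coe (stage (critSeq j m) hm)
      rw [hr.map_eq_self hj hne (m + 1) (stage (critSeq j m) hm)
        ((rank_stage hm).trans_lt (hmono m.lt_succ_self))] at h
      simpa only [mem_stage, Nat.add_right_cancel_iff, exists_eq_left'] using h
  · filter_upwards [eventually_rank_lt a] with n ⟨m, hn, hm⟩ w hw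
    exact ⟨m, hn, (ZFSet.rank_lt_of_mem hw).trans hm⟩

variable {K : VRank lam → VRank lam} {t : ℕ}

section Limit

variable (hK : IsPointwiseLimit (fun n => r (n + t)) K)

include hK

theorem isBasicEmbedding_lim : IsBasicEmbedding K :=
  hK.isBasicEmbedding (hj.hasCountableCofinality hne) fun _ => hr.isBasicEmbedding hj hne _

theorem isInverseLimit : IsInverseLimit (fun n => r (n + t)) K := by
  refine ⟨fun n => hr.mem_rankEmb hj hne _, hr.liminf_critPt hj hne t, fun a => ?_⟩
  obtain ⟨M, hM⟩ := hj.exists_lt_critSeq hne a.rank_lt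
  obtain ⟨n, hn, hMn⟩ := ((hK a).and (eventually_ge_atTop M)).exists
  exact ⟨n, fun i hi => hr.map_eq_self hj hne _ a (hM.trans_le
    ((hj.critSeq_strictMono hne).monotone (by omega))), hn.symm⟩

theorem lim_eq_self {x : VRank lam} (hx : x.1.rank < critSeq j t) : K x = x := by
  have map_eq : ∀ n, r (n + t) x = x := fun n => hr.map_eq_self hj hne _ x
    (hx.trans_le ((hj.critSeq_strictMono hne).monotone (Nat.le_add_left t n)))
  have compUpTo_eq : ∀ n, compUpTo (fun n => r (n + t)) n x = x := fun n => by
    induction n with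
    | zero => exact map_eq 0
    | succ n ih => rw [compUpTo, Function.comp_apply, map_eq, ih]
  obtain ⟨n, hn⟩ := (hK x).exists
  rw [← hn, compUpTo_eq]

theorem ordMap_lim {s d : ℕ} (h : t + d = s + 1) :
    ordMap K (critSeq j s) = critSeq j (s + d) := by
  refine ordMap_eq_of_map_stage (hj.critSeq_lt hne _) (hj.critSeq_lt hne _) ?_
  induction d generalizing t K with
  | zero =>
    rw [add_zero] at h
    exact hr.lim_eq_self hj hne hK
      ((rank_stage _).trans_lt (h ▸ hj.critSeq_lt_succ hne s))
  | succ d ih =>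
    obtain ⟨K', hK'⟩ := ((hr.stabilizes hj hne).shift (t + 1)).exists_isPointwiseLimit
    rw [hK.shift_eq hK', Function.comp_apply, ih hK' (by omega), hr.map_stage hj hne (by omega)]
    rfl

theorem rank_lim_lt {s d : ℕ} (h : t + d = s) {x : VRank lam} (hx : x.1.rank < critSeq j s) :
    (K x).1.rank < critSeq j (s + d) := by
  induction d generalizing t K with
  | zero => rwa [hr.lim_eq_self hj hne hK (by rwa [← h] at hx)]
  | succ d ih =>
    obtain ⟨K', hK'⟩ := ((hr.stabilizes hj hne).shift (t + 1)).exists_isPointwiseLimit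
    have ht := hr.isElementary hj hne t
    rw [hK.shift_eq hK', Function.comp_apply, ht.rank_map, ← add_assoc,
      ← hr.ordMap_critSeq hj hne (n := t) (m := s + d) (by omega),
      ht.ordMap_lt_iff (rank_lt _) (hj.critSeq_lt hne _)]
    exact ih hK' (by omega)

theorem lim_mem_rankEmb : K ∈ RankEmb lam := by
  refine ⟨(hr.isBasicEmbedding_lim hj hne hK).isElementary (hj.hasCountableCofinality hne), ?_⟩
  rintro rfl
  have h := hr.ordMap_lim hj hne hK (s := t) (d := 1) rfl
  rw [ordMap_eq_of_map_stage (j := id) (hj.critSeq_lt hne t) (hj.critSeq_lt hne t) rfl] at h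
  exact (hj.critSeq_lt_succ hne t).ne h

end Limit

theorem reflectsSigma {a : ℕ} (h : ReflectsSigma (2 * a + 1) j) (n : ℕ) :
    ReflectsSigma (2 * a + 1) (r n) := by
  have hr_basic := hr.isBasicEmbedding hj hne
  induction n with
  | zero => rwa [hr.1]
  | succ n ih =>
    exact ih.apply (hj.hasCountableCofinality hne) (hr_basic n) (hr_basic n) (hr_basic (n + 1))
      (hr.2 n) ih

-- The limit gains one level over an odd level, so it is enough that the right powers reflect
-- `Σ¹` formulas of the largest odd level `≤ m`.
theorem sigmaElementary_lim (hK : IsPointwiseLimit (fun n => r (n + t)) K) {m : ℕ}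
    (h : SigmaElementary m j) : SigmaElementary m K := by
  have hlam := hj.hasCountableCofinality hne
  have hK_basic := hr.isBasicEmbedding_lim hj hne hK
  refine ReflectsSigma.sigmaElementary ?_ hK_basic
  rcases Nat.eq_zero_or_pos m with rfl | hm
  · exact fun κ _ P hP => hK_basic.reflects_of_foDefinable hlam hP
  · have hj_reflects : ReflectsSigma (2 * ((m - 1) / 2) + 1) j :=
      (reflectsSigma_of_sigmaElementary h).mono (by omega)
    exact (((hr.stabilizes hj hne).shift t).reflectsSigma hlam hK
      fun n => hr.reflectsSigma hj hne hj_reflects _).mono (by omega)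

theorem eventually_gap (hK : IsPointwiseLimit (fun n => r (n + t)) K) {h : VRank lam → VRank lam}
    (hh : h ∈ irng K) : ∀ᶠ s in atTop, ∀ x : VRank lam,
      (h x).1.rank < critSeq j (s + t + (s + 1)) → (h x).1.rank < critSeq j (s + t + s) := by
  have hlam := hj.hasCountableCofinality hne
  have hK_basic := hr.isBasicEmbedding_lim hj hne hK
  have hK_elem := hK_basic.isElementary hlam
  have isSuccLimit_critSeq : ∀ n, Order.IsSuccLimit (critSeq j n) := fun n =>
    hr.critPt_eq hj hne n ▸
      (hr.isElementary hj hne n).isSuccLimit_critPt (hr.mem_rankEmb hj hne n).2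
  choose θ hθ hθ_lim hθ_ge hθ_le using fun s : ℕ =>
    hK_elem.exists_sup_ordMap (isSuccLimit_critSeq (s + t)) (hj.critSeq_lt hne _)
  have hθ_cof : ∀ α < lam, ∀ᶠ s in atTop, α < θ s := fun α hα => by
    obtain ⟨N, hN⟩ := hj.exists_lt_critSeq hne hα
    filter_upwards [eventually_ge_atTop N] with s hs
    exact hN.trans_le (((hj.critSeq_strictMono hne).monotone (by omega)).trans (hθ_ge s))
  have hK_avoids : ∀ s, Avoids K (θ s) (ordMap K (critSeq j (s + t))) := fun s =>
    hK_basic.avoids hlam (hr.isBasicEmbedding hj hne (s + t)) (hj.critSeq_lt hne _)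
      (hr.map_eq_self hj hne _) (hr.lt_ordMap hj hne _) (hθ s)
  filter_upwards [eventually_avoids_of_mem_irng hlam hK_basic hθ_lim
    (fun s => (hθ_le s).trans_lt (ordMap_lt K (hj.critSeq_lt hne _))) hθ_cof hK_avoids hh]
    with s hs x hx
  rw [← hr.ordMap_lim hj hne hK (s := s + t) (by omega)] at hx
  obtain ⟨σ, hσ, hxσ⟩ := (hθ s _).1 (hs.rank_lt (isElementary_of_mem_irng hh) (hθ_lim s).pos hx)
  have hσ_lt := hσ.trans (hj.critSeq_lt hne _)
  have hKσ := hr.rank_lim_lt hj hne hK (s := s + t) (d := s) (by omega) (x := stage σ hσ_lt)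
    ((rank_stage hσ_lt).trans_lt hσ)
  rw [hK_elem.rank_map, rank_stage] at hKσ
  exact hxσ.trans hKσ

-- The gaps of `k` and of `l` lie at alternating members of the critical sequence, so a common
-- member of the iterated ranges has no values of large rank at all.
theorem irng_disjoint {k l : VRank lam → VRank lam} (hk : IsPointwiseLimit r k)
    (hl : IsPointwiseLimit (fun n => r (n + 1)) l) : irng k ∩ irng l = ∅ := by
  refine Set.eq_empty_of_forall_notMem fun h ⟨hhk, hhl⟩ => ?_
  obtain ⟨N, hN⟩ := eventually_atTop.1
    ((hr.eventually_gap hj hne (t := 0) hk hhk).and (hr.eventually_gap hj hne hl hhl))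
  have step : ∀ i, 2 * N ≤ i → ∀ x : VRank lam,
      (h x).1.rank < critSeq j (i + 1) → (h x).1.rank < critSeq j i := by
    intro i hi x hx
    obtain ⟨s, rfl | rfl⟩ := Nat.even_or_odd' i
    · rw [show 2 * s = s + 0 + s by ring] at hx ⊢
      exact (hN s (by omega)).1 x hx
    · rw [show 2 * s + 1 = s + 1 + s by ring] at hx ⊢
      exact (hN s (by omega)).2 x hx
  have hcrit := hj.critSeq_lt hne (2 * N)
  have hh := isElementary_of_mem_irng hhk
  have not_lt : ∀ d, ¬ (h (stage _ hcrit)).1.rank < critSeq j (2 * N + d) := by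
    intro d
    induction d with
    | zero => exact not_lt_of_ge (by rw [hh.rank_map, rank_stage]; exact hh.le_ordMap hcrit)
    | succ d ih => exact fun hd => ih (step _ (Nat.le_add_right _ _) _ hd)
  obtain ⟨n, hn⟩ := hj.exists_lt_critSeq hne (h (stage _ hcrit)).rank_lt
  exact not_lt n (hn.trans_le ((hj.critSeq_strictMono hne).monotone (by omega)))

end IsRightPowers

theorem theorem23 (lam : Ordinal.{u}) (hlam : Order.IsSuccLimit lam) (m : ℕ)
    (j : VRank lam → VRank lam) (hj : j ∈ RankEmb lam) (hjm : SigmaElementary m j) :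
    ∃ (r : ℕ → VRank lam → VRank lam) (k l : VRank lam → VRank lam),
      IsRightPowers j r ∧
      IsInverseLimit r k ∧
      IsInverseLimit (fun n => r (n + 1)) l ∧
      k ∈ RankEmb lam ∧ SigmaElementary m k ∧
      l ∈ RankEmb lam ∧ SigmaElementary m l ∧
      irng k ∩ irng l = ∅ := by
  have : Fact (Order.IsSuccLimit lam) := ⟨hlam⟩
  obtain ⟨hj_elem : VRank.IsElementary j, hne⟩ := hj
  obtain ⟨r, hr⟩ := hj_elem.exists_isRightPowers hne
  have hr_stabilizes := hr.stabilizes hj_elem hne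
  obtain ⟨k, hk⟩ := (hr_stabilizes.shift 0).exists_isPointwiseLimit
  obtain ⟨l, hl⟩ := (hr_stabilizes.shift 1).exists_isPointwiseLimit
  exact ⟨r, k, l, hr,
    hr.isInverseLimit hj_elem hne hk, hr.isInverseLimit hj_elem hne hl,
    hr.lim_mem_rankEmb hj_elem hne hk, hr.sigmaElementary_lim hj_elem hne hk hjm,
    hr.lim_mem_rankEmb hj_elem hne hl, hr.sigmaElementary_lim hj_elem hne hl hjm,
    hr.irng_disjoint hj_elem hne hk hl⟩
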